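/- Let $d\ge 1$. Let $V\in C^3([0,\infty)\times\mathbf R^d;\mathbf R)$ with $\partial_x^\beta V\in L^\infty([0,\infty)\times\mathbf R^d)$ for $|\beta|\in\{2,3\}$, and let $K\in C^3\cap W^{3,\infty}(\mathbf R^d;\mathbf R)$. For $k\in\mathbf N$ let $$\Sigma^k=\Big\{f\in L^2(\mathbf R^d;\mathbf C):\ \|f\|_{\Sigma^k}:=\sum_{|\alpha|+|\beta|\le k}\|x^\alpha\partial_x^\beta f\|_{L^2}<\infty\Big\}.$$ Let $k\ge 1$ and $a_1,a_2\in\Sigma^k$. Let $(q_1,p_1,q_2,p_2):[0,\infty)\to\mathbf R^{4d}$ be the solution, with arbitrary initial data in $\mathbf R^{4d}$, of the system $$\dot q_1=p_1,\qquad \dot p_1=-\nabla V(t,q_1)-\|a_1\|_{L^2}^2\nabla K(0)-\|a_2\|_{L^2}^2\nabla K(q_1-q_2),$$ $$\dot q_2=p_2,\qquad \dot p_2=-\nabla V(t,q_2)-\|a_2\|_{L^2}^2\nabla K(0)-\|a_1\|_{L^2}^2\nabla K(q_2-q_1).$$ For $(j,\ell)=(1,2)$ and $(j,\ell)=(2,1)$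 put $G_j(t)=\int_{\mathbf R^d} z|u_j(t,z)|^2dz$ and $$M_j(t)=\|a_j\|_{L^2}^2\nabla^2K(0)+\|a_\ell\|_{L^2}^2\nabla^2K(q_j(t)-q_\ell(t))+\nabla_x^2V(t,q_j(t)).$$ Then the coupled nonlinear system, for $(j,\ell)=(1,2),(2,1)$, $$i\partial_tu_j+\tfrac12\Delta u_j=\tfrac12\langle y,M_j(t)y\rangle u_j-\langle\nabla^2K(0)G_j(t),y\rangle u_j-\langle\nabla^2K(q_j(t)-q_\ell(t))G_\ell(t),y\rangle u_j$$ $$\qquad+\tfrac12\Big(\int\langle z,\nabla^2K(0)z\rangle|u_j(t,z)|^2dz\Big)u_j+\tfrac12\Big(\int\langle z,\nabla^2K(q_j(t)-q_\ell(t))z\rangle|u_\ell(t,z)|^2dz\Big)u_j$$ (understood in the sense of distributions in $y$, for all $t\ge0$) has a unique solution $(u_1,u_2)\in C([0,\infty);\Sigma^k)^2$ with initial data $(u_1,u_2)|_{t=0}=(a_1,a_2)$. In addition, $\|u_j(t)\|_{L^2}=\|a_j\|_{L^2}$ for all $t\ge 0$ and $j=1,2$. -/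

import Mathlib

open MeasureTheory Set Filter Topology
open scoped ENNReal ContDiff Gradient

/-- The Euclidean space `ℝ^d`. -/
abbrev Rd (d : ℕ) := EuclideanSpace ℝ (Fin d)

/-- The Hilbert space `L²(ℝ^d; ℂ)`. -/
noncomputable abbrev L2 (d : ℕ) : Type := Lp ℂ 2 (volume : Measure (Rd d))

/-- Test functions: smooth, complex-valued, with compact support in `ℝ^d`. -/
def IsTest {d : ℕ} (φ : Rd d → ℂ) : Prop :=
  ContDiff ℝ ∞ φ ∧ HasCompactSupport φ

/-- The partial derivative `∂_i φ`. -/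
noncomputable def partialDeriv {d : ℕ} (i : Fin d) (φ : Rd d → ℂ) : Rd d → ℂ :=
  fun x => fderiv ℝ φ x (EuclideanSpace.single i 1)

/-- The iterated partial derivative `∂^β φ = ∂_0^{β_0} ⋯ ∂_{d-1}^{β_{d-1}} φ` of a smooth
function, for a multi-index `β`. -/
noncomputable def multiDeriv {d : ℕ} (β : Fin d → ℕ) (φ : Rd d → ℂ) : Rd d → ℂ :=
  (List.finRange d).foldr (fun i ψ => (partialDeriv i)^[β i] ψ) φ

/-- `g` is the weak (distributional) derivative `∂^β f`. -/
def IsWeakDeriv {d : ℕ} (β : Fin d → ℕ) (f g : Rd d → ℂ) : Prop :=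
  LocallyIntegrable g volume ∧
    ∀ φ : Rd d → ℂ, IsTest φ →
      ∫ x, f x * multiDeriv β φ x = (-1 : ℂ) ^ (∑ i, β i) * ∫ x, g x * φ x

/-- `‖x^α ∂^β f‖_{L²}`, with value `∞` if the weak derivative `∂^β f` is not a locally integrable
function. (The weak derivative is unique up to null sets, so that the infimum runs over at most
one value.) -/
noncomputable def weightedNorm {d : ℕ} (α β : Fin d → ℕ) (f : Rd d → ℂ) : ℝ≥0∞ :=
  ⨅ (g : Rd d → ℂ) (_ : IsWeakDeriv β f g),
    eLpNorm (fun x => (((∏ i, x i ^ α i : ℝ)) : ℂ) * g x) 2 volume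

/-- The pairs of multi-indices `(α, β)` with `|α| + |β| ≤ k`. -/
def indexPairs (d k : ℕ) : Finset ((Fin d → ℕ) × (Fin d → ℕ)) :=
  ((Fintype.piFinset fun _ : Fin d => Finset.range (k + 1)) ×ˢ
    (Fintype.piFinset fun _ : Fin d => Finset.range (k + 1))).filter
      fun p => ∑ i, p.1 i + ∑ i, p.2 i ≤ k

/-- The norm `‖f‖_{Σ^k} = ∑_{|α|+|β| ≤ k} ‖x^α ∂^β f‖_{L²}`, with values in `[0, ∞]`. -/
noncomputable def sigmaNorm {d : ℕ} (k : ℕ) (f : L2 d) : ℝ≥0∞ :=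
  ∑ p ∈ indexPairs d k, weightedNorm p.1 p.2 f

/-- Membership of `f ∈ L²` in the space `Σ^k`. -/
def MemSigma {d : ℕ} (k : ℕ) (f : L2 d) : Prop :=
  sigmaNorm k f < ⊤

/-- `u ∈ C([0, ∞); Σ^k)`. Values of `u` at negative times are irrelevant. -/
def ContinuousInSigma {d : ℕ} (k : ℕ) (u : ℝ → L2 d) : Prop :=
  (∀ t, 0 ≤ t → MemSigma k (u t)) ∧
    ∀ t, 0 ≤ t → Tendsto (fun s => sigmaNorm k (u s - u t)) (𝓝[Ici 0] t) (𝓝 0)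

/-- The external potential: `V` is `C³` on `[0, ∞) × ℝ^d`, real-valued, and its space derivatives
of order two and three are bounded on `[0, ∞) × ℝ^d`. -/
def AdmissiblePotential {d : ℕ} (V : ℝ → Rd d → ℝ) : Prop :=
  ContDiffOn ℝ 3 (fun z : ℝ × Rd d => V z.1 z.2) (Ici 0 ×ˢ univ) ∧
    ∃ C : ℝ, ∀ t, 0 ≤ t → ∀ x,
      ‖iteratedFDeriv ℝ 2 (V t) x‖ ≤ C ∧ ‖iteratedFDeriv ℝ 3 (V t) x‖ ≤ C

/-- The kernel: `K ∈ C³ ∩ W^{3,∞}(ℝ^d; ℝ)`. -/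
def AdmissibleKernel {d : ℕ} (K : Rd d → ℝ) : Prop :=
  ContDiff ℝ 3 K ∧ ∃ C : ℝ, ∀ n ≤ 3, ∀ x, ‖iteratedFDeriv ℝ n K x‖ ≤ C

/-- The system of modified trajectories on `[0, ∞)`, where `m₁ = ‖a₁‖²` and `m₂ = ‖a₂‖²`. -/
structure IsModifiedTrajectory {d : ℕ} (V : ℝ → Rd d → ℝ) (K : Rd d → ℝ) (m₁ m₂ : ℝ)
    (q₁ p₁ q₂ p₂ : ℝ → Rd d) : Prop where
  deriv_q₁ : ∀ t, 0 ≤ t → HasDerivWithinAt q₁ (p₁ t) (Ici 0) t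
  deriv_p₁ : ∀ t, 0 ≤ t → HasDerivWithinAt p₁
    (-∇ (V t) (q₁ t) - m₁ • ∇ K 0 - m₂ • ∇ K (q₁ t - q₂ t)) (Ici 0) t
  deriv_q₂ : ∀ t, 0 ≤ t → HasDerivWithinAt q₂ (p₂ t) (Ici 0) t
  deriv_p₂ : ∀ t, 0 ≤ t → HasDerivWithinAt p₂
    (-∇ (V t) (q₂ t) - m₂ • ∇ K 0 - m₁ • ∇ K (q₂ t - q₁ t)) (Ici 0) t

/-- The Hessian of `f` at `x` as a bilinear form: `hess f x v w = ⟨∇²f(x) v, w⟩`. -/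
noncomputable def hess {d : ℕ} (f : Rd d → ℝ) (x v w : Rd d) : ℝ :=
  fderiv ℝ (fderiv ℝ f) x v w

/-- The first moment `∫ z |f(z)|² dz ∈ ℝ^d`. -/
noncomputable def firstMoment {d : ℕ} (f : L2 d) : Rd d :=
  ∫ z, (‖f z‖ ^ 2) • z

/-- The quadratic moment `∫ ⟨z, ∇²K(x) z⟩ |f(z)|² dz`. -/
noncomputable def quadMoment {d : ℕ} (K : Rd d → ℝ) (x : Rd d) (f : L2 d) : ℝ :=
  ∫ z, hess K x z z * ‖f z‖ ^ 2

/-- The real potential that multiplies the envelope `f` on the right-hand side of its equation, at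
time `t` and at the point `y`. Here `q` is the centre and `m` the squared `L²` norm of the initial
datum of the wave packet with envelope `f`, and `q'`, `m'`, `f'` are those of the other one:
`½⟨y, M y⟩ - ⟨∇²K(0) G, y⟩ - ⟨∇²K(q - q') G', y⟩`
`+ ½ ∫ ⟨z, ∇²K(0) z⟩ |f|² + ½ ∫ ⟨z, ∇²K(q - q') z⟩ |f'|²`
with `M = m ∇²K(0) + m' ∇²K(q - q') + ∇²V(t, q)`. -/
noncomputable def envelopePotential {d : ℕ} (V : ℝ → Rd d → ℝ) (K : Rd d → ℝ) (m m' : ℝ)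
    (t : ℝ) (q q' : Rd d) (f f' : L2 d) (y : Rd d) : ℝ :=
  1 / 2 * (m * hess K 0 y y + m' * hess K (q - q') y y + hess (V t) q y y)
    - hess K 0 (firstMoment f) y - hess K (q - q') (firstMoment f') y
    + 1 / 2 * quadMoment K 0 f + 1 / 2 * quadMoment K (q - q') f'

/-- `i ∂_t u + ½ Δu = W u` on `[0, ∞) × ℝ^d`, for a real potential `W`, tested against every
`φ ∈ C_c^∞(ℝ^d)`: `d/dt ∫ u(t) φ = -i ∫ u(t) (W(t) φ - ½ Δφ)` for all `t ≥ 0`. -/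
def IsWeakSchrodinger {d : ℕ} (W : ℝ → Rd d → ℝ) (u : ℝ → L2 d) : Prop :=
  ∀ φ : Rd d → ℂ, IsTest φ → ∀ t, 0 ≤ t →
    HasDerivWithinAt (fun s => ∫ y, u s y * φ y)
      (-Complex.I * ∫ y, u t y * ((W t y : ℂ) * φ y - 1 / 2 * Laplacian.laplacian φ y))
      (Ici 0) t

/-- `(u₁, u₂) ∈ C([0, ∞); Σ^k)²` is a solution to the coupled envelope system along the
trajectories `q₁`, `q₂`, with initial data `(a₁, a₂)`. -/
structure IsEnvelopeSolution {d : ℕ} (V : ℝ → Rd d → ℝ) (K : Rd d → ℝ) (q₁ q₂ : ℝ → Rd d)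
    (k : ℕ) (a₁ a₂ : L2 d) (u₁ u₂ : ℝ → L2 d) : Prop where
  continuous₁ : ContinuousInSigma k u₁
  continuous₂ : ContinuousInSigma k u₂
  initial₁ : u₁ 0 = a₁
  initial₂ : u₂ 0 = a₂
  equation₁ : IsWeakSchrodinger
    (fun t => envelopePotential V K (‖a₁‖ ^ 2) (‖a₂‖ ^ 2) t (q₁ t) (q₂ t) (u₁ t) (u₂ t)) u₁
  equation₂ : IsWeakSchrodinger
    (fun t => envelopePotential V K (‖a₂‖ ^ 2) (‖a₁‖ ^ 2) t (q₂ t) (q₁ t) (u₂ t) (u₁ t)) u₂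

/-! The nonlinearity sees `u_j` only through its first and second moments, and the potential is a
polynomial of degree two in `y`. If the moments are regarded as given functions of time, each
equation is a linear Schrödinger equation with potential `½⟨y, M y⟩ - ⟨b, y⟩`, where `b_j = ∇²K(0)
G_j + ∇²K(q_j - q_ℓ) G_ℓ`, plus a function of time alone that a phase factor removes
(`IsWeakSchrodinger.gauge`).

For the linear equation, the Gaussians `exp(-½|y|² + ⟨z, y⟩)`, `z ∈ ℂ^d`, stay Gaussian, with
parameters obtained from linear differential equations (`exists_metaplecticFlow`,
`hasDerivAt_state`). Any weak solution in `C([0,∞); L²)` has a conserved pairing with each evolved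
Gaussian (`inner_stateL2_eq`, by cutoff), and evolved Gaussians are total in `L²` at each time by
injectivity of the Fourier transform (`ae_eq_zero_of_integral_state`). Hence Gram matrices of
Gaussians are conserved, the evolution extends to an isometry `prop`, and weak solutions are unique
(`eq_prop_of_isWeakSchrodinger`).

Differentiating the conserved pairings in `z` shows that `y_j` and `∂_j` applied to an evolved state
are combinations, with coefficients continuous in time, of the evolutions of `y_i a`, `∂_i a` and
`a` (`isMulCoord_propX`, `isWeakPartial_propD`). Induction on `k` gives persistence in `Σ^k`
(`continuousInSigma_prop`), and the same formulas give Ehrenfest's law `g'' = -M g + ‖a‖² b` for the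
first moment (`exists_moment_trajectory`).

In the coupled system Ehrenfest's law is a closed linear system for `(G₁, G₂)`: `G_j'' = -M_j G_j +
‖a_j‖² (∇²K(0) G_j + ∇²K(q_j - q_ℓ) G_ℓ)`. For existence, solve this system, evolve `a₁` and `a₂`
linearly with the resulting `b_j`, and multiply by phases; the moments then agree with the chosen
ones. For uniqueness, two solutions have the same `G_j`, hence differ by phases, hence have the same
second moments, hence the same phases (`IsCoupledSolution.eq_fst`). Conservation of the `L²` norm is
the isometry of the linear evolution. -/

/-! ### Linear differential equations in a Banach space -/

section LinearODE

variable {E : Type*} [NormedAddCommGroup E] [NormedSpace ℝ E]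

/-- The Picard iterates of the linear equation `x' = L(t) x`, `x(0) = x₀`. -/
noncomputable def picardTerm (L : ℝ → E →L[ℝ] E) (x₀ : E) : ℕ → ℝ → E
  | 0 => fun _ => x₀
  | n + 1 => fun t => ∫ s in (0 : ℝ)..t, L s (picardTerm L x₀ n s)

variable {L : ℝ → E →L[ℝ] E}

theorem continuous_picardTerm (hL : Continuous L) (x₀ : E) (n : ℕ) :
    Continuous (picardTerm L x₀ n) := by
  induction n with
  | zero => exact continuous_const
  | succ n ih =>
    exact intervalIntegral.continuous_primitive
      (fun a b => (hL.clm_apply ih).intervalIntegrable a b) 0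

theorem hasDerivAt_picardTerm_succ [CompleteSpace E] (hL : Continuous L) (x₀ : E) (n : ℕ) (t : ℝ) :
    HasDerivAt (picardTerm L x₀ (n + 1)) (L t (picardTerm L x₀ n t)) t := by
  have hc : Continuous fun s => L s (picardTerm L x₀ n s) :=
    hL.clm_apply (continuous_picardTerm hL x₀ n)
  exact intervalIntegral.integral_hasDerivAt_right (hc.intervalIntegrable 0 t)
    (hc.stronglyMeasurableAtFilter _ _) hc.continuousAt

/-- Integrating the bound for one iterate yields the bound for the next; negative times are reduced
to positive ones by reflection. The factorial makes the Picard series converge at every time, so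
global solvability needs no continuation argument. -/
theorem norm_picardTerm_le (x₀ : E) {C T : ℝ}
    (hC : ∀ t, |t| ≤ T → ‖L t‖ ≤ C) (n : ℕ) {t : ℝ} (ht : |t| ≤ T) :
    ‖picardTerm L x₀ n t‖ ≤ ‖x₀‖ * (C * |t|) ^ n / n.factorial := by
  have hC0 : 0 ≤ C := (norm_nonneg _).trans (hC t ht)
  induction n generalizing t with
  | zero => simp [picardTerm]
  | succ n ih =>
    have key : ∀ s, |s| ≤ T → ‖L s (picardTerm L x₀ n s)‖ ≤
        C * (‖x₀‖ * (C * |s|) ^ n / n.factorial) := fun s hs =>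
      ((L s).le_opNorm _).trans (by gcongr; exacts [hC s hs, ih hs])
    have hint : ∀ s : ℝ, 0 ≤ s → ∫ r in (0 : ℝ)..s, C * (‖x₀‖ * (C * r) ^ n / n.factorial) =
        ‖x₀‖ * (C * s) ^ (n + 1) / (n + 1).factorial := by
      intro s _
      have : (fun r : ℝ => C * (‖x₀‖ * (C * r) ^ n / n.factorial)) =
          fun r => (‖x₀‖ * C ^ (n + 1) / n.factorial) * r ^ n := by
        funext r; ring
      rw [this, intervalIntegral.integral_const_mul, integral_pow, Nat.factorial_succ]
      have : ((n : ℝ) + 1) ≠ 0 := by positivity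
      push_cast
      field_simp
      simp [mul_pow, mul_assoc]
    have hcont : Continuous fun r : ℝ => C * (‖x₀‖ * (C * r) ^ n / n.factorial) := by fun_prop
    rcases le_total 0 t with h0 | h0
    · rw [abs_of_nonneg h0] at ht ⊢
      rw [← hint t h0]
      refine intervalIntegral.norm_integral_le_of_norm_le h0 (ae_of_all _ fun s hs => ?_)
        (hcont.intervalIntegrable 0 t)
      have := key s (by rw [abs_of_pos hs.1]; exact hs.2.trans ht)
      rwa [abs_of_pos hs.1] at this
    · rw [abs_of_nonpos h0] at ht ⊢
      rw [← hint (-t) (by linarith)]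
      have hneg : picardTerm L x₀ (n + 1) t =
          - ∫ r in (0 : ℝ)..(-t), L (-r) (picardTerm L x₀ n (-r)) := by
        have := intervalIntegral.integral_comp_neg (a := 0) (b := -t)
          (fun r => L r (picardTerm L x₀ n r))
        rw [this, neg_neg, neg_zero, ← intervalIntegral.integral_symm]
        rfl
      rw [hneg, norm_neg]
      refine intervalIntegral.norm_integral_le_of_norm_le (by linarith)
        (ae_of_all _ fun s hs => ?_) (hcont.intervalIntegrable 0 (-t))
      have := key (-s) (by rw [abs_neg, abs_of_pos hs.1]; exact hs.2.trans ht)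
      rwa [abs_neg, abs_of_pos hs.1] at this

/-- Global solvability of linear differential equations with continuous coefficients. -/
theorem exists_linearODE_solution [CompleteSpace E] (hL : Continuous L) (x₀ : E) :
    ∃ x : ℝ → E, x 0 = x₀ ∧ ∀ t, HasDerivAt x (L t (x t)) t := by
  have bound : ∀ T : ℝ, ∃ C, ∀ t, |t| ≤ T → ‖L t‖ ≤ C := by
    intro T
    obtain ⟨C, hC⟩ := (isCompact_Icc (a := -T) (b := T)).exists_bound_of_continuousOn
      hL.continuousOn
    exact ⟨C, fun t ht => hC t (abs_le.1 ht)⟩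
  have summ : ∀ t, Summable fun n => picardTerm L x₀ n t := by
    intro t
    obtain ⟨C, hC⟩ := bound |t|
    refine Summable.of_norm_bounded (g := fun n => ‖x₀‖ * ((C * |t|) ^ n / n.factorial))
      ((Real.summable_pow_div_factorial _).mul_left _) fun n => ?_
    rw [← mul_div_assoc]
    exact norm_picardTerm_le x₀ hC n le_rfl
  refine ⟨fun t => ∑' n, picardTerm L x₀ n t, ?_, fun t => ?_⟩
  · beta_reduce
    rw [tsum_eq_single 0]
    · rfl
    · rintro (_ | n) hn
      · exact absurd rfl hn
      · simp [picardTerm]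
  -- The interval of radius `|t| + 1` is a neighbourhood of `t` on which the derivatives of the
  -- iterates are dominated by an exponential series.
  · obtain ⟨C, hC⟩ := bound (|t| + 1)
    have hC0 : 0 ≤ C := (norm_nonneg _).trans (hC t (by linarith))
    have htm : t ∈ Ioo (-(|t| + 1)) (|t| + 1) := abs_lt.1 (by linarith)
    have h := hasDerivAt_tsum_of_isPreconnected
      (u := fun n => C * (‖x₀‖ * ((C * (|t| + 1)) ^ n / n.factorial)))
      (t := Ioo (-(|t| + 1)) (|t| + 1))
      (g := fun n => picardTerm L x₀ (n + 1)) (g' := fun n s => L s (picardTerm L x₀ n s))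
      (((Real.summable_pow_div_factorial _).mul_left _).mul_left _) isOpen_Ioo
      isPreconnected_Ioo (fun n s _ => hasDerivAt_picardTerm_succ hL x₀ n s)
      (fun n s hs => by
        have hs' : |s| ≤ |t| + 1 := (abs_lt.2 hs).le
        refine ((L s).le_opNorm _).trans ?_
        have := norm_picardTerm_le x₀ hC n hs'
        rw [mul_div_assoc] at this
        refine mul_le_mul (hC s hs') (this.trans ?_) (norm_nonneg _) hC0
        gcongr)
      htm ((summable_nat_add_iff 1).2 (summ t)) htm
    rw [← ContinuousLinearMap.map_tsum _ (summ t)] at h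
    -- The zeroth iterate is constant and is split off: the derivative of iterate `n + 1` involves
    -- iterate `n`, so the differentiated tail is `L` applied to the whole series.
    have h2 : (fun s => ∑' n, picardTerm L x₀ n s) =
        fun s => x₀ + ∑' n, picardTerm L x₀ (n + 1) s := by
      funext s
      rw [(summ s).tsum_eq_zero_add]
      rfl
    have h3 := h.const_add x₀
    rw [← h2] at h3
    exact h3

/-- Uniqueness for linear differential equations on `[0, ∞)`. -/
theorem linearODE_unique_Ici (hL : Continuous L) {x y : ℝ → E}
    (hx : ∀ t, 0 ≤ t → HasDerivWithinAt x (L t (x t)) (Ici 0) t)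
    (hy : ∀ t, 0 ≤ t → HasDerivWithinAt y (L t (y t)) (Ici 0) t) (h0 : x 0 = y 0)
    {t : ℝ} (ht : 0 ≤ t) : x t = y t := by
  obtain ⟨C, hC⟩ := (isCompact_Icc (a := 0) (b := t)).exists_bound_of_continuousOn
    hL.continuousOn
  have hC0 : 0 ≤ C := (norm_nonneg _).trans (hC 0 ⟨le_rfl, ht⟩)
  refine ODE_solution_unique_of_mem_Icc_right (v := fun s z => L s z) (s := fun _ => univ)
    (K := ⟨C, hC0⟩) (a := 0) (b := t) ?_ ?_ ?_ ?_ ?_ ?_ ?_ h0 ⟨ht, le_rfl⟩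
  · intro s hs
    refine LipschitzWith.lipschitzOnWith ?_
    refine (L s).lipschitz.weaken ?_
    exact hC s ⟨hs.1, hs.2.le⟩
  · exact fun s hs => ((hx s hs.1).mono Icc_subset_Ici_self).continuousWithinAt
  · exact fun s hs => (hx s hs.1).mono (Ici_subset_Ici.2 hs.1)
  · simp
  · exact fun s hs => ((hy s hs.1).mono Icc_subset_Ici_self).continuousWithinAt
  · exact fun s hs => (hy s hs.1).mono (Ici_subset_Ici.2 hs.1)
  · simp

end LinearODE

/-! ### Pairings, dominated convergence and differentiation in `L²` -/

section L2Calculus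

variable {d : ℕ}

theorem norm_toLp_sq {f : Rd d → ℂ} (hf : MemLp f 2 volume) :
    ‖(hf.toLp f : L2 d)‖ ^ 2 = ∫ y, ‖f y‖ ^ 2 := by
  have h := inner_self_eq_norm_sq_to_K (𝕜 := ℂ) (hf.toLp f : L2 d)
  rw [L2.inner_def] at h
  have h2 : ∫ y, inner ℂ ((hf.toLp f : L2 d) y) ((hf.toLp f : L2 d) y) =
      ∫ y, ((‖f y‖ ^ 2 : ℝ) : ℂ) := by
    refine integral_congr_ae ?_
    filter_upwards [hf.coeFn_toLp] with y hy
    rw [hy, inner_self_eq_norm_sq_to_K]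
    push_cast
    rfl
  rw [h2, integral_complex_ofReal] at h
  exact Complex.ofReal_injective (by rw [Complex.ofReal_pow]; exact h.symm)

theorem inner_toLp {f : Rd d → ℂ} (hf : MemLp f 2 volume) (g : L2 d) :
    inner ℂ (hf.toLp f : L2 d) g = ∫ y, (starRingEnd ℂ) (f y) * g y := by
  rw [L2.inner_def]
  refine integral_congr_ae ?_
  filter_upwards [hf.coeFn_toLp] with y hy
  rw [hy, RCLike.inner_apply, mul_comm]

theorem integrable_mul_L2 {f : Rd d → ℂ} (hf : MemLp f 2 volume) (g : L2 d) :
    Integrable (fun y => f y * g y) volume :=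
  MemLp.integrable_mul hf (Lp.memLp g)

theorem integrable_star_mul_L2 {f : Rd d → ℂ} (hf : MemLp f 2 volume) (g : L2 d) :
    Integrable (fun y => (starRingEnd ℂ) (f y) * g y) volume :=
  MemLp.integrable_mul (f := fun y => (starRingEnd ℂ) (f y)) hf.star (Lp.memLp g)

/-- Dominated convergence in `L²`. -/
theorem tendsto_toLp_of_dominated {ι : Type*} {l : Filter ι} [l.IsCountablyGenerated] [l.NeBot]
    {F : ι → Rd d → ℂ} {f : Rd d → ℂ} {g : Rd d → ℝ} (hF : ∀ i, MemLp (F i) 2 volume)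
    (hf : MemLp f 2 volume) (hg : MemLp g 2 volume)
    (bound : ∀ᶠ i in l, ∀ y, ‖F i y‖ ≤ g y)
    (lim : ∀ y, Tendsto (fun i => F i y) l (𝓝 (f y))) :
    Tendsto (fun i => ((hF i).toLp (F i) : L2 d)) l (𝓝 (hf.toLp f)) := by
  have hfb : ∀ y, ‖f y‖ ≤ g y := fun y =>
    le_of_tendsto (lim y).norm (bound.mono fun i hi => hi y)
  have hsq : Tendsto (fun i => ∫ y, ‖F i y - f y‖ ^ 2) l (𝓝 (∫ y : Rd d, (0 : ℝ))) := by
    refine tendsto_integral_filter_of_dominated_convergence (fun y => 4 * ‖g y‖ ^ 2) ?_ ?_ ?_ ?_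
    · exact Eventually.of_forall fun i => (((hF i).sub hf).1.norm.pow 2)
    · filter_upwards [bound] with i hi
      refine ae_of_all _ fun y => ?_
      have h1 : ‖F i y - f y‖ ≤ 2 * ‖g y‖ := by
        refine (norm_sub_le _ _).trans ?_
        have := le_abs_self (g y)
        rw [Real.norm_eq_abs]
        linarith [hi y, hfb y]
      rw [Real.norm_of_nonneg (by positivity)]
      calc ‖F i y - f y‖ ^ 2 ≤ (2 * ‖g y‖) ^ 2 := by gcongr
        _ = 4 * ‖g y‖ ^ 2 := by ring
    · exact ((memLp_two_iff_integrable_sq_norm hg.1).1 hg).const_mul 4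
    · refine ae_of_all _ fun y => ?_
      have := ((lim y).sub_const (f y)).norm.pow 2
      simpa using this
  rw [integral_zero] at hsq
  rw [tendsto_iff_norm_sub_tendsto_zero]
  have h3 := hsq.sqrt
  rw [Real.sqrt_zero] at h3
  refine h3.congr fun i => ?_
  have := norm_toLp_sq ((hF i).sub hf)
  rw [MemLp.toLp_sub (hF i) hf] at this
  rw [← Real.sqrt_sq (norm_nonneg (((hF i).toLp (F i) : L2 d) - hf.toLp f)), this]
  rfl

/-- Differentiation in `L²` of a family of functions with a dominated pointwise derivative. -/
theorem hasDerivAt_toLp {f f' : ℝ → Rd d → ℂ} {g : Rd d → ℝ} {t ε : ℝ}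
    (hf : ∀ s, MemLp (f s) 2 volume) (hf' : MemLp (f' t) 2 volume) (hg : MemLp g 2 volume)
    (hε : 0 < ε) (hderiv : ∀ s ∈ Metric.ball t ε, ∀ y, HasDerivAt (fun r => f r y) (f' s y) s)
    (bound : ∀ s ∈ Metric.ball t ε, ∀ y, ‖f' s y‖ ≤ g y) :
    HasDerivAt (fun s => ((hf s).toLp (f s) : L2 d)) (hf'.toLp (f' t)) t := by
  rw [hasDerivAt_iff_tendsto_slope]
  have hmem : ∀ s, MemLp (fun y => (s - t)⁻¹ • (f s y - f t y)) 2 volume := fun s =>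
    (((hf s).sub (hf t)).const_smul ((s - t)⁻¹ : ℝ) :)
  have hslope : slope (fun s => ((hf s).toLp (f s) : L2 d)) t =
      fun s => ((hmem s).toLp _ : L2 d) := by
    funext s
    rw [slope, vsub_eq_sub, ← MemLp.toLp_sub]
    rfl
  rw [hslope]
  refine tendsto_toLp_of_dominated hmem hf' hg ?_ ?_
  · have hb : ∀ᶠ s in 𝓝[≠] t, s ∈ Metric.ball t ε :=
      eventually_nhdsWithin_of_eventually_nhds (Metric.ball_mem_nhds t hε)
    filter_upwards [hb, self_mem_nhdsWithin] with s hs hne y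
    -- The mean value inequality turns the bound on the derivative into the same bound on difference
    -- quotients, to which dominated convergence applies.
    have h1 := (convex_ball t ε).norm_image_sub_le_of_norm_hasDerivWithin_le
      (f := fun r => f r y) (f' := fun r => f' r y) (C := g y)
      (fun r hr => (hderiv r hr y).hasDerivWithinAt) (fun r hr => bound r hr y)
      (Metric.mem_ball_self hε) hs
    have hpos : 0 < ‖s - t‖ := norm_pos_iff.2 (sub_ne_zero.2 hne)
    rw [norm_smul, norm_inv, inv_mul_le_iff₀ hpos, mul_comm]
    exact h1
  · intro y
    exact hasDerivAt_iff_tendsto_slope.1 (hderiv t (Metric.mem_ball_self hε) y)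

end L2Calculus

/-! ### The dominating weight for Gaussian states -/

section GaussianWeight

variable {d : ℕ}

/-- The weight `(1 + |y|²) exp(-c |y|²)`. -/
noncomputable def gaussWeight (c : ℝ) (y : Rd d) : ℝ := (1 + ‖y‖ ^ 2) * Real.exp (-c * ‖y‖ ^ 2)

theorem gaussWeight_nonneg (c : ℝ) (y : Rd d) : 0 ≤ gaussWeight c y := by
  unfold gaussWeight; positivity

theorem continuous_gaussWeight (c : ℝ) : Continuous (gaussWeight c : Rd d → ℝ) := by
  unfold gaussWeight; fun_prop

theorem one_add_sq_le_exp {c : ℝ} (hc : 0 < c) (r : ℝ) :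
    1 + r ^ 2 ≤ (1 + 1 / c) * Real.exp (c * r ^ 2) := by
  have h1 := Real.add_one_le_exp (c * r ^ 2)
  have h2 : 1 ≤ Real.exp (c * r ^ 2) := Real.one_le_exp (by positivity)
  have h3 : r ^ 2 ≤ 1 / c * Real.exp (c * r ^ 2) := by
    rw [one_div, ← div_eq_inv_mul, le_div_iff₀ hc]; linarith
  linarith

/-- Half of the exponent absorbs the quadratic factor: this is `one_add_sq_le_exp` with constant `c
/ 2`. -/
theorem gaussWeight_le {c : ℝ} (hc : 0 < c) (y : Rd d) :
    gaussWeight c y ≤ (1 + 2 / c) * Real.exp (-(c / 2) * ‖y‖ ^ 2) := by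
  have := one_add_sq_le_exp (half_pos hc) ‖y‖
  unfold gaussWeight
  calc _ ≤ (1 + 1 / (c / 2)) * Real.exp (c / 2 * ‖y‖ ^ 2) * Real.exp (-c * ‖y‖ ^ 2) := by gcongr
    _ = _ := by
      rw [mul_assoc, ← Real.exp_add]
      congr 2
      · field_simp
      · ring

theorem integrable_exp_neg_mul_sq_norm {c : ℝ} (hc : 0 < c) :
    Integrable (fun y : Rd d => Real.exp (-c * ‖y‖ ^ 2)) volume := by
  have := (GaussianFourier.integrable_cexp_neg_mul_sq_norm_add (V := Rd d) (b := (c : ℂ))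
    (by simpa using hc) 0 0).norm
  refine this.congr (ae_of_all _ fun y => ?_)
  simp only [Complex.norm_exp]
  congr 1
  simp [← Complex.ofReal_pow]

theorem memLp_gaussWeight {c : ℝ} (hc : 0 < c) : MemLp (gaussWeight c : Rd d → ℝ) 2 volume := by
  rw [memLp_two_iff_integrable_sq_norm (continuous_gaussWeight c).aestronglyMeasurable]
  refine (((integrable_exp_neg_mul_sq_norm (d := d) hc)).const_mul ((1 + 2 / c) ^ 2)).mono'
    ((continuous_gaussWeight c).norm.pow 2).aestronglyMeasurable (ae_of_all _ fun y => ?_)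
  rw [norm_pow, norm_norm, Real.norm_of_nonneg (gaussWeight_nonneg c y)]
  calc _ ≤ ((1 + 2 / c) * Real.exp (-(c / 2) * ‖y‖ ^ 2)) ^ 2 := by
        gcongr
        · exact gaussWeight_nonneg c y
        · exact gaussWeight_le hc y
    _ = _ := by
      rw [mul_pow, ← Real.exp_nat_mul]
      congr 2
      push_cast
      ring

/-- The criterion for square integrability of Gaussians, their derivatives and their cutoff errors,
all of which are Gaussians times functions of at most quadratic growth. -/
theorem memLp_of_le_gaussWeight {f : Rd d → ℂ} (hf : Continuous f) {C c : ℝ} (hc : 0 < c)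
    (h : ∀ y, ‖f y‖ ≤ C * gaussWeight c y) : MemLp f 2 volume := by
  refine ((memLp_gaussWeight (d := d) hc).const_mul C).mono hf.aestronglyMeasurable
    (ae_of_all _ fun y => (h y).trans (le_abs_self _))

end GaussianWeight

/-! ### Rules for partial derivatives and the Laplacian -/

section PartialDerivatives

variable {d : ℕ}

theorem partialDeriv_eq_of_hasDerivAt {φ : Rd d → ℂ} {x : Rd d} {i : Fin d} {φ' : ℂ}
    (hφ : DifferentiableAt ℝ φ x)
    (h : HasDerivAt (fun t : ℝ => φ (x + t • EuclideanSpace.single i (1 : ℝ))) φ' 0) :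
    partialDeriv i φ x = φ' := by
  rw [partialDeriv, ← hφ.lineDeriv_eq_fderiv]
  exact h.deriv

theorem partialDeriv_mul {φ ψ : Rd d → ℂ} {x : Rd d} (i : Fin d) (hφ : DifferentiableAt ℝ φ x)
    (hψ : DifferentiableAt ℝ ψ x) :
    partialDeriv i (fun y => φ y * ψ y) x = partialDeriv i φ x * ψ x + φ x * partialDeriv i ψ x := by
  simp only [partialDeriv]
  rw [fderiv_fun_mul hφ hψ]
  simp
  ring

theorem partialDeriv_add {φ ψ : Rd d → ℂ} {x : Rd d} (i : Fin d) (hφ : DifferentiableAt ℝ φ x)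
    (hψ : DifferentiableAt ℝ ψ x) :
    partialDeriv i (fun y => φ y + ψ y) x = partialDeriv i φ x + partialDeriv i ψ x := by
  simp only [partialDeriv]
  rw [fderiv_fun_add hφ hψ]
  simp

theorem partialDeriv_const_mul {φ : Rd d → ℂ} {x : Rd d} (i : Fin d) (c : ℂ)
    (hφ : DifferentiableAt ℝ φ x) :
    partialDeriv i (fun y => c * φ y) x = c * partialDeriv i φ x := by
  simp only [partialDeriv]
  rw [fderiv_const_mul hφ c]
  simp

theorem contDiff_partialDeriv {φ : Rd d → ℂ} {n m : ℕ∞ω} (i : Fin d) (hφ : ContDiff ℝ n φ)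
    (hmn : m + 1 ≤ n) : ContDiff ℝ m (partialDeriv i φ) :=
  (hφ.fderiv_right hmn).clm_apply contDiff_const

theorem laplacian_eq_sum_partialDeriv {φ : Rd d → ℂ} (hφ : ContDiff ℝ 2 φ) (x : Rd d) :
    Laplacian.laplacian φ x = ∑ i, partialDeriv i (partialDeriv i φ) x := by
  rw [InnerProductSpace.laplacian_eq_iteratedFDeriv_orthonormalBasis φ
    (EuclideanSpace.basisFun (Fin d) ℝ)]
  refine Finset.sum_congr rfl fun i _ => ?_
  rw [iteratedFDeriv_two_apply]
  have h1 : DifferentiableAt ℝ (fderiv ℝ φ) x :=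
    ((hφ.fderiv_right (m := 1) (by norm_num)).differentiable (by norm_num)) x
  change _ = fderiv ℝ (fun y => fderiv ℝ φ y (EuclideanSpace.single i 1)) x _
  rw [fderiv_clm_apply h1 (differentiableAt_const _)]
  simp

theorem contDiff_coord (i : Fin d) {n : ℕ∞ω} : ContDiff ℝ n (fun y : Rd d => ((y i : ℝ) : ℂ)) :=
  Complex.ofRealCLM.contDiff.comp (EuclideanSpace.proj (𝕜 := ℝ) i).contDiff

theorem hasDerivAt_coord_line (x : Rd d) (i k : Fin d) :
    HasDerivAt (fun t : ℝ => (((x + t • EuclideanSpace.single k (1 : ℝ) : Rd d) i : ℝ) : ℂ))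
      (if i = k then 1 else 0) 0 := by
  have h : (fun t : ℝ => (((x + t • EuclideanSpace.single k (1 : ℝ) : Rd d) i : ℝ) : ℂ)) =
      fun t : ℝ => ((x i : ℝ) : ℂ) + (t : ℂ) * (if i = k then 1 else 0) := by
    funext t
    by_cases h : i = k <;> simp [h]
  rw [h]
  have := ((Complex.ofRealCLM.hasDerivAt (x := (0 : ℝ))).mul_const
    (if i = k then (1 : ℂ) else 0)).const_add ((x i : ℝ) : ℂ)
  simpa using this

theorem partialDeriv_coord (i k : Fin d) (x : Rd d) :
    partialDeriv k (fun y : Rd d => ((y i : ℝ) : ℂ)) x = if i = k then 1 else 0 :=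
  partialDeriv_eq_of_hasDerivAt ((contDiff_coord (n := 1) i).differentiable (by norm_num) x)
    (hasDerivAt_coord_line x i k)

end PartialDerivatives

/-! ### Complex Gaussians: derivatives and decay -/

section Gaussian

variable {d : ℕ}

/-- The quadratic form `∑ P_ij y_i y_j`. -/
noncomputable def quadForm (P : Matrix (Fin d) (Fin d) ℂ) (y : Rd d) : ℂ :=
  ∑ i, ∑ j, P i j * ((y i : ℝ) : ℂ) * ((y j : ℝ) : ℂ)

/-- The linear form `∑ ζ_i y_i`. -/
noncomputable def linForm (ζ : Fin d → ℂ) (y : Rd d) : ℂ := ∑ i, ζ i * ((y i : ℝ) : ℂ)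

/-- The Gaussian `exp(-½ ∑ P_ij y_i y_j + ∑ ζ_i y_i + s)`. -/
noncomputable def gauss (P : Matrix (Fin d) (Fin d) ℂ) (ζ : Fin d → ℂ) (s : ℂ) (y : Rd d) : ℂ :=
  Complex.exp (-(1 / 2) * quadForm P y + linForm ζ y + s)

theorem contDiff_linForm (ζ : Fin d → ℂ) {n : ℕ∞ω} : ContDiff ℝ n (linForm ζ) :=
  ContDiff.sum fun i _ => contDiff_const.mul (contDiff_coord i)

theorem contDiff_quadForm (P : Matrix (Fin d) (Fin d) ℂ) {n : ℕ∞ω} : ContDiff ℝ n (quadForm P) :=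
  ContDiff.sum fun i _ => ContDiff.sum fun j _ =>
    (contDiff_const.mul (contDiff_coord i)).mul (contDiff_coord j)

theorem contDiff_gauss (P : Matrix (Fin d) (Fin d) ℂ) (ζ : Fin d → ℂ) (s : ℂ) {n : ℕ∞ω} :
    ContDiff ℝ n (gauss P ζ s) :=
  (((contDiff_const.mul (contDiff_quadForm P)).add (contDiff_linForm ζ)).add contDiff_const).cexp

theorem partialDeriv_linForm (ζ : Fin d → ℂ) (k : Fin d) (x : Rd d) :
    partialDeriv k (linForm ζ) x = ζ k := by
  refine partialDeriv_eq_of_hasDerivAt ((contDiff_linForm (n := 1) ζ).differentiable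
    (by norm_num) x) ?_
  have := HasDerivAt.fun_sum (u := Finset.univ)
    (fun i _ => (hasDerivAt_coord_line x i k).const_mul (ζ i))
  simpa [linForm] using this

/-- The `k`-th component of the gradient of the exponent of a Gaussian. -/
noncomputable def gaussGrad (P : Matrix (Fin d) (Fin d) ℂ) (ζ : Fin d → ℂ) (k : Fin d) (y : Rd d) :
    ℂ :=
  ζ k - linForm (P k) y

theorem partialDeriv_gauss {P : Matrix (Fin d) (Fin d) ℂ} (hP : ∀ i j, P i j = P j i)
    (ζ : Fin d → ℂ) (s : ℂ) (k : Fin d) (x : Rd d) :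
    partialDeriv k (gauss P ζ s) x = gaussGrad P ζ k x * gauss P ζ s x := by
  refine partialDeriv_eq_of_hasDerivAt ((contDiff_gauss (n := 1) P ζ s).differentiable
    (by norm_num) x) ?_
  have hq := HasDerivAt.fun_sum (u := Finset.univ) (fun i _ =>
    HasDerivAt.fun_sum (u := Finset.univ) (fun j _ =>
      ((hasDerivAt_coord_line x i k).const_mul (P i j)).mul (hasDerivAt_coord_line x j k)))
  have hl := HasDerivAt.fun_sum (u := Finset.univ)
    (fun i _ => (hasDerivAt_coord_line x i k).const_mul (ζ i))
  have := (((hq.const_mul (-(1 / 2) : ℂ)).add hl).add_const s).cexp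
  refine this.congr_deriv ?_
  -- Symmetry of `P` identifies the two halves of the derivative of the quadratic form, so that the
  -- factor `½` cancels.
  have h1 : ∑ i, P i k * ((x i : ℝ) : ℂ) = linForm (P k) x :=
    Finset.sum_congr rfl fun i _ => by rw [hP]
  simp only [zero_smul, add_zero, mul_ite, mul_one, mul_zero, ite_mul, zero_mul,
    Finset.sum_add_distrib, Finset.sum_ite_eq', Finset.mem_univ, if_true, Pi.add_apply, Pi.mul_apply,
    Finset.sum_ite_irrel, Finset.sum_const_zero, h1]
  have h2 : ∑ i, P k i * ((x i : ℝ) : ℂ) = linForm (P k) x := rfl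
  have h3 : ∑ i, ζ i * ((x i : ℝ) : ℂ) = linForm ζ x := rfl
  rw [h2, h3, gaussGrad, gauss, quadForm]
  ring

theorem contDiff_gaussGrad (P : Matrix (Fin d) (Fin d) ℂ) (ζ : Fin d → ℂ) (k : Fin d) {n : ℕ∞ω} :
    ContDiff ℝ n (gaussGrad P ζ k) :=
  contDiff_const.sub (contDiff_linForm _)

theorem partialDeriv_gaussGrad (P : Matrix (Fin d) (Fin d) ℂ) (ζ : Fin d → ℂ) (i k : Fin d)
    (x : Rd d) : partialDeriv k (gaussGrad P ζ i) x = - P i k := by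
  have h := partialDeriv_add (φ := fun _ => ζ i) (ψ := fun y => (-1 : ℂ) * linForm (P i) y)
    (x := x) k (differentiableAt_const _)
    (((contDiff_linForm (n := 1) (P i)).differentiable (by norm_num) x).const_mul _)
  rw [partialDeriv_const_mul k (-1) ((contDiff_linForm (n := 1) (P i)).differentiable
    (by norm_num) x), partialDeriv_linForm] at h
  have h2 : (fun y => ζ i + (-1 : ℂ) * linForm (P i) y) = gaussGrad P ζ i := by
    funext y; simp [gaussGrad, sub_eq_add_neg]
  rw [h2] at h
  rw [h]
  simp [partialDeriv]

theorem laplacian_gauss {P : Matrix (Fin d) (Fin d) ℂ} (hP : ∀ i j, P i j = P j i)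
    (ζ : Fin d → ℂ) (s : ℂ) (x : Rd d) :
    Laplacian.laplacian (gauss P ζ s) x =
      ((∑ k, gaussGrad P ζ k x ^ 2) - ∑ k, P k k) * gauss P ζ s x := by
  rw [laplacian_eq_sum_partialDeriv (contDiff_gauss P ζ s), sub_mul, Finset.sum_mul,
    Finset.sum_mul, ← Finset.sum_sub_distrib]
  refine Finset.sum_congr rfl fun k _ => ?_
  have : partialDeriv k (gauss P ζ s) = fun y => gaussGrad P ζ k y * gauss P ζ s y :=
    funext fun y => partialDeriv_gauss hP ζ s k y
  rw [this, partialDeriv_mul k ((contDiff_gaussGrad (n := 1) P ζ k).differentiable (by norm_num) x)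
    ((contDiff_gauss (n := 1) P ζ s).differentiable (by norm_num) x), partialDeriv_gaussGrad,
    partialDeriv_gauss hP]
  ring

theorem abs_coord_le (y : Rd d) (i : Fin d) : ‖((y i : ℝ) : ℂ)‖ ≤ ‖y‖ := by
  rw [Complex.norm_real]
  exact PiLp.norm_apply_le y i

theorem norm_linForm_le {ζ : Fin d → ℂ} {Z : ℝ} (hζ : ∀ i, ‖ζ i‖ ≤ Z) (y : Rd d) :
    ‖linForm ζ y‖ ≤ d * Z * ‖y‖ := by
  refine (norm_sum_le _ _).trans ((Finset.sum_le_card_nsmul _ _ (Z * ‖y‖) fun i _ => ?_).trans ?_)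
  · rw [norm_mul]
    have := (norm_nonneg _).trans (hζ i)
    gcongr
    exacts [hζ i, abs_coord_le y i]
  · simp [mul_assoc]

/-- Of the decay `-(c/2)‖y‖²` one half is spent on the linear term: completing the square gives
`dZ‖y‖ ≤ (dZ)²/c + (c/4)‖y‖²`. -/
theorem norm_gauss_le {P : Matrix (Fin d) (Fin d) ℂ} {ζ : Fin d → ℂ} {s : ℂ} {c Z : ℝ}
    (hc : 0 < c) (y : Rd d) (hP : c * ‖y‖ ^ 2 ≤ (quadForm P y).re) (hζ : ∀ i, ‖ζ i‖ ≤ Z) :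
    ‖gauss P ζ s y‖ ≤ Real.exp (s.re + (d * Z) ^ 2 / c) * Real.exp (-(c / 4) * ‖y‖ ^ 2) := by
  rw [gauss, Complex.norm_exp, ← Real.exp_add]
  refine Real.exp_le_exp.2 ?_
  have h1 : (linForm ζ y).re ≤ d * Z * ‖y‖ :=
    ((Complex.re_le_norm _).trans (norm_linForm_le hζ y))
  have h2 : d * Z * ‖y‖ ≤ (d * Z) ^ 2 / c + c / 4 * ‖y‖ ^ 2 := by
    have h4 : 0 ≤ (d * Z - c / 2 * ‖y‖) ^ 2 / c := by positivity
    have h5 : (d * Z - c / 2 * ‖y‖) ^ 2 / c =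
        (d * Z) ^ 2 / c + c / 4 * ‖y‖ ^ 2 - d * Z * ‖y‖ := by
      field_simp; ring
    linarith
  have h3 : (-(1 / 2) * quadForm P y + linForm ζ y + s).re =
      -(1 / 2) * (quadForm P y).re + (linForm ζ y).re + s.re := by
    have : (-(1 / 2) : ℂ) = ((-(1 / 2) : ℝ) : ℂ) := by push_cast; ring
    rw [this, Complex.add_re, Complex.add_re, Complex.re_ofReal_mul]
  rw [h3]
  nlinarith

/-- A Gaussian with positive definite real part times a function of quadratic growth. -/
theorem norm_mul_gauss_le {P : Matrix (Fin d) (Fin d) ℂ} {ζ : Fin d → ℂ} {s : ℂ} {c Z B : ℝ}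
    (hc : 0 < c) {y : Rd d} (hP : c * ‖y‖ ^ 2 ≤ (quadForm P y).re) (hζ : ∀ i, ‖ζ i‖ ≤ Z)
    {p : ℂ} (hp : ‖p‖ ≤ B * (1 + ‖y‖ ^ 2)) :
    ‖p * gauss P ζ s y‖ ≤
      (B * Real.exp (s.re + (d * Z) ^ 2 / c)) * gaussWeight (c / 4) y := by
  rw [norm_mul]
  calc _ ≤ (B * (1 + ‖y‖ ^ 2)) *
        (Real.exp (s.re + (d * Z) ^ 2 / c) * Real.exp (-(c / 4) * ‖y‖ ^ 2)) := by
        gcongr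
        · exact (norm_nonneg _).trans hp
        · exact norm_gauss_le hc y hP hζ
    _ = _ := by unfold gaussWeight; ring

end Gaussian

/-! ### The classical flow and the parameters of Gaussian states -/

section MatrixCalculus

open scoped Matrix Matrix.Norms.Operator

variable {d : ℕ}

theorem HasDerivAt.matrix_entry {F : ℝ → Matrix (Fin d) (Fin d) ℂ} {F' : Matrix (Fin d) (Fin d) ℂ}
    {t : ℝ} (h : HasDerivAt F F' t) (i j : Fin d) : HasDerivAt (fun s => F s i j) (F' i j) t :=
  ((Matrix.entryLinearMap ℝ ℂ i j).toContinuousLinearMap.hasFDerivAt (x := F t)).comp_hasDerivAt t h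

theorem HasDerivAt.matrix_transpose {F : ℝ → Matrix (Fin d) (Fin d) ℂ}
    {F' : Matrix (Fin d) (Fin d) ℂ} {t : ℝ} (h : HasDerivAt F F' t) :
    HasDerivAt (fun s => (F s)ᵀ) F'ᵀ t :=
  ((Matrix.transposeLinearEquiv (Fin d) (Fin d) ℝ ℂ).toLinearMap.toContinuousLinearMap.hasFDerivAt
    (x := F t)).comp_hasDerivAt t h

theorem HasDerivAt.matrix_conjTranspose {F : ℝ → Matrix (Fin d) (Fin d) ℂ}
    {F' : Matrix (Fin d) (Fin d) ℂ} {t : ℝ} (h : HasDerivAt F F' t) :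
    HasDerivAt (fun s => (F s)ᴴ) F'ᴴ t :=
  ((Matrix.conjTransposeLinearEquiv (Fin d) (Fin d) ℝ ℂ).toLinearMap.toContinuousLinearMap.hasFDerivAt
    (x := F t)).comp_hasDerivAt t h

theorem HasDerivAt.matrix_inv {F : ℝ → Matrix (Fin d) (Fin d) ℂ}
    {F' : Matrix (Fin d) (Fin d) ℂ} {t : ℝ} (h : HasDerivAt F F' t) (hu : IsUnit (F t)) :
    HasDerivAt (fun s => (F s)⁻¹) (-((F t)⁻¹ * F' * (F t)⁻¹)) t := by
  obtain ⟨u, hu⟩ := hu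
  have h1 := hasFDerivAt_ringInverse (𝕜 := ℝ) u
  rw [hu] at h1
  have h2 := h1.comp_hasDerivAt t h
  have h3 : (↑u⁻¹ : Matrix (Fin d) (Fin d) ℂ) = (F t)⁻¹ := by
    rw [← hu, Matrix.coe_units_inv]
  rw [h3] at h2
  refine (h2.congr_deriv ?_).congr_of_eventuallyEq (Eventually.of_forall fun s => ?_)
  · simp
  · exact Matrix.nonsing_inv_eq_ringInverse _

theorem HasDerivAt.matrix_mulVec {F : ℝ → Matrix (Fin d) (Fin d) ℂ}
    {F' : Matrix (Fin d) (Fin d) ℂ} {v : ℝ → Fin d → ℂ} {v' : Fin d → ℂ} {t : ℝ}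
    (h : HasDerivAt F F' t) (hv : HasDerivAt v v' t) :
    HasDerivAt (fun s => F s *ᵥ v s) (F' *ᵥ v t + F t *ᵥ v') t := by
  rw [hasDerivAt_pi] at hv ⊢
  intro i
  have := HasDerivAt.fun_sum (u := Finset.univ) fun j _ => (h.matrix_entry i j).mul (hv j)
  refine this.congr_deriv ?_
  simp [Matrix.mulVec, dotProduct, Finset.sum_add_distrib]

theorem hasDerivAt_integral_of_continuous {E : Type*} [NormedAddCommGroup E] [NormedSpace ℝ E]
    [CompleteSpace E] {f : ℝ → E} (hf : Continuous f) (t : ℝ) :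
    HasDerivAt (fun u => ∫ s in (0 : ℝ)..u, f s) (f t) t :=
  intervalIntegral.integral_hasDerivAt_right (hf.intervalIntegrable 0 t)
    (hf.stronglyMeasurableAtFilter _ _) hf.continuousAt

theorem eq_const_of_hasDerivAt_zero {E : Type*} [NormedAddCommGroup E] [NormedSpace ℝ E]
    {f : ℝ → E} (hf : ∀ t, HasDerivAt f 0 t) (t : ℝ) : f t = f 0 :=
  is_const_of_deriv_eq_zero (fun s => (hf s).differentiableAt) (fun s => (hf s).deriv) t 0

/-- The complexification of a real matrix. -/
def complexify (M : Matrix (Fin d) (Fin d) ℝ) : Matrix (Fin d) (Fin d) ℂ := M.map (fun r : ℝ => (r : ℂ))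

theorem continuous_complexify {M : ℝ → Matrix (Fin d) (Fin d) ℝ} (hM : Continuous M) :
    Continuous fun t => complexify (M t) :=
  hM.matrix_map Complex.continuous_ofReal

/-- A matrix solution of Newton's equation `A'' = -M A`. The imaginary initial momentum encodes the
Gaussian `exp(-½|y|²)`: the matrix `-i B A⁻¹` equals `1` at time zero. Linearising in this way
avoids solving a Riccati equation globally. -/
theorem exists_hamiltonian_flow {M : ℝ → Matrix (Fin d) (Fin d) ℝ} (hM : Continuous M) :
    ∃ A B : ℝ → Matrix (Fin d) (Fin d) ℂ, A 0 = 1 ∧ B 0 = Complex.I • 1 ∧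
      (∀ t, HasDerivAt A (B t) t) ∧ ∀ t, HasDerivAt B (-(complexify (M t) * A t)) t := by
  let E := Matrix (Fin d) (Fin d) ℂ
  let L : ℝ → (E × E) →L[ℝ] (E × E) := fun t =>
    (ContinuousLinearMap.snd ℝ E E).prod
      (-((ContinuousLinearMap.mul ℝ E (complexify (M t))).comp (ContinuousLinearMap.fst ℝ E E)))
  have hL : Continuous L := by
    have h1 : Continuous fun t => ContinuousLinearMap.mul ℝ E (complexify (M t)) :=
      (ContinuousLinearMap.mul ℝ E).continuous.comp (continuous_complexify hM)
    exact (ContinuousLinearMap.prodₗᵢ ℝ (E := E × E) (F := E) (G := E) (𝕜 := ℝ)).continuous.comp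
      (continuous_const.prodMk (h1.clm_comp continuous_const).neg)
  obtain ⟨x, hx0, hx⟩ := exists_linearODE_solution hL ((1 : E), Complex.I • (1 : E))
  refine ⟨fun t => (x t).1, fun t => (x t).2, by simp [hx0], by simp [hx0], fun t => ?_,
    fun t => ?_⟩
  · exact (hx t).fst
  · exact (hx t).snd

/-- The evolution of the parameters of Gaussian states under the quadratic Hamiltonian
`-½Δ + ½⟨y, M(t) y⟩ - ⟨b(t), y⟩`. -/
structure MetaplecticFlow (M : ℝ → Matrix (Fin d) (Fin d) ℝ) (b : ℝ → Fin d → ℝ) where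
  (A B R N P Z : ℝ → Matrix (Fin d) (Fin d) ℂ)
  (β ν w : ℝ → Fin d → ℂ)
  s₁ : ℝ → ℂ
  A_zero : A 0 = 1
  B_zero : B 0 = Complex.I • 1
  P_zero : P 0 = 1
  R_zero : R 0 = 1
  N_zero : N 0 = 0
  Z_zero : Z 0 = 1
  β_zero : β 0 = 0
  ν_zero : ν 0 = 0
  w_zero : w 0 = 0
  s₁_zero : s₁ 0 = 0
  A_mul_R : ∀ t, A t * (R t)ᵀ = 1
  P_symm : ∀ t i j, P t i j = P t j i
  P_pos : ∀ T : ℝ, ∃ c > 0, ∀ t, |t| ≤ T → ∀ y : Rd d, c * ‖y‖ ^ 2 ≤ (quadForm (P t) y).re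
  A_deriv : ∀ t, HasDerivAt A (B t) t
  B_deriv : ∀ t, HasDerivAt B (-(complexify (M t) * A t)) t
  P_deriv : ∀ t, HasDerivAt P (Complex.I • (complexify (M t) - P t * P t)) t
  R_deriv : ∀ t, HasDerivAt R (-(Complex.I • (P t * R t))) t
  N_deriv : ∀ t, HasDerivAt N ((R t)ᵀ * R t) t
  AN_deriv : ∀ t, HasDerivAt (fun t => A t * N t) (Z t) t
  Z_deriv : ∀ t, HasDerivAt Z (-(complexify (M t) * (A t * N t))) t
  β_deriv : ∀ t, HasDerivAt β ((A t)ᵀ *ᵥ fun k => (b t k : ℂ)) t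
  ν_deriv : ∀ t, HasDerivAt ν ((R t)ᵀ *ᵥ (R t *ᵥ β t)) t
  Aν_deriv : ∀ t, HasDerivAt (fun t => A t *ᵥ ν t) (w t) t
  w_deriv : ∀ t, HasDerivAt w (-(complexify (M t) *ᵥ (A t *ᵥ ν t)) + fun k => (b t k : ℂ)) t
  s₁_deriv : ∀ t, HasDerivAt s₁
    (-(Complex.I / 2) * ((R t *ᵥ β t) ⬝ᵥ (R t *ᵥ β t)) - Complex.I / 2 * (P t).trace) t

theorem norm_sq_eq_dotProduct (y : Rd d) :
    ‖y‖ ^ 2 = ∑ i, ‖((y i : ℝ) : ℂ)‖ ^ 2 := by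
  rw [EuclideanSpace.norm_sq_eq]
  simp

theorem exists_metaplecticFlow {M : ℝ → Matrix (Fin d) (Fin d) ℝ} {b : ℝ → Fin d → ℝ}
    (hM : Continuous M) (hMs : ∀ t, (M t).IsSymm) (hb : Continuous b) :
    Nonempty (MetaplecticFlow M b) := by
  obtain ⟨A, B, hA0, hB0, hA, hB⟩ := exists_hamiltonian_flow hM
  have hMt : ∀ t, (complexify (M t))ᵀ = complexify (M t) := fun t => by
    ext i j
    simp only [complexify, Matrix.transpose_apply, Matrix.map_apply]
    rw [(hMs t).apply]
  have hMh : ∀ t, (complexify (M t))ᴴ = complexify (M t) := fun t => by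
    ext i j
    simp only [complexify, Matrix.conjTranspose_apply, Matrix.map_apply]
    rw [(hMs t).apply]
    simp
  -- First symplectic invariant, from the symmetry of `M`: it will make `B A⁻¹` symmetric.
  have cons1 : ∀ t, (A t)ᵀ * B t = (B t)ᵀ * A t := by
    have h : ∀ t, HasDerivAt (fun t => (A t)ᵀ * B t - (B t)ᵀ * A t) 0 t := fun t => by
      refine (((hA t).matrix_transpose.mul (hB t)).sub
        ((hB t).matrix_transpose.mul (hA t))).congr_deriv ?_
      rw [Matrix.transpose_neg, Matrix.transpose_mul, hMt]
      noncomm_ring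
    intro t
    have := eq_const_of_hasDerivAt_zero h t
    simp only [hA0, hB0] at this
    rw [← sub_eq_zero, this]
    simp
  -- Second invariant, which also uses that `M` is real: it gives both the invertibility of `A` and
  -- the positivity of the real part of `P`.
  have cons2 : ∀ t, (A t)ᴴ * B t - (B t)ᴴ * A t = (2 * Complex.I) • (1 : Matrix (Fin d) (Fin d) ℂ) := by
    have h : ∀ t, HasDerivAt (fun t => (A t)ᴴ * B t - (B t)ᴴ * A t) 0 t := fun t => by
      refine (((hA t).matrix_conjTranspose.mul (hB t)).sub
        ((hB t).matrix_conjTranspose.mul (hA t))).congr_deriv ?_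
      rw [Matrix.conjTranspose_neg, Matrix.conjTranspose_mul, hMh]
      noncomm_ring
    intro t
    have := eq_const_of_hasDerivAt_zero h t
    simp only [hA0, hB0] at this
    rw [this]
    simp [Matrix.conjTranspose_smul, two_mul, add_smul]
  have form : ∀ t (v : Fin d → ℂ), star (A t *ᵥ v) ⬝ᵥ (B t *ᵥ v) - star (B t *ᵥ v) ⬝ᵥ (A t *ᵥ v) =
      2 * Complex.I * (star v ⬝ᵥ v) := fun t v => by
    rw [Matrix.star_mulVec, Matrix.star_mulVec, ← Matrix.dotProduct_mulVec,
      ← Matrix.dotProduct_mulVec, Matrix.mulVec_mulVec, Matrix.mulVec_mulVec, ← dotProduct_sub,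
      ← Matrix.sub_mulVec, cons2, Matrix.smul_mulVec, Matrix.one_mulVec, dotProduct_smul, smul_eq_mul]
  -- On the kernel of `A` the left side of `form` vanishes, which forces `|v|² = 0`.
  have hunit : ∀ t, IsUnit (A t) := fun t => by
    rw [← Matrix.mulVec_injective_iff_isUnit]
    refine (injective_iff_map_eq_zero (A t).mulVecLin).2 fun v hv => ?_
    have hv' : A t *ᵥ v = 0 := hv
    have := form t v
    rw [hv', star_zero, zero_dotProduct, dotProduct_zero, sub_zero, eq_comm, mul_eq_zero] at this
    open scoped ComplexOrder in
    exact dotProduct_star_self_eq_zero.1 (this.resolve_left (by simp))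
  have hdet : ∀ t, IsUnit (A t).det := fun t => (Matrix.isUnit_iff_isUnit_det _).1 (hunit t)
  -- With `R = A⁻ᵀ` and `P = -i B A⁻¹`, the linear flow yields the Riccati equation `P' = i (M -
  -- P²)` and the transport equation `R' = -i P R`.
  let R : ℝ → Matrix (Fin d) (Fin d) ℂ := fun t => ((A t)⁻¹)ᵀ
  let P : ℝ → Matrix (Fin d) (Fin d) ℂ := fun t => -(Complex.I • (B t * (A t)⁻¹))
  have hAR : ∀ t, A t * (R t)ᵀ = 1 := fun t => by
    simp only [R, Matrix.transpose_transpose]; exact Matrix.mul_nonsing_inv _ (hdet t)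
  have hRA : ∀ t, R t * (A t)ᵀ = 1 := fun t => by
    have := congrArg Matrix.transpose (hAR t)
    rwa [Matrix.transpose_mul, Matrix.transpose_transpose, Matrix.transpose_one] at this
  have hinv : ∀ t, HasDerivAt (fun s => (A s)⁻¹) (-((A t)⁻¹ * B t * (A t)⁻¹)) t := fun t =>
    (hA t).matrix_inv (hunit t)
  have hsymm : ∀ t, (B t * (A t)⁻¹)ᵀ = B t * (A t)⁻¹ := fun t => by
    have h1 : (B t)ᵀ = (A t)ᵀ * B t * (A t)⁻¹ := by
      rw [cons1, mul_assoc, Matrix.mul_nonsing_inv _ (hdet t), mul_one]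
    rw [Matrix.transpose_mul, h1, ← mul_assoc, ← mul_assoc]
    have := hRA t
    simp only [R] at this
    rw [this, one_mul]
  have hPs : ∀ t, (P t)ᵀ = P t := fun t => by
    simp only [P, Matrix.transpose_neg, Matrix.transpose_smul, hsymm]
  have hR : ∀ t, HasDerivAt R (-(Complex.I • (P t * R t))) t := fun t => by
    refine (hinv t).matrix_transpose.congr_deriv ?_
    rw [Matrix.transpose_neg, mul_assoc, Matrix.transpose_mul, hsymm]
    simp [P, R, smul_smul]
  have hP : ∀ t, HasDerivAt P (Complex.I • (complexify (M t) - P t * P t)) t := fun t => by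
    refine ((((hB t).mul (hinv t)).const_smul Complex.I).neg).congr_deriv ?_
    simp only [P, neg_mul, mul_neg, neg_neg, smul_mul_smul_comm, Complex.I_mul_I]
    rw [mul_assoc (complexify (M t)), Matrix.mul_nonsing_inv _ (hdet t), mul_one]
    simp only [smul_add, smul_sub, smul_neg, neg_smul, one_smul, mul_assoc]
    abel
  have hcont : ∀ {F F' : ℝ → Matrix (Fin d) (Fin d) ℂ}, (∀ t, HasDerivAt F (F' t) t) →
      Continuous F := fun h => continuous_iff_continuousAt.2 fun t => (h t).continuousAt
  have hRc := hcont hR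
  have hAc := hcont hA
  have hPc := hcont hP
  let β : ℝ → Fin d → ℂ := fun t => ∫ s in (0 : ℝ)..t, (A s)ᵀ *ᵥ fun k => (b s k : ℂ)
  have hβ : ∀ t, HasDerivAt β ((A t)ᵀ *ᵥ fun k => (b t k : ℂ)) t :=
    hasDerivAt_integral_of_continuous (hAc.matrix_transpose.matrix_mulVec (by fun_prop))
  have hβc : Continuous β := continuous_iff_continuousAt.2 fun t => (hβ t).continuousAt
  have hN := hasDerivAt_integral_of_continuous (hRc.matrix_transpose.matrix_mul hRc)
  have hν := hasDerivAt_integral_of_continuous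
    (hRc.matrix_transpose.matrix_mulVec (hRc.matrix_mulVec hβc))
  have hs := hasDerivAt_integral_of_continuous
    (f := fun t => -(Complex.I / 2) * ((R t *ᵥ β t) ⬝ᵥ (R t *ᵥ β t)) -
      Complex.I / 2 * (P t).trace) (by
      have h1 : Continuous fun t => R t *ᵥ β t := hRc.matrix_mulVec hβc
      exact (continuous_const.mul (h1.dotProduct h1)).sub (continuous_const.mul hPc.matrix_trace))
  set N : ℝ → Matrix (Fin d) (Fin d) ℂ := fun t => ∫ s in (0 : ℝ)..t, (R s)ᵀ * R s
  set ν : ℝ → Fin d → ℂ := fun t => ∫ s in (0 : ℝ)..t, (R s)ᵀ *ᵥ (R s *ᵥ β s)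
  set s₁ : ℝ → ℂ := fun t => ∫ s in (0 : ℝ)..t, (-(Complex.I / 2) * ((R s *ᵥ β s) ⬝ᵥ (R s *ᵥ β s)) -
      Complex.I / 2 * (P s).trace)
  -- This identity makes the term with `R'` cancel the one with `N'` (respectively `ν'`) when the
  -- momenta of `A N` and `A ν` are differentiated.
  have hIPR : ∀ t, Complex.I • (P t * R t) = B t * ((R t)ᵀ * R t) := fun t => by
    simp [P, R, smul_smul, mul_assoc]
  -- Because `A Rᵀ = 1`, the derivatives of `A N` and `A ν` are `B N + R` and `B ν + R β`. Thus `A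
  -- N` is the solution of the homogeneous Newton equation with initial position `0` and momentum
  -- `1`, and `A ν` is the solution with force `b` that starts at rest.
  refine ⟨⟨A, B, R, N, P, fun t => B t * N t + R t, β, ν, fun t => B t *ᵥ ν t + R t *ᵥ β t, s₁,
    hA0, hB0, ?_, ?_, ?_, ?_, ?_, ?_, ?_, ?_, hAR, ?_, ?_, hA, hB, hP, hR, hN, ?_, ?_, hβ, hν, ?_,
    ?_, hs⟩⟩
  · simp [P, hA0, hB0, smul_smul]
  · simp [R, hA0]
  · simp [N]
  · simp [N, R, hA0]
  · simp [β]
  · simp [ν]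
  · simp [ν, β]
  · simp [s₁]
  · intro t i j
    have := congrFun (congrFun (hPs t) j) i
    exact this
  · intro T
    obtain ⟨K, hK⟩ := (isCompact_Icc (a := -T) (b := T)).exists_bound_of_continuousOn
      (f := fun t => fun p : Fin d × Fin d => A t p.1 p.2)
      (continuous_pi fun p : Fin d × Fin d => hAc.matrix_elem p.1 p.2).continuousOn
    have hK' : ∀ t, |t| ≤ T → ∀ i j, ‖A t i j‖ ≤ |K| := fun t ht i j =>
      (norm_le_pi_norm (fun p : Fin d × Fin d => A t p.1 p.2) (i, j)).trans
        ((hK t (abs_le.1 ht)).trans (le_abs_self _))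
    -- Writing `y = A v`, the real part of the form is `|v|²`, while `|y|² ≤ d² K² |v|²` since the
    -- entries of `A` are bounded by `|K|`. The added `1` keeps the denominator positive.
    refine ⟨1 / ((d : ℝ) ^ 2 * K ^ 2 + 1), by positivity, fun t ht y => ?_⟩
    set yc : Fin d → ℂ := fun i => ((y i : ℝ) : ℂ) with hyc
    set v := (A t)⁻¹ *ᵥ yc with hv
    have hAv : A t *ᵥ v = yc := by
      rw [hv, Matrix.mulVec_mulVec, Matrix.mul_nonsing_inv _ (hdet t), Matrix.one_mulVec]
    -- As `y` is real, the form is `-i` times the pairing of `A v` with `B v`, whose imaginary part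
    -- is `|v|²` by the second invariant.
    have hre : (quadForm (P t) y).re = ∑ i, ‖v i‖ ^ 2 := by
      have h1 : quadForm (P t) y = -Complex.I * (star (A t *ᵥ v) ⬝ᵥ (B t *ᵥ v)) := by
        have h2 : B t *ᵥ v = (B t * (A t)⁻¹) *ᵥ yc := by rw [hv, Matrix.mulVec_mulVec]
        rw [hAv, h2]
        simp only [quadForm, P, dotProduct, Matrix.mulVec, Pi.star_apply, Finset.mul_sum, yc,
          Matrix.neg_apply, Matrix.smul_apply, smul_eq_mul, Complex.star_def, Complex.conj_ofReal]
        refine Finset.sum_congr rfl fun i _ => Finset.sum_congr rfl fun j _ => ?_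
        ring
      have h3 : star (star (A t *ᵥ v) ⬝ᵥ (B t *ᵥ v)) = star (B t *ᵥ v) ⬝ᵥ (A t *ᵥ v) := by
        rw [Matrix.star_dotProduct, star_star]
      have h4 := form t v
      rw [← h3] at h4
      have h5 : star v ⬝ᵥ v = ((∑ i, ‖v i‖ ^ 2 : ℝ) : ℂ) := by
        simp only [dotProduct, Pi.star_apply, Complex.star_def, Complex.conj_mul']
        push_cast
        rfl
      rw [h5] at h4
      rw [h1]
      have h6 := congrArg Complex.im h4
      simp only [Complex.sub_im, Complex.star_def, Complex.conj_im, Complex.mul_im, Complex.mul_re,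
        Complex.re_ofNat, Complex.im_ofNat, Complex.I_re, Complex.I_im, Complex.ofReal_re,
        Complex.ofReal_im] at h6
      simp only [Complex.mul_re, Complex.neg_re, Complex.neg_im, Complex.I_re, Complex.I_im]
      linarith
    rw [hre]
    have hy : ‖y‖ ^ 2 ≤ (d : ℝ) ^ 2 * K ^ 2 * ∑ i, ‖v i‖ ^ 2 := by
      rw [norm_sq_eq_dotProduct]
      have h1 : ∀ i, ‖((y i : ℝ) : ℂ)‖ ^ 2 ≤ d * K ^ 2 * ∑ j, ‖v j‖ ^ 2 := fun i => by
        have h2 : ((y i : ℝ) : ℂ) = ∑ j, A t i j * v j := (congrFun hAv i).symm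
        have h3 : ‖((y i : ℝ) : ℂ)‖ ≤ |K| * ∑ j, ‖v j‖ := by
          rw [h2, Finset.mul_sum]
          refine (norm_sum_le _ _).trans (Finset.sum_le_sum fun j _ => ?_)
          rw [norm_mul]
          gcongr
          exact hK' t ht i j
        have h4 : (∑ j, ‖v j‖) ^ 2 ≤ d * ∑ j, ‖v j‖ ^ 2 := by
          simpa using sq_sum_le_card_mul_sum_sq (s := Finset.univ) (f := fun j => ‖v j‖)
        calc ‖((y i : ℝ) : ℂ)‖ ^ 2 ≤ (|K| * ∑ j, ‖v j‖) ^ 2 := by gcongr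
          _ = K ^ 2 * (∑ j, ‖v j‖) ^ 2 := by rw [mul_pow, sq_abs]
          _ ≤ K ^ 2 * (d * ∑ j, ‖v j‖ ^ 2) := by gcongr
          _ = _ := by ring
      refine (Finset.sum_le_sum fun i _ => h1 i).trans (le_of_eq ?_)
      simp
      ring
    have hS : 0 ≤ ∑ i, ‖v i‖ ^ 2 := by positivity
    rw [one_div, inv_mul_le_iff₀ (by positivity)]
    nlinarith
  · intro t
    refine ((hA t).mul (hN t)).congr_deriv ?_
    rw [← mul_assoc, hAR, one_mul]
  · intro t
    refine (((hB t).mul (hN t)).add (hR t)).congr_deriv ?_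
    rw [hIPR]
    noncomm_ring
  · intro t
    refine ((hA t).matrix_mulVec (hν t)).congr_deriv ?_
    rw [Matrix.mulVec_mulVec, hAR, Matrix.one_mulVec]
  · intro t
    refine (((hB t).matrix_mulVec (hν t)).add ((hR t).matrix_mulVec (hβ t))).congr_deriv ?_
    rw [hIPR]
    simp only [Matrix.mulVec_mulVec, hRA, Matrix.one_mulVec, Matrix.neg_mulVec]
    abel

end MatrixCalculus

/-! ### Evolved Gaussians solve the linear equation; uniform bounds -/

section GaussianStates

open scoped Matrix Matrix.Norms.Operator

variable {d : ℕ}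

/-- The vector of coordinates, as a complex vector. -/
def coordVec (y : Rd d) : Fin d → ℂ := fun i => ((y i : ℝ) : ℂ)

theorem quadForm_eq (P : Matrix (Fin d) (Fin d) ℂ) (y : Rd d) :
    quadForm P y = coordVec y ⬝ᵥ (P *ᵥ coordVec y) := by
  simp only [quadForm, dotProduct, Matrix.mulVec, coordVec, Finset.mul_sum]
  refine Finset.sum_congr rfl fun i _ => Finset.sum_congr rfl fun j _ => ?_
  ring

theorem linForm_eq (ζ : Fin d → ℂ) (y : Rd d) : linForm ζ y = ζ ⬝ᵥ coordVec y := rfl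

theorem gaussGrad_eq (P : Matrix (Fin d) (Fin d) ℂ) (ζ : Fin d → ℂ) (k : Fin d) (y : Rd d) :
    gaussGrad P ζ k y = (ζ - P *ᵥ coordVec y) k := rfl

/-- The potential `½⟨y, M(t) y⟩ - ⟨b(t), y⟩`. -/
noncomputable def quadPotential (M : ℝ → Matrix (Fin d) (Fin d) ℝ) (b : ℝ → Fin d → ℝ) (t : ℝ)
    (y : Rd d) : ℝ :=
  1 / 2 * (∑ i, ∑ j, M t i j * y i * y j) - ∑ i, b t i * y i

theorem ofReal_quadPotential (M : ℝ → Matrix (Fin d) (Fin d) ℝ) (b : ℝ → Fin d → ℝ) (t : ℝ)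
    (y : Rd d) : (quadPotential M b t y : ℂ) =
      1 / 2 * quadForm (complexify (M t)) y - linForm (fun i => (b t i : ℂ)) y := by
  simp [quadPotential, quadForm, linForm, complexify]

namespace MetaplecticFlow

variable {M : ℝ → Matrix (Fin d) (Fin d) ℝ} {b : ℝ → Fin d → ℝ} (F : MetaplecticFlow M b)

theorem continuous_A : Continuous F.A :=
  continuous_iff_continuousAt.2 fun t => (F.A_deriv t).continuousAt
theorem continuous_P : Continuous F.P :=
  continuous_iff_continuousAt.2 fun t => (F.P_deriv t).continuousAt
theorem continuous_R : Continuous F.R :=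
  continuous_iff_continuousAt.2 fun t => (F.R_deriv t).continuousAt
theorem continuous_N : Continuous F.N :=
  continuous_iff_continuousAt.2 fun t => (F.N_deriv t).continuousAt
theorem continuous_β : Continuous F.β :=
  continuous_iff_continuousAt.2 fun t => (F.β_deriv t).continuousAt
theorem continuous_ν : Continuous F.ν :=
  continuous_iff_continuousAt.2 fun t => (F.ν_deriv t).continuousAt
theorem continuous_s₁ : Continuous F.s₁ :=
  continuous_iff_continuousAt.2 fun t => (F.s₁_deriv t).continuousAt

/-- The linear term in the exponent of the evolved Gaussian. -/
noncomputable def zeta (t : ℝ) (z : Fin d → ℂ) : Fin d → ℂ := F.R t *ᵥ (z + Complex.I • F.β t)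

/-- The constant term in the exponent of the evolved Gaussian. -/
noncomputable def phase (t : ℝ) (z : Fin d → ℂ) : ℂ :=
  F.s₁ t + Complex.I / 2 * (z ⬝ᵥ (F.N t *ᵥ z)) - F.ν t ⬝ᵥ z

/-- The Gaussian `exp(-½|y|² + ⟨z, y⟩)`, evolved up to time `t`. -/
noncomputable def state (t : ℝ) (z : Fin d → ℂ) : Rd d → ℂ :=
  gauss (F.P t) (F.zeta t z) (F.phase t z)

theorem R_mul_A (t : ℝ) : F.R t * (F.A t)ᵀ = 1 := by
  have := congrArg Matrix.transpose (F.A_mul_R t)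
  rwa [Matrix.transpose_mul, Matrix.transpose_transpose, Matrix.transpose_one] at this

theorem zeta_zero (z : Fin d → ℂ) : F.zeta 0 z = z := by
  simp [zeta, F.R_zero, F.β_zero]

/-- Since `R` is invertible, every linear exponent is reached at time `t`, in particular the
imaginary ones. This is what makes the evolved family total. -/
theorem exists_zeta_eq (t : ℝ) (ζ : Fin d → ℂ) : ∃ z, F.zeta t z = ζ := by
  refine ⟨(F.A t)ᵀ *ᵥ ζ - Complex.I • F.β t, ?_⟩
  rw [zeta, sub_add_cancel, Matrix.mulVec_mulVec, R_mul_A, Matrix.one_mulVec]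

theorem hasDerivAt_zeta (t : ℝ) (z : Fin d → ℂ) :
    HasDerivAt (fun t => F.zeta t z)
      (-(Complex.I • (F.P t *ᵥ F.zeta t z)) + Complex.I • fun k => (b t k : ℂ)) t := by
  have := (F.R_deriv t).matrix_mulVec (((F.β_deriv t).const_smul Complex.I).const_add z)
  refine this.congr_deriv ?_
  rw [Matrix.mulVec_smul, Matrix.mulVec_mulVec, R_mul_A, Matrix.one_mulVec, Matrix.neg_mulVec,
    Matrix.smul_mulVec, zeta, Matrix.mulVec_mulVec]
  rfl

theorem dotProduct_RR (t : ℝ) (u v : Fin d → ℂ) :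
    u ⬝ᵥ (((F.R t)ᵀ * F.R t) *ᵥ v) = (F.R t *ᵥ u) ⬝ᵥ (F.R t *ᵥ v) := by
  rw [← Matrix.mulVec_mulVec, Matrix.dotProduct_mulVec, Matrix.vecMul_transpose]

/-- Expanding `ζ · ζ` with `ζ = R (z + iβ)` in powers of `z`, the quadratic, linear and constant
parts are the derivatives built into `N`, `ν` and `s₁`. -/
theorem hasDerivAt_phase (t : ℝ) (z : Fin d → ℂ) :
    HasDerivAt (fun t => F.phase t z)
      (Complex.I / 2 * (F.zeta t z ⬝ᵥ F.zeta t z) - Complex.I / 2 * (F.P t).trace) t := by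
  have hN : HasDerivAt (fun t => F.N t *ᵥ z) (((F.R t)ᵀ * F.R t) *ᵥ z) t :=
    ((F.N_deriv t).matrix_mulVec (hasDerivAt_const t z)).congr_deriv (by simp)
  have dot : ∀ {v : ℝ → Fin d → ℂ} {v' : Fin d → ℂ}, HasDerivAt v v' t →
      HasDerivAt (fun t => z ⬝ᵥ v t) (z ⬝ᵥ v') t := fun hv =>
    HasDerivAt.fun_sum fun i _ => ((hasDerivAt_pi.1 hv i).const_mul (z i))
  have h1 := (((F.s₁_deriv t).add ((dot hN).const_mul (Complex.I / 2))).sub (dot (F.ν_deriv t)))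
  have h2 : (fun t => F.phase t z) = (fun t => F.s₁ t) + (fun t => Complex.I / 2 * (z ⬝ᵥ (F.N t *ᵥ z))) -
      fun t => z ⬝ᵥ F.ν t := by
    funext t
    simp [phase, dotProduct_comm]
  rw [h2]
  refine h1.congr_deriv ?_
  rw [dotProduct_RR, Matrix.mulVec_mulVec, dotProduct_RR, zeta, Matrix.mulVec_add,
    Matrix.mulVec_smul, add_dotProduct, dotProduct_add, dotProduct_add, smul_dotProduct,
    dotProduct_smul, dotProduct_smul, smul_dotProduct,
    dotProduct_comm (F.R t *ᵥ F.β t) (F.R t *ᵥ z)]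
  simp only [smul_eq_mul]
  linear_combination (-(Complex.I / 2) * ((F.R t *ᵥ F.β t) ⬝ᵥ (F.R t *ᵥ F.β t)) -
    ((F.R t *ᵥ z) ⬝ᵥ (F.R t *ᵥ F.β t))) * Complex.I_mul_I

/-- The logarithmic time derivative of the evolved Gaussian. -/
noncomputable def stateRate (t : ℝ) (z : Fin d → ℂ) (y : Rd d) : ℂ :=
  -Complex.I * (quadPotential M b t y -
    1 / 2 * ((∑ k, gaussGrad (F.P t) (F.zeta t z) k y ^ 2) - ∑ k, F.P t k k))

/-- Compare the coefficients of degree two, one and zero in `y`: they are the equations for `P`,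
`zeta` and `phase`. With `stateRate_mul_state` this says that the evolved Gaussian is a classical
solution. -/
theorem hasDerivAt_state (t : ℝ) (z : Fin d → ℂ) (y : Rd d) :
    HasDerivAt (fun t => F.state t z y) (F.stateRate t z y * F.state t z y) t := by
  have hq : HasDerivAt (fun t => quadForm (F.P t) y)
      (quadForm (Complex.I • (complexify (M t) - F.P t * F.P t)) y) t :=
    HasDerivAt.fun_sum fun i _ => HasDerivAt.fun_sum fun j _ =>
      (((F.P_deriv t).matrix_entry i j).mul_const _).mul_const _
  have hl : HasDerivAt (fun t => linForm (F.zeta t z) y)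
      (linForm (-(Complex.I • (F.P t *ᵥ F.zeta t z)) + Complex.I • fun k => (b t k : ℂ)) y) t :=
    HasDerivAt.fun_sum fun i _ => ((hasDerivAt_pi.1 (F.hasDerivAt_zeta t z) i).mul_const _)
  have h := ((((hq.const_mul (-(1 / 2) : ℂ)).add hl).add (F.hasDerivAt_phase t z))).cexp
  refine h.congr_deriv ?_
  rw [mul_comm (Complex.exp _)]
  congr 1
  have hS : (F.P t)ᵀ = F.P t := by ext i j; exact F.P_symm t j i
  have h1 : ∑ k, gaussGrad (F.P t) (F.zeta t z) k y ^ 2 =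
      (F.zeta t z - F.P t *ᵥ coordVec y) ⬝ᵥ (F.zeta t z - F.P t *ᵥ coordVec y) := by
    simp only [dotProduct, gaussGrad_eq, sq]
  have h2 : ∀ u v : Fin d → ℂ, (F.P t *ᵥ u) ⬝ᵥ v = u ⬝ᵥ (F.P t *ᵥ v) := fun u v => by
    rw [Matrix.dotProduct_mulVec, ← Matrix.mulVec_transpose, hS]
  rw [stateRate, h1, ofReal_quadPotential]
  simp only [quadForm_eq, linForm_eq, add_dotProduct, neg_dotProduct, smul_dotProduct,
    Matrix.smul_mulVec, Matrix.sub_mulVec, dotProduct_smul, dotProduct_sub, sub_dotProduct,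
    smul_eq_mul, ← Matrix.mulVec_mulVec, h2, Matrix.trace, Matrix.diag]
  rw [dotProduct_comm (coordVec y) (F.P t *ᵥ F.zeta t z), h2]
  ring

theorem contDiff_state (t : ℝ) (z : Fin d → ℂ) {n : ℕ∞ω} : ContDiff ℝ n (F.state t z) :=
  contDiff_gauss _ _ _

theorem stateRate_mul_state (t : ℝ) (z : Fin d → ℂ) (y : Rd d) :
    F.stateRate t z y * F.state t z y = -Complex.I * ((quadPotential M b t y : ℂ) * F.state t z y -
      1 / 2 * Laplacian.laplacian (F.state t z) y) := by
  rw [state, laplacian_gauss (F.P_symm t), stateRate]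
  ring

theorem continuous_zeta : Continuous fun p : ℝ × (Fin d → ℂ) => F.zeta p.1 p.2 :=
  (F.continuous_R.comp continuous_fst).matrix_mulVec
    (continuous_snd.add ((F.continuous_β.comp continuous_fst).const_smul Complex.I))

theorem continuous_phase : Continuous fun p : ℝ × (Fin d → ℂ) => F.phase p.1 p.2 :=
  ((F.continuous_s₁.comp continuous_fst).add (continuous_const.mul (continuous_snd.dotProduct
    ((F.continuous_N.comp continuous_fst).matrix_mulVec continuous_snd)))).sub
      ((F.continuous_ν.comp continuous_fst).dotProduct continuous_snd)

/-- Evolved Gaussians, times functions of quadratic growth, decay uniformly in bounded sets of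
parameters. -/
theorem exists_state_bound (T K : ℝ) : ∃ c > 0, ∃ C ≥ 0, ∀ t, |t| ≤ T → ∀ z : Fin d → ℂ, ‖z‖ ≤ K →
    ∀ (y : Rd d) (p : ℂ) (B : ℝ), ‖p‖ ≤ B * (1 + ‖y‖ ^ 2) →
      ‖p * F.state t z y‖ ≤ B * C * gaussWeight c y := by
  obtain ⟨c, hc, hP⟩ := F.P_pos T
  have hcomp : IsCompact (Icc (-T) T ×ˢ Metric.closedBall (0 : Fin d → ℂ) K) :=
    isCompact_Icc.prod (isCompact_closedBall _ _)
  obtain ⟨Z, hZ⟩ := hcomp.exists_bound_of_continuousOn F.continuous_zeta.continuousOn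
  obtain ⟨S, hS⟩ := hcomp.exists_bound_of_continuousOn F.continuous_phase.continuousOn
  refine ⟨c / 4, by positivity, Real.exp (S + (d * Z) ^ 2 / c), by positivity,
    fun t ht z hz y p B hp => ?_⟩
  have hmem : ((t, z) : ℝ × (Fin d → ℂ)) ∈ Icc (-T) T ×ˢ Metric.closedBall (0 : Fin d → ℂ) K :=
    ⟨abs_le.1 ht, by simpa using hz⟩
  refine (norm_mul_gauss_le hc (hP t ht y)
    (fun i => (norm_le_pi_norm _ i).trans (hZ _ hmem)) hp).trans ?_
  have hB : 0 ≤ B := by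
    have := (norm_nonneg _).trans hp
    by_contra hneg
    have : B * (1 + ‖y‖ ^ 2) < 0 := mul_neg_of_neg_of_pos (not_le.1 hneg) (by positivity)
    linarith
  have := gaussWeight_nonneg (c / 4) y
  have h2 : (F.phase t z).re ≤ S := (Complex.re_le_norm _).trans (hS _ hmem)
  gcongr

theorem le_one_add_sq (r : ℝ) : r ≤ 1 + r ^ 2 := by nlinarith [sq_nonneg (r - 1)]

theorem norm_quadForm_le (Q : Matrix (Fin d) (Fin d) ℂ) (y : Rd d) :
    ‖quadForm Q y‖ ≤ (∑ i, ∑ j, ‖Q i j‖) * (1 + ‖y‖ ^ 2) := by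
  rw [Finset.sum_mul]
  refine (norm_sum_le _ _).trans (Finset.sum_le_sum fun i _ => ?_)
  rw [Finset.sum_mul]
  refine (norm_sum_le _ _).trans (Finset.sum_le_sum fun j _ => ?_)
  rw [norm_mul, norm_mul, mul_assoc]
  have h1 := abs_coord_le y i
  have h2 := abs_coord_le y j
  gcongr
  nlinarith [norm_nonneg ((y i : ℝ) : ℂ), norm_nonneg ((y j : ℝ) : ℂ), norm_nonneg y]

theorem norm_gaussGrad_le (P : Matrix (Fin d) (Fin d) ℂ) (ζ : Fin d → ℂ) (k : Fin d) (y : Rd d) :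
    ‖gaussGrad P ζ k y‖ ≤ (‖ζ‖ + ∑ j, ‖P k j‖) * (1 + ‖y‖) := by
  have h1 : ‖linForm (P k) y‖ ≤ (∑ j, ‖P k j‖) * ‖y‖ := by
    rw [Finset.sum_mul]
    refine (norm_sum_le _ _).trans (Finset.sum_le_sum fun j _ => ?_)
    rw [norm_mul]
    have := abs_coord_le y j
    gcongr
  have h2 := norm_le_pi_norm ζ k
  have h3 : 0 ≤ ∑ j, ‖P k j‖ := by positivity
  have h4 := norm_nonneg ζ
  have h5 := norm_nonneg y
  refine (norm_sub_le _ _).trans ?_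
  nlinarith

theorem exists_gaussGrad_bound (T K : ℝ) : ∃ B ≥ 0, ∀ t, |t| ≤ T → ∀ z : Fin d → ℂ, ‖z‖ ≤ K →
    ∀ k y, ‖gaussGrad (F.P t) (F.zeta t z) k y‖ ≤ B * (1 + ‖y‖) := by
  have hcomp : IsCompact (Icc (-T) T ×ˢ Metric.closedBall (0 : Fin d → ℂ) K) :=
    isCompact_Icc.prod (isCompact_closedBall _ _)
  obtain ⟨Z, hZ⟩ := hcomp.exists_bound_of_continuousOn F.continuous_zeta.continuousOn
  obtain ⟨Q, hQ⟩ := (isCompact_Icc (a := -T) (b := T)).exists_bound_of_continuousOn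
    (f := fun t => ∑ k, ∑ j, ‖F.P t k j‖) (by
      refine Continuous.continuousOn ?_
      refine continuous_finsetSum _ fun k _ => continuous_finsetSum _ fun j _ => ?_
      exact (F.continuous_P.matrix_elem k j).norm)
  refine ⟨|Z| + |Q|, by positivity, fun t ht z hz k y => ?_⟩
  have hmem : ((t, z) : ℝ × (Fin d → ℂ)) ∈ Icc (-T) T ×ˢ Metric.closedBall (0 : Fin d → ℂ) K :=
    ⟨abs_le.1 ht, by simpa using hz⟩
  refine (norm_gaussGrad_le _ _ _ _).trans ?_
  have h1 := (hZ _ hmem).trans (le_abs_self Z)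
  have h2 : ∑ j, ‖F.P t k j‖ ≤ |Q| := by
    refine (Finset.single_le_sum (f := fun k => ∑ j, ‖F.P t k j‖) (fun i _ => by positivity)
      (Finset.mem_univ k)).trans ?_
    exact (le_abs_self _).trans ((hQ t (abs_le.1 ht)).trans (le_abs_self _))
  gcongr

/-- Uniformity in bounded times provides the dominating function for differentiating evolved
Gaussians in `L²`. -/
theorem exists_stateRate_bound (hM : Continuous M) (hb : Continuous b) (T K : ℝ) :
    ∃ B ≥ 0, ∀ t, |t| ≤ T → ∀ z : Fin d → ℂ, ‖z‖ ≤ K →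
      ∀ y, ‖F.stateRate t z y‖ ≤ B * (1 + ‖y‖ ^ 2) := by
  obtain ⟨B, hB0, hB⟩ := F.exists_gaussGrad_bound T K
  have bd : ∀ f : ℝ → ℝ, Continuous f → ∃ C ≥ 0, ∀ t, |t| ≤ T → f t ≤ C := fun f hf => by
    obtain ⟨C, hC⟩ := (isCompact_Icc (a := -T) (b := T)).exists_bound_of_continuousOn
      hf.continuousOn
    exact ⟨|C|, abs_nonneg _, fun t ht =>
      (le_abs_self _).trans ((hC t (abs_le.1 ht)).trans (le_abs_self _))⟩
  obtain ⟨C₁, hC₁, h1⟩ := bd (fun t => ∑ i, ∑ j, ‖complexify (M t) i j‖) (by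
    refine continuous_finsetSum _ fun k _ => continuous_finsetSum _ fun j _ => ?_
    exact ((continuous_complexify hM).matrix_elem k j).norm)
  obtain ⟨C₂, hC₂, h2⟩ := bd (fun t => ∑ i, ‖(b t i : ℂ)‖) (by fun_prop)
  obtain ⟨C₃, hC₃, h3⟩ := bd (fun t => ‖(∑ k, F.P t k k)‖) (by
    refine (continuous_finsetSum _ fun k _ => ?_).norm
    exact F.continuous_P.matrix_elem k k)
  refine ⟨C₁ + C₂ + (d * (2 * B ^ 2) + C₃), by positivity, fun t ht z hz y => ?_⟩
  have hy := norm_nonneg y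
  have e1 : ‖1 / 2 * quadForm (complexify (M t)) y‖ ≤ C₁ * (1 + ‖y‖ ^ 2) := by
    rw [norm_mul]
    have h := norm_quadForm_le (complexify (M t)) y
    have h' := norm_nonneg (quadForm (complexify (M t)) y)
    calc _ ≤ 1 * ‖quadForm (complexify (M t)) y‖ := by gcongr; norm_num
      _ ≤ (∑ i, ∑ j, ‖complexify (M t) i j‖) * (1 + ‖y‖ ^ 2) := by rwa [one_mul]
      _ ≤ _ := by gcongr; exact h1 t ht
  have e2 : ‖linForm (fun i => (b t i : ℂ)) y‖ ≤ C₂ * (1 + ‖y‖ ^ 2) := by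
    calc _ ≤ (∑ i, ‖(b t i : ℂ)‖) * ‖y‖ := by
          rw [Finset.sum_mul]
          refine (norm_sum_le _ _).trans (Finset.sum_le_sum fun j _ => ?_)
          rw [norm_mul]
          have := abs_coord_le y j
          gcongr
      _ ≤ C₂ * (1 + ‖y‖ ^ 2) := by
          gcongr
          · exact h2 t ht
          · exact le_one_add_sq _
  have e3 : ‖∑ k, gaussGrad (F.P t) (F.zeta t z) k y ^ 2‖ ≤ d * (2 * B ^ 2) * (1 + ‖y‖ ^ 2) := by
    refine (norm_sum_le _ _).trans ((Finset.sum_le_card_nsmul _ _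
      (2 * B ^ 2 * (1 + ‖y‖ ^ 2)) fun k _ => ?_).trans ?_)
    · rw [norm_pow]
      calc _ ≤ (B * (1 + ‖y‖)) ^ 2 := by gcongr; exact hB t ht z hz k y
        _ ≤ _ := by nlinarith [sq_nonneg (1 - ‖y‖), sq_nonneg B, mul_nonneg (sq_nonneg B) (sq_nonneg (1 - ‖y‖))]
    · simp [mul_assoc]
  have e4 : ‖∑ k, F.P t k k‖ ≤ C₃ * (1 + ‖y‖ ^ 2) := by
    refine (h3 t ht).trans ?_
    nlinarith [mul_nonneg hC₃ (sq_nonneg ‖y‖)]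
  rw [stateRate, norm_mul, norm_neg, Complex.norm_I, one_mul, ofReal_quadPotential]
  have e5 : ‖1 / 2 * ((∑ k, gaussGrad (F.P t) (F.zeta t z) k y ^ 2) - ∑ k, F.P t k k)‖ ≤
      ‖∑ k, gaussGrad (F.P t) (F.zeta t z) k y ^ 2‖ + ‖∑ k, F.P t k k‖ := by
    rw [norm_mul]
    calc _ ≤ 1 * ‖(∑ k, gaussGrad (F.P t) (F.zeta t z) k y ^ 2) - ∑ k, F.P t k k‖ := by
          gcongr; norm_num
      _ ≤ _ := by rw [one_mul]; exact norm_sub_le _ _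
  refine (norm_sub_le _ _).trans ((add_le_add (norm_sub_le _ _) e5).trans ?_)
  linarith

theorem continuous_stateRate (t : ℝ) (z : Fin d → ℂ) : Continuous (F.stateRate t z) := by
  unfold stateRate
  have h1 : Continuous fun y : Rd d => (quadPotential M b t y : ℂ) := by
    simp only [ofReal_quadPotential]
    exact (continuous_const.mul (contDiff_quadForm (n := 0) _).continuous).sub
      (contDiff_linForm (n := 0) _).continuous
  have h2 : ∀ k, Continuous (gaussGrad (F.P t) (F.zeta t z) k) := fun k =>
    (contDiff_gaussGrad (n := 0) _ _ _).continuous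
  fun_prop

theorem memLp_mul_state (t : ℝ) (z : Fin d → ℂ) {p : Rd d → ℂ} (hp : Continuous p) {B : ℝ}
    (hB : ∀ y, ‖p y‖ ≤ B * (1 + ‖y‖ ^ 2)) :
    MemLp (fun y => p y * F.state t z y) 2 volume := by
  obtain ⟨c, hc, C, _, h⟩ := F.exists_state_bound |t| ‖z‖
  exact memLp_of_le_gaussWeight (hp.mul (F.contDiff_state (n := 0) t z).continuous) hc
    fun y => h t le_rfl z le_rfl y (p y) B (hB y)

theorem memLp_state (t : ℝ) (z : Fin d → ℂ) : MemLp (F.state t z) 2 volume := by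
  have := F.memLp_mul_state t z (p := fun _ => 1) continuous_const (B := 1)
    (fun y => by simp)
  simpa using this

end MetaplecticFlow

end GaussianStates

/-! ### Test functions, integration by parts and cutoffs -/

section TestFunctions

variable {d : ℕ}

theorem IsTest.contDiff {φ : Rd d → ℂ} (h : IsTest φ) {n : ℕ∞} : ContDiff ℝ n φ :=
  h.1.of_le (by exact_mod_cast le_top)

theorem IsTest.continuous {φ : Rd d → ℂ} (h : IsTest φ) : Continuous φ := h.1.continuous

theorem IsTest.differentiableAt {φ : Rd d → ℂ} (h : IsTest φ) (x : Rd d) :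
    DifferentiableAt ℝ φ x := h.1.differentiable (by simp) x

theorem IsTest.memLp {φ : Rd d → ℂ} (h : IsTest φ) : MemLp φ 2 volume :=
  h.continuous.memLp_of_hasCompactSupport h.2

theorem hasCompactSupport_partialDeriv {φ : Rd d → ℂ} (h : HasCompactSupport φ) (k : Fin d) :
    HasCompactSupport (partialDeriv k φ) :=
  h.fderiv_apply (𝕜 := ℝ) _

theorem IsTest.partialDeriv {φ : Rd d → ℂ} (h : IsTest φ) (k : Fin d) :
    IsTest (partialDeriv k φ) :=
  ⟨contDiff_partialDeriv k h.1 (by simp), hasCompactSupport_partialDeriv h.2 k⟩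

theorem IsTest.mul {φ ψ : Rd d → ℂ} (h : IsTest φ) (hψ : ContDiff ℝ ∞ ψ) :
    IsTest (fun y => φ y * ψ y) :=
  ⟨h.1.mul hψ, h.2.mul_right⟩

theorem IsTest.coord_mul {φ : Rd d → ℂ} (h : IsTest φ) (k : Fin d) :
    IsTest (fun y => ((y k : ℝ) : ℂ) * φ y) := by
  have := h.mul (contDiff_coord k)
  simpa only [mul_comm] using this

theorem laplacian_eq_sum_of_isTest {φ : Rd d → ℂ} (h : IsTest φ) :
    Laplacian.laplacian φ = fun x => ∑ k, _root_.partialDeriv k (_root_.partialDeriv k φ) x :=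
  funext fun x => laplacian_eq_sum_partialDeriv (h.contDiff (n := 2)) x

theorem IsTest.laplacian {φ : Rd d → ℂ} (h : IsTest φ) : IsTest (Laplacian.laplacian φ) := by
  have key : ∀ s : Finset (Fin d),
      IsTest (fun x => ∑ k ∈ s, _root_.partialDeriv k (_root_.partialDeriv k φ) x) := by
    intro s
    induction s using Finset.induction_on with
    | empty => exact ⟨by simpa using contDiff_const, by
      simp only [Finset.sum_empty]
      exact HasCompactSupport.zero⟩
    | insert k s hk ih =>
      simp only [Finset.sum_insert hk]
      have h2 := (h.partialDeriv k).partialDeriv k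
      exact ⟨h2.1.add ih.1, h2.2.add ih.2⟩
  rw [laplacian_eq_sum_of_isTest h]
  exact key _

theorem integral_mul_partialDeriv {φ g : Rd d → ℂ} (hφ : ContDiff ℝ 1 φ)
    (hc : HasCompactSupport φ) (hg : ContDiff ℝ 1 g) (k : Fin d) :
    ∫ y, φ y * partialDeriv k g y = - ∫ y, partialDeriv k φ y * g y := by
  have c1 : Continuous (partialDeriv k φ) :=
    (contDiff_partialDeriv (m := 0) k hφ (by norm_num)).continuous
  have c2 : Continuous (partialDeriv k g) :=
    (contDiff_partialDeriv (m := 0) k hg (by norm_num)).continuous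
  refine integral_mul_fderiv_eq_neg_fderiv_mul_of_integrable ?_ ?_ ?_
    (fun x _ => hφ.differentiable (by norm_num) x) (fun x _ => hg.differentiable (by norm_num) x)
  · exact (c1.mul hg.continuous).integrable_of_hasCompactSupport
      (hasCompactSupport_partialDeriv hc k).mul_right
  · exact (hφ.continuous.mul c2).integrable_of_hasCompactSupport hc.mul_right
  · exact (hφ.continuous.mul hg.continuous).integrable_of_hasCompactSupport hc.mul_right

theorem integral_mul_laplacian {φ g : Rd d → ℂ} (hφ : IsTest φ) (hg : ContDiff ℝ 2 g) :
    ∫ y, φ y * Laplacian.laplacian g y = ∫ y, Laplacian.laplacian φ y * g y := by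
  have hg1 : ∀ k, ContDiff ℝ 1 (partialDeriv k g) := fun k =>
    contDiff_partialDeriv k hg (by norm_num)
  have hg2 : ∀ k, Continuous (partialDeriv k (partialDeriv k g)) := fun k =>
    (contDiff_partialDeriv (m := 0) k (hg1 k) (by norm_num)).continuous
  simp only [laplacian_eq_sum_partialDeriv hg, laplacian_eq_sum_of_isTest hφ, Finset.mul_sum,
    Finset.sum_mul]
  have i1 : ∀ k, Integrable (fun y => φ y * partialDeriv k (partialDeriv k g) y) volume := fun k =>
    (hφ.continuous.mul (hg2 k)).integrable_of_hasCompactSupport hφ.2.mul_right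
  have i2 : ∀ k, Integrable (fun y => partialDeriv k (partialDeriv k φ) y * g y) volume := fun k =>
    (((hφ.partialDeriv k).partialDeriv k).continuous.mul
      hg.continuous).integrable_of_hasCompactSupport ((hφ.partialDeriv k).partialDeriv k).2.mul_right
  rw [integral_finsetSum _ fun k _ => i1 k, integral_finsetSum _ fun k _ => i2 k]
  refine Finset.sum_congr rfl fun k _ => ?_
  rw [integral_mul_partialDeriv hφ.contDiff hφ.2 (hg1 k),
    integral_mul_partialDeriv (hφ.partialDeriv k).contDiff (hφ.partialDeriv k).2
      (hg.of_le (by norm_num)), neg_neg]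

theorem laplacian_mul {φ ψ : Rd d → ℂ} (hφ : ContDiff ℝ 2 φ) (hψ : ContDiff ℝ 2 ψ) (x : Rd d) :
    Laplacian.laplacian (fun y => φ y * ψ y) x = Laplacian.laplacian φ x * ψ x +
      2 * ∑ k, partialDeriv k φ x * partialDeriv k ψ x + φ x * Laplacian.laplacian ψ x := by
  have d0 : ∀ {f : Rd d → ℂ}, ContDiff ℝ 2 f → ∀ y, DifferentiableAt ℝ f y := fun h y =>
    h.differentiable (by norm_num) y
  have d1 : ∀ {f : Rd d → ℂ}, ContDiff ℝ 2 f → ∀ k y, DifferentiableAt ℝ (partialDeriv k f) y :=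
    fun h k y => (contDiff_partialDeriv (m := 1) k h (by norm_num)).differentiable (by norm_num) y
  rw [laplacian_eq_sum_partialDeriv (hφ.mul hψ), laplacian_eq_sum_partialDeriv hφ,
    laplacian_eq_sum_partialDeriv hψ, Finset.sum_mul, Finset.mul_sum, Finset.mul_sum,
    ← Finset.sum_add_distrib, ← Finset.sum_add_distrib]
  refine Finset.sum_congr rfl fun k _ => ?_
  have : partialDeriv k (fun y => φ y * ψ y) =
      fun y => partialDeriv k φ y * ψ y + φ y * partialDeriv k ψ y :=
    funext fun y => partialDeriv_mul k (d0 hφ y) (d0 hψ y)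
  rw [this, partialDeriv_add (φ := fun y => partialDeriv k φ y * ψ y)
    (ψ := fun y => φ y * partialDeriv k ψ y) k ((d1 hφ k x).mul (d0 hψ x))
    ((d0 hφ x).mul (d1 hψ k x)),
    partialDeriv_mul k (d1 hφ k x) (d0 hψ x), partialDeriv_mul k (d0 hφ x) (d1 hψ k x)]
  ring

theorem partialDeriv_star {φ : Rd d → ℂ} {x : Rd d} (h : DifferentiableAt ℝ φ x) (k : Fin d) :
    partialDeriv k (fun y => (starRingEnd ℂ) (φ y)) x = (starRingEnd ℂ) (partialDeriv k φ x) := by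
  have := (Complex.conjCLE.toContinuousLinearMap.hasFDerivAt (x := φ x)).comp x h.hasFDerivAt
  simp only [partialDeriv]
  have h2 : fderiv ℝ (fun y => (starRingEnd ℂ) (φ y)) x =
    Complex.conjCLE.toContinuousLinearMap.comp (fderiv ℝ φ x) := this.fderiv
  rw [h2]
  simp

theorem laplacian_star {φ : Rd d → ℂ} (h : ContDiff ℝ 2 φ) (x : Rd d) :
    Laplacian.laplacian (fun y => (starRingEnd ℂ) (φ y)) x =
      (starRingEnd ℂ) (Laplacian.laplacian φ x) :=
  (h.contDiffAt (x := x)).laplacian_CLM_comp_left (l := Complex.conjCLE.toContinuousLinearMap)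

theorem partialDeriv_comp_smul (φ : Rd d → ℂ) (c : ℝ) (k : Fin d) (x : Rd d) :
    partialDeriv k (fun y => φ (c • y)) x = c * partialDeriv k φ (c • x) := by
  simp only [partialDeriv]
  rw [fderiv_comp_smul]
  simp

/-- Smooth cutoff functions that tend to `1` and have small derivatives. -/
theorem exists_cutoff (d : ℕ) : ∃ (χ : ℕ → Rd d → ℝ) (C : ℝ), 0 ≤ C ∧
    (∀ n, IsTest (fun y => (χ n y : ℂ))) ∧ (∀ n y, |χ n y| ≤ 1) ∧
    (∀ y, ∀ᶠ n in atTop, χ n y = 1) ∧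
    ∀ n y, (∀ k, ‖partialDeriv k (fun y => (χ n y : ℂ)) y‖ ≤ C / (n + 1)) ∧
      ‖Laplacian.laplacian (fun y => (χ n y : ℂ)) y‖ ≤ C / (n + 1) := by
  let f : ContDiffBump (0 : Rd d) := ⟨1, 2, one_pos, one_lt_two⟩
  let g : Rd d → ℂ := fun y => (f y : ℂ)
  have hg : IsTest g := ⟨Complex.ofRealCLM.contDiff.comp f.contDiff,
    f.hasCompactSupport.comp_left (g := fun r : ℝ => (r : ℂ)) Complex.ofReal_zero⟩
  have bd : ∀ {h : Rd d → ℂ}, IsTest h → ∃ C ≥ 0, ∀ y, ‖h y‖ ≤ C := fun hh => by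
    obtain ⟨C, hC⟩ := hh.2.exists_bound_of_continuous hh.continuous
    exact ⟨|C|, abs_nonneg _, fun y => (hC y).trans (le_abs_self _)⟩
  choose C₁ h0 h1 using fun k => bd (hg.partialDeriv k)
  obtain ⟨C₂, h02, h2⟩ := bd hg.laplacian
  have hc : ∀ n : ℕ, (0 : ℝ) < ((n : ℝ) + 1)⁻¹ := fun n => by positivity
  have htest : ∀ n : ℕ, IsTest (fun y => g (((n : ℝ) + 1)⁻¹ • y)) := fun n =>
    ⟨hg.1.comp (contDiff_const_smul _), hg.2.comp_smul (hc n).ne'⟩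
  have hsum : 0 ≤ ∑ k, C₁ k := Finset.sum_nonneg fun k _ => h0 k
  -- Dilates of a fixed bump: a first derivative gains `1/(n+1)`, the Laplacian gains its square,
  -- which is bounded by the first power.
  refine ⟨fun n y => f (((n : ℝ) + 1)⁻¹ • y), ∑ k, C₁ k + C₂, by positivity, htest, fun n y => ?_,
    fun y => ?_, fun n y => ⟨fun k => ?_, ?_⟩⟩
  · rw [abs_of_nonneg f.nonneg]
    exact f.le_one
  · obtain ⟨m, hm⟩ := exists_nat_ge ‖y‖
    filter_upwards [eventually_ge_atTop m] with n hn
    refine f.one_of_mem_closedBall ?_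
    rw [mem_closedBall_zero_iff, norm_smul, Real.norm_of_nonneg (hc n).le,
      inv_mul_le_iff₀ (by positivity)]
    have : (m : ℝ) ≤ n := by exact_mod_cast hn
    change ‖y‖ ≤ (↑n + 1) * 1
    linarith
  · change ‖partialDeriv k (fun y => g (((n : ℝ) + 1)⁻¹ • y)) y‖ ≤ _
    rw [partialDeriv_comp_smul, norm_mul, Complex.norm_real, Real.norm_of_nonneg (hc n).le,
      div_eq_inv_mul]
    have h3 : C₁ k ≤ ∑ k, C₁ k := Finset.single_le_sum (fun i _ => h0 i) (Finset.mem_univ k)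
    have := h1 k (((n : ℝ) + 1)⁻¹ • y)
    gcongr
    linarith
  · change ‖Laplacian.laplacian (fun y => g (((n : ℝ) + 1)⁻¹ • y)) y‖ ≤ _
    have e : Laplacian.laplacian (fun y => g (((n : ℝ) + 1)⁻¹ • y)) y =
        ((n : ℝ) + 1)⁻¹ * (((n : ℝ) + 1)⁻¹ * Laplacian.laplacian g (((n : ℝ) + 1)⁻¹ • y)) := by
      rw [laplacian_eq_sum_of_isTest (htest n), laplacian_eq_sum_of_isTest hg]
      simp only [Finset.mul_sum]
      refine Finset.sum_congr rfl fun k _ => ?_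
      have h3 : partialDeriv k (fun y => g (((n : ℝ) + 1)⁻¹ • y)) =
          fun y => (((n : ℝ) + 1)⁻¹ : ℝ) * partialDeriv k g (((n : ℝ) + 1)⁻¹ • y) :=
        funext fun y => partialDeriv_comp_smul g _ k y
      have h4 : DifferentiableAt ℝ (fun y => partialDeriv k g (((n : ℝ) + 1)⁻¹ • y)) y :=
        ((hg.partialDeriv k).1.comp (contDiff_const_smul _)).differentiable (by simp) y
      rw [h3, partialDeriv_const_mul k _ h4, partialDeriv_comp_smul]
    rw [e]
    rw [norm_mul, norm_mul, Complex.norm_real, Real.norm_of_nonneg (hc n).le, div_eq_inv_mul]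
    have h5 : ((n : ℝ) + 1)⁻¹ ≤ 1 := inv_le_one_of_one_le₀ (by linarith [n.cast_nonneg (α := ℝ)])
    have h6 := h2 (((n : ℝ) + 1)⁻¹ • y)
    gcongr
    calc _ ≤ 1 * ‖Laplacian.laplacian g (((n : ℝ) + 1)⁻¹ • y)‖ := by gcongr
      _ ≤ _ := by linarith

/-- The pairing `f ↦ ∫ f φ` as an inner product. -/
theorem inner_star_toLp {φ : Rd d → ℂ} (hφ : MemLp (fun y => (starRingEnd ℂ) (φ y)) 2 volume)
    (f : L2 d) : inner ℂ (hφ.toLp _ : L2 d) f = ∫ y, f y * φ y := by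
  rw [inner_toLp]
  simp only [Complex.conj_conj, mul_comm]

theorem MeasureTheory.MemLp.conj {φ : Rd d → ℂ} (h : MemLp φ 2 (volume : Measure (Rd d))) :
    MemLp (fun y => (starRingEnd ℂ) (φ y)) 2 volume := h.star

theorem norm_toLp_le_mul {f : Rd d → ℂ} {g : Rd d → ℝ} (hf : MemLp f 2 volume)
    (hg : MemLp g 2 volume) {D : ℝ} (h : ∀ y, ‖f y‖ ≤ D * g y) (hg0 : ∀ y, 0 ≤ g y) :
    ‖(hf.toLp f : L2 d)‖ ≤ D * ‖hg.toLp g‖ := by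
  refine Lp.norm_le_mul_norm_of_ae_le_mul ?_
  filter_upwards [hf.coeFn_toLp, hg.coeFn_toLp] with y h1 h2
  rw [h1, h2, Real.norm_of_nonneg (hg0 y)]
  exact h y

end TestFunctions

/-! ### Conservation of pairings between weak solutions and evolved Gaussians -/

section Duality

variable {d : ℕ}

/-- A product rule in which `w` need only be differentiable against the frozen vector `c t`. In the
splitting `⟨c r - c t, w r⟩ + ⟨c t, w r⟩` the slope of `c` converges in norm, and continuity of `w`
suffices for the first term. -/
theorem hasDerivWithinAt_inner_of_weak {c : ℝ → L2 d} {c' : L2 d} {w : ℝ → L2 d} {D : ℂ} {s : Set ℝ}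
    {t : ℝ} (hc : HasDerivAt c c' t) (hw : ContinuousWithinAt w s t)
    (hD : HasDerivWithinAt (fun r => inner ℂ (c t) (w r)) D s t) :
    HasDerivWithinAt (fun r => inner ℂ (c r) (w r)) (inner ℂ c' (w t) + D) s t := by
  have h1 : HasDerivWithinAt (fun r => inner ℂ (c r - c t) (w r)) (inner ℂ c' (w t)) s t := by
    rw [hasDerivWithinAt_iff_tendsto_slope]
    have h2 : Tendsto (slope c t) (𝓝[s \ {t}] t) (𝓝 c') :=
      hasDerivWithinAt_iff_tendsto_slope.1 hc.hasDerivWithinAt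
    have h3 : Tendsto w (𝓝[s \ {t}] t) (𝓝 (w t)) := hw.mono sdiff_subset
    refine (h2.inner (𝕜 := ℂ) h3).congr fun r => ?_
    simp only [slope, vsub_eq_sub, sub_self, inner_zero_left, sub_zero]
    rw [RCLike.real_smul_eq_coe_smul (K := ℂ), RCLike.real_smul_eq_coe_smul (K := ℂ),
      inner_smul_left, RCLike.conj_ofReal, smul_eq_mul]
  have h4 := h1.add hD
  refine h4.congr (fun r _ => ?_) ?_
  · simp [inner_sub_left]
  · simp

namespace MetaplecticFlow

variable {M : ℝ → Matrix (Fin d) (Fin d) ℝ} {b : ℝ → Fin d → ℝ} (F : MetaplecticFlow M b)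

/-- The evolved Gaussian as an element of `L²`. -/
noncomputable def stateL2 (t : ℝ) (z : Fin d → ℂ) : L2 d := (F.memLp_state t z).toLp _

theorem memLp_cutoff_mul_state {χ : Rd d → ℂ} (hχ : Continuous χ) (hb : ∀ y, ‖χ y‖ ≤ 1) (t : ℝ)
    (z : Fin d → ℂ) : MemLp (fun y => χ y * F.state t z y) 2 volume :=
  F.memLp_mul_state t z hχ (B := 1) fun y => (hb y).trans (by nlinarith [sq_nonneg ‖y‖])

theorem memLp_stateRate_mul_state (hM : Continuous M) (hb : Continuous b) {χ : Rd d → ℂ}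
    (hχ : Continuous χ) (hχb : ∀ y, ‖χ y‖ ≤ 1) (t : ℝ) (z : Fin d → ℂ) :
    MemLp (fun y => χ y * F.stateRate t z y * F.state t z y) 2 volume := by
  obtain ⟨B, hB0, hB⟩ := F.exists_stateRate_bound hM hb |t| ‖z‖
  refine F.memLp_mul_state t z (hχ.mul (F.continuous_stateRate t z)) (B := B) fun y => ?_
  rw [norm_mul]
  calc _ ≤ 1 * (B * (1 + ‖y‖ ^ 2)) := by gcongr; exacts [hχb y, hB t le_rfl z le_rfl y]
    _ = _ := one_mul _

theorem hasDerivAt_cutoff_mul_state (hM : Continuous M) (hb : Continuous b) {χ : Rd d → ℂ}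
    (hχ : Continuous χ) (hχb : ∀ y, ‖χ y‖ ≤ 1) (t : ℝ) (z : Fin d → ℂ) :
    HasDerivAt (fun t => ((F.memLp_cutoff_mul_state hχ hχb t z).toLp _ : L2 d))
      ((F.memLp_stateRate_mul_state hM hb hχ hχb t z).toLp _) t := by
  obtain ⟨B, hB0, hB⟩ := F.exists_stateRate_bound hM hb (|t| + 1) ‖z‖
  obtain ⟨c, hc, C, hC0, hC⟩ := F.exists_state_bound (|t| + 1) ‖z‖
  have hT : ∀ s ∈ Metric.ball t 1, |s| ≤ |t| + 1 := fun s hs => by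
    rw [Metric.mem_ball, Real.dist_eq] at hs
    have := abs_sub_abs_le_abs_sub s t
    linarith
  refine hasDerivAt_toLp (f := fun t y => χ y * F.state t z y)
    (f' := fun t y => χ y * F.stateRate t z y * F.state t z y)
    (g := fun y => B * C * gaussWeight c y) _ _ ((memLp_gaussWeight hc).const_mul _) one_pos
    (fun s _ y => ?_) (fun s hs y => ?_)
  · exact ((F.hasDerivAt_state s z y).const_mul (χ y)).congr_deriv (by ring)
  · refine hC s (hT s hs) z le_rfl y _ B ?_
    rw [norm_mul]
    calc _ ≤ 1 * (B * (1 + ‖y‖ ^ 2)) := by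
          gcongr; exacts [hχb y, hB s (hT s hs) z le_rfl y]
      _ = _ := one_mul _

theorem exists_hasDerivAt_stateL2 (hM : Continuous M) (hb : Continuous b) (t : ℝ)
    (z : Fin d → ℂ) : ∃ h : MemLp (fun y => F.stateRate t z y * F.state t z y) 2 volume,
      HasDerivAt (fun t => F.stateL2 t z) (h.toLp _) t := by
  have h := F.hasDerivAt_cutoff_mul_state hM hb (χ := fun _ => 1) continuous_const (by simp) t z
  have h2 := F.memLp_stateRate_mul_state hM hb (χ := fun _ => 1) continuous_const (by simp) t z
  simp only [one_mul] at h h2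
  exact ⟨h2, h⟩

theorem continuous_stateL2 (hM : Continuous M) (hb : Continuous b) (z : Fin d → ℂ) :
    Continuous fun t => F.stateL2 t z :=
  continuous_iff_continuousAt.2 fun t =>
    (F.exists_hasDerivAt_stateL2 hM hb t z).choose_spec.continuousAt

theorem isTest_potential {φ : Rd d → ℂ} (hφ : IsTest φ) (t : ℝ) :
    IsTest (fun y => (quadPotential M b t y : ℂ) * φ y) := by
  have h : ContDiff ℝ ∞ fun y : Rd d => (quadPotential M b t y : ℂ) := by
    simp only [ofReal_quadPotential]
    exact (contDiff_const.mul (contDiff_quadForm _)).sub (contDiff_linForm _)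
  have := hφ.mul h
  simpa only [mul_comm] using this

/-- The classical equation, with the Laplacian moved onto the compactly supported `φ` by two
integrations by parts. -/
theorem hasDerivAt_integral_stateL2 (hM : Continuous M) (hb : Continuous b) (z : Fin d → ℂ)
    {φ : Rd d → ℂ} (hφ : IsTest φ) (t : ℝ) :
    HasDerivAt (fun s => ∫ y, F.stateL2 s z y * φ y)
      (-Complex.I * ∫ y, F.stateL2 t z y * ((quadPotential M b t y : ℂ) * φ y -
        1 / 2 * Laplacian.laplacian φ y)) t := by
  obtain ⟨hmem, h⟩ := F.exists_hasDerivAt_stateL2 hM hb t z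
  simp only [← inner_star_toLp hφ.memLp.conj]
  refine ((hasDerivAt_const t _).inner ℂ h).congr_deriv ?_
  rw [inner_zero_left, add_zero, inner_star_toLp]
  have e1 : ∫ y, (hmem.toLp _ : L2 d) y * φ y =
      ∫ y, -Complex.I * (((quadPotential M b t y : ℂ) * φ y) * F.state t z y -
        1 / 2 * (φ y * Laplacian.laplacian (F.state t z) y)) := by
    refine integral_congr_ae ?_
    filter_upwards [hmem.coeFn_toLp] with y hy
    rw [hy, F.stateRate_mul_state]
    ring
  have e2 : ∫ y, F.stateL2 t z y * ((quadPotential M b t y : ℂ) * φ y -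
        1 / 2 * Laplacian.laplacian φ y) =
      ∫ y, (((quadPotential M b t y : ℂ) * φ y) * F.state t z y -
        1 / 2 * (Laplacian.laplacian φ y * F.state t z y)) := by
    refine integral_congr_ae ?_
    filter_upwards [(F.memLp_state t z).coeFn_toLp] with y hy
    rw [stateL2, hy]
    ring
  have hs : Continuous (F.state t z) := (F.contDiff_state (n := 0) t z).continuous
  have hsl : Continuous (Laplacian.laplacian (F.state t z)) := by
    have : Laplacian.laplacian (F.state t z) =
        fun y => ∑ k, partialDeriv k (partialDeriv k (F.state t z)) y :=
      funext fun y => laplacian_eq_sum_partialDeriv (F.contDiff_state t z) y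
    rw [this]
    exact continuous_finsetSum _ fun k _ => (contDiff_partialDeriv (m := 0) k
      (contDiff_partialDeriv (m := 1) k (F.contDiff_state (n := 2) t z) (by norm_num))
        (by norm_num)).continuous
  have hp := isTest_potential (M := M) (b := b) hφ t
  have i0 : Integrable (fun y => (quadPotential M b t y : ℂ) * φ y * F.state t z y) volume :=
    (hp.continuous.mul hs).integrable_of_hasCompactSupport hp.2.mul_right
  have i1 : Integrable (fun y => 1 / 2 * (φ y * Laplacian.laplacian (F.state t z) y)) volume :=
    ((hφ.continuous.mul hsl).integrable_of_hasCompactSupport hφ.2.mul_right).const_mul (1 / 2)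
  have i2 : Integrable (fun y => 1 / 2 * (Laplacian.laplacian φ y * F.state t z y)) volume :=
    ((hφ.laplacian.continuous.mul hs).integrable_of_hasCompactSupport
      hφ.laplacian.2.mul_right).const_mul (1 / 2)
  rw [e1, e2, integral_const_mul, integral_sub i0 i1, integral_sub i0 i2, integral_const_mul,
    integral_const_mul, integral_mul_laplacian hφ (F.contDiff_state t z)]

theorem isWeakSchrodinger_stateL2 (hM : Continuous M) (hb : Continuous b) (z : Fin d → ℂ) :
    IsWeakSchrodinger (quadPotential M b) fun t => F.stateL2 t z :=
  fun _ hφ t _ => (F.hasDerivAt_integral_stateL2 hM hb z hφ t).hasDerivWithinAt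

/-- The error made by cutting off the evolved Gaussian. -/
noncomputable def cutoffError (χ : Rd d → ℂ) (t : ℝ) (z : Fin d → ℂ) (y : Rd d) : ℂ :=
  Complex.I / 2 * (Laplacian.laplacian χ y +
    2 * ∑ k, partialDeriv k χ y * gaussGrad (F.P t) (F.zeta t z) k y) * F.state t z y

theorem continuous_cutoffError {χ : Rd d → ℂ} (hχ : IsTest χ) (t : ℝ) (z : Fin d → ℂ) :
    Continuous (F.cutoffError χ t z) := by
  refine (continuous_const.mul (hχ.laplacian.continuous.add (continuous_const.mul
    (continuous_finsetSum _ fun k _ => (hχ.partialDeriv k).continuous.mul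
      (contDiff_gaussGrad (n := 0) _ _ _).continuous)))).mul
        (F.contDiff_state (n := 0) t z).continuous

/-- The error is linear in the derivatives of the cutoff, so its size is governed by `δ`. This is
what lets the error vanish for the dilated cutoffs. -/
theorem exists_cutoffError_bound (T : ℝ) (z : Fin d → ℂ) : ∃ c > 0, ∃ C ≥ 0,
    ∀ (χ : Rd d → ℂ) (δ : ℝ), 0 ≤ δ → (∀ y k, ‖partialDeriv k χ y‖ ≤ δ) →
      (∀ y, ‖Laplacian.laplacian χ y‖ ≤ δ) → ∀ t, |t| ≤ T → ∀ y,
        ‖F.cutoffError χ t z y‖ ≤ δ * C * gaussWeight c y := by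
  obtain ⟨c, hc, C, hC0, hC⟩ := F.exists_state_bound T ‖z‖
  obtain ⟨B, hB0, hB⟩ := F.exists_gaussGrad_bound T ‖z‖
  refine ⟨c, hc, (1 + 4 * (d * B)) * C, by positivity, fun χ δ hδ h1 h2 t ht y => ?_⟩
  refine (hC t ht z le_rfl y _ (δ * (1 + 4 * (d * B))) ?_).trans (le_of_eq (by ring))
  have hs : ‖∑ k, partialDeriv k χ y * gaussGrad (F.P t) (F.zeta t z) k y‖ ≤
      d * (δ * (B * (1 + ‖y‖))) := by
    refine (norm_sum_le _ _).trans ((Finset.sum_le_card_nsmul _ _ (δ * (B * (1 + ‖y‖)))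
      fun k _ => ?_).trans (by simp))
    rw [norm_mul]
    gcongr
    exacts [h1 y k, hB t ht z le_rfl k y]
  have hy : 1 + ‖y‖ ≤ 2 * (1 + ‖y‖ ^ 2) := by
    nlinarith [sq_nonneg (‖y‖ - 1), sq_nonneg ‖y‖]
  have hI : ‖Complex.I / 2‖ = 1 / 2 := by simp
  rw [norm_mul, hI]
  have h3 : ‖Laplacian.laplacian χ y +
      2 * ∑ k, partialDeriv k χ y * gaussGrad (F.P t) (F.zeta t z) k y‖ ≤
      δ + 2 * (d * (δ * (B * (2 * (1 + ‖y‖ ^ 2))))) := by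
    refine (norm_add_le _ _).trans (add_le_add (h2 y) ?_)
    rw [norm_mul]
    have : ‖(2 : ℂ)‖ = 2 := by simp
    rw [this]
    refine mul_le_mul_of_nonneg_left (hs.trans ?_) zero_le_two
    gcongr
  have h4 : 0 ≤ δ * (d * B) * (1 + ‖y‖ ^ 2) := by positivity
  have h5 : 0 ≤ δ * ‖y‖ ^ 2 := by positivity
  have h6 : 0 ≤ ‖Laplacian.laplacian χ y +
      2 * ∑ k, partialDeriv k χ y * gaussGrad (F.P t) (F.zeta t z) k y‖ := norm_nonneg _
  linarith

/-- The conjugated Gaussian times a compactly supported `χ` is an admissible test function for `w`.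
The potential cancels between the equations of the Gaussian and of `w`; what remains is the
commutator of the Laplacian with `χ`, which is `cutoffError`. -/
theorem hasDerivWithinAt_inner_cutoff (hM : Continuous M) (hb : Continuous b) (z : Fin d → ℂ)
    {w : ℝ → L2 d} (hw : ContinuousOn w (Ici 0)) (hweak : IsWeakSchrodinger (quadPotential M b) w)
    {χ : Rd d → ℝ} (hχ : IsTest fun y => (χ y : ℂ)) (hχb : ∀ y, ‖(χ y : ℂ)‖ ≤ 1) {t : ℝ}
    (ht : 0 ≤ t) {e : L2 d} (he : e =ᵐ[volume] F.cutoffError (fun y => (χ y : ℂ)) t z) :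
    HasDerivWithinAt
      (fun s => inner ℂ ((F.memLp_cutoff_mul_state hχ.continuous hχb s z).toLp _ : L2 d) (w s))
      (-inner ℂ e (w t)) (Ici 0) t := by
  set φ : Rd d → ℂ := fun y => (χ y : ℂ) * (starRingEnd ℂ) (F.state t z y) with hφdef
  have hst : ContDiff ℝ ∞ fun y => (starRingEnd ℂ) (F.state t z y) :=
    Complex.conjCLE.contDiff.comp (F.contDiff_state t z)
  have hφ : IsTest φ := hχ.mul hst
  have hcongr : ∀ r, inner ℂ ((F.memLp_cutoff_mul_state hχ.continuous hχb t z).toLp _ : L2 d) (w r)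
      = ∫ y, w r y * φ y := fun r => by
    rw [inner_toLp]
    refine integral_congr_ae (ae_of_all _ fun y => ?_)
    simp only [map_mul, Complex.conj_ofReal, hφdef]
    ring
  have hD := hweak φ hφ t ht
  simp only [← hcongr] at hD
  refine (hasDerivWithinAt_inner_of_weak
    (F.hasDerivAt_cutoff_mul_state hM hb hχ.continuous hχb t z) (hw t ht) hD).congr_deriv ?_
  rw [inner_toLp, L2.inner_def]
  have hrate := integrable_star_mul_L2
    (F.memLp_stateRate_mul_state hM hb hχ.continuous hχb t z) (w t)
  have hp := isTest_potential (M := M) (b := b) hφ t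
  have hWφ : MemLp (fun y => (quadPotential M b t y : ℂ) * φ y -
      1 / 2 * Laplacian.laplacian φ y) 2 volume :=
    hp.memLp.sub (hφ.laplacian.memLp.const_mul (1 / 2))
  have hint := (integrable_mul_L2 hWφ (w t)).const_mul (-Complex.I)
  have hint2 : Integrable (fun y => -Complex.I * (w t y * ((quadPotential M b t y : ℂ) * φ y -
      1 / 2 * Laplacian.laplacian φ y))) volume :=
    hint.congr (ae_of_all _ fun y => by ring)
  rw [← integral_const_mul, ← integral_add hrate hint2, ← integral_neg]
  refine integral_congr_ae ?_
  filter_upwards [he] with y hy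
  have hlap : Laplacian.laplacian φ y = _ := laplacian_mul
    (ψ := fun y => (starRingEnd ℂ) (F.state t z y)) (hχ.contDiff (n := 2))
    (Complex.conjCLE.contDiff.comp (F.contDiff_state (n := 2) t z)) y
  have hpart : ∀ k, partialDeriv k (fun y => (starRingEnd ℂ) (F.state t z y)) y =
      (starRingEnd ℂ) (gaussGrad (F.P t) (F.zeta t z) k y) * (starRingEnd ℂ) (F.state t z y) :=
    fun k => by
      rw [partialDeriv_star ((F.contDiff_state (n := 1) t z).differentiable (by norm_num) y), state,
        partialDeriv_gauss (F.P_symm t), map_mul]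
  have hreal : ∀ k, (starRingEnd ℂ) (partialDeriv k (fun y => (χ y : ℂ)) y) =
      partialDeriv k (fun y => (χ y : ℂ)) y := fun k => by
    rw [← partialDeriv_star (hχ.differentiableAt y)]
    simp only [Complex.conj_ofReal]
  have hreal2 : (starRingEnd ℂ) (Laplacian.laplacian (fun y => (χ y : ℂ)) y) =
      Laplacian.laplacian (fun y => (χ y : ℂ)) y := by
    rw [← laplacian_star (hχ.contDiff (n := 2))]
    simp only [Complex.conj_ofReal]
  rw [laplacian_star (F.contDiff_state t z)] at hlap
  have hr := congrArg (starRingEnd ℂ) (F.stateRate_mul_state t z y)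
  have hrw : (starRingEnd ℂ) ((χ y : ℂ) * F.stateRate t z y * F.state t z y) =
      (χ y : ℂ) * (starRingEnd ℂ) (F.stateRate t z y * F.state t z y) := by
    rw [mul_assoc, map_mul, Complex.conj_ofReal]
  rw [hrw, hr, hlap, hy, RCLike.inner_apply, cutoffError]
  simp only [hpart, map_mul, map_sub, map_neg, map_add, map_sum, Complex.conj_I, Complex.conj_ofReal,
    map_div₀, map_ofNat, map_one, hreal, hreal2, hφdef, ← mul_assoc, ← Finset.sum_mul]
  ring

/-- Pairings of solutions with evolved Gaussians are conserved. -/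
theorem inner_stateL2_eq (hM : Continuous M) (hb : Continuous b) (z : Fin d → ℂ)
    {w : ℝ → L2 d} (hw : ContinuousOn w (Ici 0)) (hweak : IsWeakSchrodinger (quadPotential M b) w)
    {T : ℝ} (hT : 0 ≤ T) :
    inner ℂ (F.stateL2 T z) (w T) = inner ℂ (F.stateL2 0 z) (w 0) := by
  obtain ⟨χ, C, hC0, hχ, hχb, hχ1, hχd⟩ := exists_cutoff d
  have hχb' : ∀ n y, ‖(χ n y : ℂ)‖ ≤ 1 := fun n y => by
    rw [Complex.norm_real]; exact hχb n y
  obtain ⟨c, hc, C', hC'0, hC'⟩ := F.exists_cutoffError_bound T z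
  obtain ⟨K, hK⟩ := (isCompact_Icc (a := 0) (b := T)).exists_bound_of_continuousOn
    (hw.mono Icc_subset_Ici_self)
  have hK0 : 0 ≤ K := (norm_nonneg _).trans (hK 0 ⟨le_rfl, hT⟩)
  set G : ℝ := ‖((memLp_gaussWeight (d := d) hc).toLp _ : Lp ℝ 2 volume)‖ with hG
  have hG0 : 0 ≤ G := norm_nonneg _
  let f : ℕ → ℝ → ℂ := fun n s =>
    inner ℂ ((F.memLp_cutoff_mul_state (hχ n).continuous (hχb' n) s z).toLp _ : L2 d) (w s)
  -- Mean value inequality on `[0, T]`: the derivative of the truncated pairing is at most the `L²`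
  -- norm of the cutoff error, of order `1/(n+1)`, times the bound `K` for `w`.
  have hbound : ∀ n, ‖f n T - f n 0‖ ≤ C / (n + 1) * C' * G * K * T := by
    intro n
    have herr : ∀ s, |s| ≤ T → ∀ y, ‖F.cutoffError (fun y => (χ n y : ℂ)) s z y‖ ≤
        C / (n + 1) * C' * gaussWeight c y := hC' _ _ (by positivity)
        (fun y k => (hχd n y).1 k) (fun y => (hχd n y).2)
    have hmem : ∀ s, |s| ≤ T → MemLp (F.cutoffError (fun y => (χ n y : ℂ)) s z) 2 volume :=
      fun s hs => memLp_of_le_gaussWeight (F.continuous_cutoffError (hχ n) s z) hc (herr s hs)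
    have habs : ∀ s ∈ Icc 0 T, |s| ≤ T := fun s hs => by rw [abs_of_nonneg hs.1]; exact hs.2
    have := Convex.norm_image_sub_le_of_norm_hasDerivWithin_le (f := f n) (s := Icc 0 T)
      -- Square integrability of the error is available only for `|s| ≤ T`; the value `0` elsewhere
      -- plays no role on `[0, T]`.
      (f' := fun s => if h : |s| ≤ T then -inner ℂ ((hmem s h).toLp _ : L2 d) (w s) else 0)
      (C := C / (n + 1) * C' * G * K) (x := 0) (y := T)
      (fun s hs => by
        rw [dif_pos (habs s hs)]
        exact (F.hasDerivWithinAt_inner_cutoff hM hb z hw hweak (hχ n) (hχb' n) hs.1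
          (hmem s (habs s hs)).coeFn_toLp).mono Icc_subset_Ici_self)
      (fun s hs => by
        rw [dif_pos (habs s hs), norm_neg]
        refine (norm_inner_le_norm _ _).trans ?_
        have h1 := norm_toLp_le_mul (hmem s (habs s hs)) (memLp_gaussWeight hc)
          (herr s (habs s hs)) (gaussWeight_nonneg c)
        exact mul_le_mul h1 (hK s hs) (norm_nonneg _) (by positivity))
      (convex_Icc 0 T) ⟨le_rfl, hT⟩ ⟨hT, le_rfl⟩
    rwa [sub_zero, Real.norm_of_nonneg hT] at this
  have hlim : ∀ s, Tendsto (fun n => f n s) atTop (𝓝 (inner ℂ (F.stateL2 s z) (w s))) := by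
    intro s
    refine Tendsto.inner ?_ tendsto_const_nhds
    refine tendsto_toLp_of_dominated
      (fun n => F.memLp_cutoff_mul_state (hχ n).continuous (hχb' n) s z)
      (F.memLp_state s z) (g := fun y => ‖F.state s z y‖) (F.memLp_state s z).norm
      (Eventually.of_forall fun n y => ?_) (fun y => ?_)
    · rw [norm_mul]
      exact mul_le_of_le_one_left (norm_nonneg _) (hχb' n y)
    · refine tendsto_const_nhds.congr' ?_
      filter_upwards [hχ1 y] with n hn
      rw [hn]
      simp
  have h0 : Tendsto (fun n : ℕ => C / ((n : ℝ) + 1) * C' * G * K * T) atTop (𝓝 0) := by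
    have h1 : Tendsto (fun n : ℕ => C * (1 / ((n : ℝ) + 1))) atTop (𝓝 (C * 0)) :=
      tendsto_one_div_add_atTop_nhds_zero_nat.const_mul C
    have h2 := (((h1.mul_const C').mul_const G).mul_const K).mul_const T
    simpa [div_eq_mul_inv] using h2
  have h3 := squeeze_zero_norm hbound h0
  have h4 := tendsto_nhds_unique h3 ((hlim T).sub (hlim 0))
  exact (sub_eq_zero.1 h4.symm)

end MetaplecticFlow

end Duality

/-! ### Totality of evolved Gaussians and recognition of weak derivatives -/

section FourierUniqueness

open scoped FourierTransform LineDeriv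

variable {d : ℕ}

theorem fourier_apply_eq (f : Rd d → ℂ) (ξ : Rd d) :
    𝓕 f ξ = ∫ y, Complex.exp (-(2 * Real.pi * Complex.I * ∑ i, ((ξ i : ℝ) : ℂ) * ((y i : ℝ) : ℂ))) * f y := by
  rw [Real.fourier_eq']
  refine integral_congr_ae (ae_of_all _ fun y => ?_)
  simp only [smul_eq_mul]
  congr 2
  rw [PiLp.inner_apply]
  simp only [RCLike.inner_apply, conj_trivial]
  push_cast
  ring

theorem integral_fourier_mul_schwartz {f : Rd d → ℂ} (hf : Integrable f volume)
    (g : SchwartzMap (Rd d) ℂ) : ∫ ξ, 𝓕 f ξ * g ξ = ∫ y, f y * (𝓕 g) y := by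
  have := VectorFourier.integral_fourierIntegral_smul_eq_flip (L := innerₗ (Rd d)) (μ := volume)
    (ν := volume) Real.continuous_fourierChar continuous_inner hf (g.integrable (μ := volume))
  simp only [flip_innerₗ, smul_eq_mul] at this
  exact this

/-- A relation between Fourier transforms is a relation between weak derivatives. -/
theorem integral_mul_eq_of_fourier_eq {F₁ F₂ : Rd d → ℂ} (h₁ : Integrable F₁ volume)
    (h₂ : Integrable F₂ volume) (k : Fin d) (c : ℂ)
    (h : ∀ ξ : Rd d, 𝓕 F₁ ξ = c * (2 * Real.pi * Complex.I * ((ξ k : ℝ) : ℂ)) * 𝓕 F₂ ξ)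
    {φ : Rd d → ℂ} (hφ : IsTest φ) :
    ∫ y, F₁ y * φ y = -(c * ∫ y, F₂ y * partialDeriv k φ y) := by
  set e : Rd d := EuclideanSpace.single k 1
  set Φ : SchwartzMap (Rd d) ℂ := hφ.2.toSchwartzMap hφ.1
  set g : SchwartzMap (Rd d) ℂ := 𝓕⁻ Φ
  have hg : 𝓕 g = Φ := FourierTransform.fourier_fourierInv_eq Φ
  -- Writing `φ` as the Fourier transform of a Schwartz function `g` moves the transform onto `F₁`;
  -- below, differentiating `φ` becomes multiplying `g` by a frequency.
  have e1 : ∫ y, F₁ y * φ y = ∫ ξ, 𝓕 F₁ ξ * g ξ := by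
    rw [integral_fourier_mul_schwartz h₁, hg]
    rfl
  have hT : (fun x : Rd d => inner ℝ x e).HasTemperateGrowth :=
    ((innerSL ℝ).flip e).hasTemperateGrowth
  have e2 : ∀ y, partialDeriv k φ y =
      (𝓕 (-(2 * Real.pi * Complex.I) • SchwartzMap.smulLeftCLM ℂ (inner ℝ · e) g)) y := fun y => by
    rw [← SchwartzMap.lineDerivOp_fourier_eq, hg, SchwartzMap.lineDerivOp_apply_eq_fderiv]
    rfl
  simp only [e2]
  rw [e1, ← integral_fourier_mul_schwartz h₂, ← integral_const_mul, ← integral_neg]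
  refine integral_congr_ae (ae_of_all _ fun ξ => ?_)
  have hin : inner ℝ ξ e = ξ k := by simp [e, EuclideanSpace.inner_single_right]
  simp only [h, smul_apply, SchwartzMap.smulLeftCLM_apply_apply hT, hin,
    Complex.real_smul, smul_eq_mul]
  ring

theorem ae_eq_zero_of_integral_mul_test {f : Rd d → ℂ} (hf : LocallyIntegrable f volume)
    (h : ∀ φ : Rd d → ℂ, IsTest φ → ∫ y, f y * φ y = 0) : f =ᵐ[volume] 0 := by
  refine ae_eq_zero_of_integral_contDiff_smul_eq_zero hf fun g hg hgc => ?_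
  rw [← h (fun y => (g y : ℂ)) ⟨Complex.ofRealCLM.contDiff.comp hg,
    hgc.comp_left (g := fun r : ℝ => (r : ℂ)) Complex.ofReal_zero⟩]
  refine integral_congr_ae (ae_of_all _ fun y => ?_)
  simp [mul_comm]

namespace MetaplecticFlow

variable {M : ℝ → Matrix (Fin d) (Fin d) ℝ} {b : ℝ → Fin d → ℝ} (F : MetaplecticFlow M b)

theorem gauss_ne_zero (P : Matrix (Fin d) (Fin d) ℂ) (ζ : Fin d → ℂ) (s : ℂ) (y : Rd d) :
    gauss P ζ s y ≠ 0 := Complex.exp_ne_zero _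

/-- Evolved Gaussians with imaginary linear terms are modulations of a fixed Gaussian. -/
theorem exists_star_state_eq (t : ℝ) (ξ : Rd d) : ∃ (z : Fin d → ℂ) (a : ℂ), a ≠ 0 ∧
    F.zeta t z = (fun i => 2 * Real.pi * Complex.I * ((ξ i : ℝ) : ℂ)) ∧
    ∀ y, (starRingEnd ℂ) (F.state t z y) =
      a * (Complex.exp (-(2 * Real.pi * Complex.I * ∑ i, ((ξ i : ℝ) : ℂ) * ((y i : ℝ) : ℂ))) *
        (starRingEnd ℂ) (gauss (F.P t) 0 0 y)) := by
  obtain ⟨z, hz⟩ := F.exists_zeta_eq t fun i => 2 * Real.pi * Complex.I * ((ξ i : ℝ) : ℂ)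
  refine ⟨z, (starRingEnd ℂ) (Complex.exp (F.phase t z)), ?_, hz, fun y => ?_⟩
  · rw [Ne, map_eq_zero]; exact Complex.exp_ne_zero _
  · have h1 : F.state t z y = Complex.exp (F.phase t z) *
        (Complex.exp (2 * Real.pi * Complex.I * ∑ i, ((ξ i : ℝ) : ℂ) * ((y i : ℝ) : ℂ)) *
          gauss (F.P t) 0 0 y) := by
      simp only [state, gauss, hz, ← Complex.exp_add]
      congr 1
      simp [linForm, Finset.mul_sum, mul_assoc]
      ring
    rw [h1, map_mul, map_mul]
    congr 2
    rw [← Complex.exp_conj]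
    congr 1
    simp only [map_mul, map_sum, map_ofNat, Complex.conj_ofReal, Complex.conj_I]
    ring

/-- Evolved Gaussians are total. -/
theorem ae_eq_zero_of_integral_state (t : ℝ) {H : Rd d → ℂ}
    (hi : ∀ z, Integrable (fun y => (starRingEnd ℂ) (F.state t z y) * H y) volume)
    (h : ∀ z, ∫ y, (starRingEnd ℂ) (F.state t z y) * H y = 0) : H =ᵐ[volume] 0 := by
  set G : Rd d → ℂ := fun y => (starRingEnd ℂ) (gauss (F.P t) 0 0 y) * H y with hG
  have hGi : Integrable G volume := by
    obtain ⟨z, a, ha, -, hz⟩ := F.exists_star_state_eq t 0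
    refine ((hi z).const_mul a⁻¹).congr (ae_of_all _ fun y => ?_)
    simp only [hz, hG]
    simp only [PiLp.zero_apply, Complex.ofReal_zero, zero_mul, Finset.sum_const_zero, mul_zero,
      neg_zero, Complex.exp_zero, one_mul]
    rw [mul_assoc, inv_mul_cancel_left₀ ha]
  have hF : ∀ ξ, 𝓕 G ξ = 0 := fun ξ => by
    obtain ⟨z, a, ha, -, hz⟩ := F.exists_star_state_eq t ξ
    have := h z
    simp only [hz, mul_assoc] at this
    rw [integral_const_mul] at this
    rw [fourier_apply_eq]
    simpa only [mul_assoc] using (mul_eq_zero.1 this).resolve_left ha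
  have h0 : G =ᵐ[volume] 0 := ae_eq_zero_of_integral_mul_test hGi.locallyIntegrable fun φ hφ => by
    -- For `d > 0` the vanishing of the Fourier transform is fed into the derivative criterion with
    -- factor `0`. That criterion needs a coordinate, so `d = 0` is treated directly.
    rcases Nat.eq_zero_or_pos d with hd | hd
    · subst hd
      have h1 := integral_fourier_mul_schwartz hGi (𝓕⁻ (hφ.2.toSchwartzMap hφ.1))
      rw [FourierTransform.fourier_fourierInv_eq] at h1
      simp only [hF, zero_mul, integral_zero] at h1
      exact h1.symm
    · have := integral_mul_eq_of_fourier_eq hGi hGi ⟨0, hd⟩ 0 (fun ξ => by simp [hF]) hφ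
      simpa using this
  filter_upwards [h0] with y hy
  exact (mul_eq_zero.1 hy).resolve_left
    ((map_ne_zero (starRingEnd ℂ)).2 (gauss_ne_zero _ _ _ _))

theorem contDiff_star_gauss (P : Matrix (Fin d) (Fin d) ℂ) (ζ : Fin d → ℂ) (s : ℂ) {n : ℕ∞ω} :
    ContDiff ℝ n fun y => (starRingEnd ℂ) (gauss P ζ s y) :=
  Complex.conjCLE.contDiff.comp (contDiff_gauss P ζ s)

theorem memLp_partialDeriv_state (t : ℝ) (z : Fin d → ℂ) (k : Fin d) :
    MemLp (partialDeriv k (F.state t z)) 2 volume := by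
  have h : partialDeriv k (F.state t z) =
      fun y => gaussGrad (F.P t) (F.zeta t z) k y * F.state t z y :=
    funext fun y => partialDeriv_gauss (F.P_symm t) _ _ k y
  rw [h]
  refine F.memLp_mul_state t z (contDiff_gaussGrad (n := 0) _ _ k).continuous
    (B := 2 * (‖F.zeta t z‖ + ∑ j, ‖F.P t k j‖)) fun y => (norm_gaussGrad_le _ _ k y).trans ?_
  have h1 : 1 + ‖y‖ ≤ 2 * (1 + ‖y‖ ^ 2) := by nlinarith [sq_nonneg (‖y‖ - 1), sq_nonneg ‖y‖]
  calc _ ≤ (‖F.zeta t z‖ + ∑ j, ‖F.P t k j‖) * (2 * (1 + ‖y‖ ^ 2)) := by gcongr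
    _ = _ := by ring

/-- To recognise `g = ∂_k f` it suffices to test with evolved Gaussians. Let `G` be the conjugate of
the centred Gaussian at time `t`, so that `∂_k G = -L G`. States with imaginary linear terms are
modulations of this Gaussian, so the hypothesis is a relation between Fourier transforms, namely
`∂_k (G f) = G g - L G f`; dividing by `G` gives the claim. -/
theorem integral_mul_partialDeriv_of_state (t : ℝ) (k : Fin d) (f g : L2 d)
    (h : ∀ z, ∫ y, (starRingEnd ℂ) (partialDeriv k (F.state t z) y) * f y =
      - ∫ y, (starRingEnd ℂ) (F.state t z y) * g y) {φ : Rd d → ℂ} (hφ : IsTest φ) :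
    ∫ y, f y * partialDeriv k φ y = - ∫ y, g y * φ y := by
  set P := F.P t
  set G : Rd d → ℂ := fun y => (starRingEnd ℂ) (gauss P 0 0 y) with hG
  set L : Rd d → ℂ := fun y => (starRingEnd ℂ) (linForm (P k) y) with hL
  have hGs : ∀ {n : ℕ∞ω}, ContDiff ℝ n G := contDiff_star_gauss P 0 0
  have hG0 : ∀ y, G y ≠ 0 := fun y => (map_ne_zero (starRingEnd ℂ)).2 (gauss_ne_zero _ _ _ _)
  have hint : ∀ z, Integrable (fun y => (starRingEnd ℂ) (F.state t z y) * f y) volume ∧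
      Integrable (fun y => (starRingEnd ℂ) (F.state t z y) * g y) volume ∧
      Integrable (fun y => (starRingEnd ℂ) (F.state t z y) * (L y * f y)) volume := fun z => by
    refine ⟨integrable_star_mul_L2 (F.memLp_state t z) f,
      integrable_star_mul_L2 (F.memLp_state t z) g, ?_⟩
    have h1 := integrable_star_mul_L2 (F.memLp_partialDeriv_state t z k) f
    have h2 := (integrable_star_mul_L2 (F.memLp_state t z) f).const_mul
      ((starRingEnd ℂ) (F.zeta t z k))
    refine (h2.sub h1).congr (ae_of_all _ fun y => ?_)
    simp only [Pi.sub_apply]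
    rw [state, partialDeriv_gauss (F.P_symm t), gaussGrad]
    simp only [map_mul, map_sub, hL]
    ring
  have hGi : Integrable (fun y => G y * f y) volume ∧ Integrable (fun y => G y * g y) volume ∧
      Integrable (fun y => G y * (L y * f y)) volume := by
    obtain ⟨z, a, ha, -, hz⟩ := F.exists_star_state_eq t 0
    obtain ⟨i1, i2, i3⟩ := hint z
    have hz' : ∀ y, (starRingEnd ℂ) (F.state t z y) = a * G y := fun y => by
      rw [hz]; simp [hG, P]
    simp only [hz', mul_assoc] at i1 i2 i3
    have hc : ∀ u : ℂ, a⁻¹ * (a * u) = u := fun u => inv_mul_cancel_left₀ ha u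
    exact ⟨by simpa only [hc] using i1.const_mul a⁻¹, by simpa only [hc] using i2.const_mul a⁻¹,
      by simpa only [hc] using i3.const_mul a⁻¹⟩
  obtain ⟨i1, i2, i3⟩ := hGi
  have hF : ∀ ξ : Rd d, 𝓕 (fun y => G y * g y - G y * (L y * f y)) ξ =
      1 * (2 * Real.pi * Complex.I * ((ξ k : ℝ) : ℂ)) * 𝓕 (fun y => G y * f y) ξ := fun ξ => by
    obtain ⟨z, a, ha, hzeta, hz⟩ := F.exists_star_state_eq t ξ
    obtain ⟨j1, j2, j3⟩ := hint z
    have e1 : ∀ u : Rd d → ℂ, ∫ y, (starRingEnd ℂ) (F.state t z y) * u y =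
        a * 𝓕 (fun y => G y * u y) ξ := fun u => by
      rw [fourier_apply_eq, ← integral_const_mul]
      refine integral_congr_ae (ae_of_all _ fun y => ?_)
      simp only [hz, hG, P]
      ring
    have e2 : ∫ y, (starRingEnd ℂ) (partialDeriv k (F.state t z) y) * f y =
        (starRingEnd ℂ) (F.zeta t z k) * (∫ y, (starRingEnd ℂ) (F.state t z y) * f y) -
          ∫ y, (starRingEnd ℂ) (F.state t z y) * (L y * f y) := by
      rw [← integral_const_mul, ← integral_sub (j1.const_mul _) j3]
      refine integral_congr_ae (ae_of_all _ fun y => ?_)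
      simp only
      rw [state, partialDeriv_gauss (F.P_symm t), gaussGrad]
      simp only [map_mul, map_sub, hL, P]
      ring
    have e3 : 𝓕 (fun y => G y * g y - G y * (L y * f y)) ξ =
        𝓕 (fun y => G y * g y) ξ - 𝓕 (fun y => G y * (L y * f y)) ξ := by
      have hk : ∀ {u : Rd d → ℂ}, Integrable u volume → Integrable (fun y =>
          Complex.exp (-(2 * Real.pi * Complex.I * ∑ i, ((ξ i : ℝ) : ℂ) * ((y i : ℝ) : ℂ))) * u y)
          volume := fun hu => by
        refine hu.bdd_mul (c := 1) (Continuous.aestronglyMeasurable ?_) (ae_of_all _ fun y => ?_)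
        · have := fun i => (contDiff_coord (d := d) (n := 0) i).continuous
          fun_prop
        · rw [Complex.norm_exp]
          refine le_of_eq ?_
          have : (-(2 * Real.pi * Complex.I * ∑ i, ((ξ i : ℝ) : ℂ) * ((y i : ℝ) : ℂ))) =
            ((-(2 * Real.pi * ∑ i, ξ i * y i) : ℝ) : ℂ) * Complex.I := by push_cast; ring
          rw [this, Complex.re_ofReal_mul]
          simp
      rw [fourier_apply_eq, fourier_apply_eq, fourier_apply_eq, ← integral_sub (hk i2) (hk i3)]
      simp only [mul_sub]
    have := h z
    rw [e2, e1, e1, e1, hzeta] at this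
    simp only [map_mul, Complex.conj_I, Complex.conj_ofReal, map_ofNat] at this
    rw [e3]
    refine mul_left_cancel₀ ha ?_
    linear_combination this
  -- The Gaussian is smooth and has no zeros, so division by it preserves test functions.
  have hdiv : IsTest fun y => φ y * (G y)⁻¹ := hφ.mul (hGs.inv hG0)
  have key := integral_mul_eq_of_fourier_eq (i2.sub i3) i1 k 1 hF hdiv
  have hpart : ∀ y, partialDeriv k φ y =
      partialDeriv k (fun y => φ y * (G y)⁻¹) y * G y - L y * φ y := fun y => by
    have e1 : φ = fun y => φ y * (G y)⁻¹ * G y := funext fun y => by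
      rw [mul_assoc, inv_mul_cancel₀ (hG0 y), mul_one]
    have e2 : partialDeriv k G y = - L y * G y := by
      rw [hG, partialDeriv_star ((contDiff_gauss (n := 1) P 0 0).differentiable (by norm_num) y),
        partialDeriv_gauss (F.P_symm t), gaussGrad]
      simp [hL, P]
    have e3 := partialDeriv_mul (φ := fun y => φ y * (G y)⁻¹) (ψ := G) k
      (hdiv.differentiableAt y) ((hGs (n := 1)).differentiable (by norm_num) y)
    rw [← e1, e2] at e3
    rw [e3]
    have := hG0 y
    field_simp
    ring
  have hI1 : Integrable (fun y => G y * f y * partialDeriv k (fun y => φ y * (G y)⁻¹) y) volume := by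
    have hm := (hdiv.partialDeriv k).mul (hGs (n := ∞))
    exact (integrable_mul_L2 hm.memLp f).congr (ae_of_all _ fun y => by ring)
  have hI2 : Integrable (fun y => f y * (L y * φ y)) volume := by
    have hLs : ContDiff ℝ ∞ L := Complex.conjCLE.contDiff.comp (contDiff_linForm (P k))
    exact (integrable_mul_L2 (hφ.mul hLs).memLp f).congr (ae_of_all _ fun y => by ring)
  have hI3 : Integrable (fun y => g y * φ y) volume :=
    (integrable_mul_L2 hφ.memLp g).congr (ae_of_all _ fun y => by ring)
  have e1 : ∫ y, f y * partialDeriv k φ y =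
      (∫ y, G y * f y * partialDeriv k (fun y => φ y * (G y)⁻¹) y) - ∫ y, f y * (L y * φ y) := by
    rw [← integral_sub hI1 hI2]
    refine integral_congr_ae (ae_of_all _ fun y => ?_)
    simp only [hpart]
    ring
  have e2 : ∫ y, ((fun y => G y * g y) - fun y => G y * (L y * f y)) y * (φ y * (G y)⁻¹) =
      (∫ y, g y * φ y) - ∫ y, f y * (L y * φ y) := by
    rw [← integral_sub hI3 hI2]
    refine integral_congr_ae (ae_of_all _ fun y => ?_)
    simp only [Pi.sub_apply]
    have := hG0 y
    field_simp
  rw [e2, one_mul] at key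
  rw [e1]
  linear_combination key

end MetaplecticFlow

end FourierUniqueness

/-! ### The unitary-type evolution on `L²` and uniqueness of weak solutions -/

section Propagator

variable {d : ℕ}

/-- The norm of a linear combination depends only on the Gram matrix of the family. -/
theorem norm_linearCombination_eq {ι H : Type*} [NormedAddCommGroup H] [InnerProductSpace ℂ H]
    {v v' : ι → H} (h : ∀ i j, inner ℂ (v i) (v j) = inner ℂ (v' i) (v' j)) (x : ι →₀ ℂ) :
    ‖Finsupp.linearCombination ℂ v x‖ = ‖Finsupp.linearCombination ℂ v' x‖ := by
  have key : ∀ u : ι → H, inner ℂ (Finsupp.linearCombination ℂ u x)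
      (Finsupp.linearCombination ℂ u x) =
      ∑ i ∈ x.support, x i * ∑ j ∈ x.support,
        (starRingEnd ℂ) (x j) * inner ℂ (u j) (u i) := fun u => by
    simp only [Finsupp.linearCombination_apply, Finsupp.sum, sum_inner, inner_sum,
      inner_smul_left, inner_smul_right]
  have h2 : inner ℂ (Finsupp.linearCombination ℂ v x) (Finsupp.linearCombination ℂ v x) =
      inner ℂ (Finsupp.linearCombination ℂ v' x) (Finsupp.linearCombination ℂ v' x) := by
    simp only [key, h]
  rw [inner_self_eq_norm_sq_to_K, inner_self_eq_norm_sq_to_K] at h2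
  have h3 : ‖Finsupp.linearCombination ℂ v x‖ ^ 2 = ‖Finsupp.linearCombination ℂ v' x‖ ^ 2 :=
    Complex.ofReal_injective (by rw [Complex.ofReal_pow, Complex.ofReal_pow]; exact h2)
  exact (sq_eq_sq₀ (norm_nonneg _) (norm_nonneg _)).1 h3

namespace MetaplecticFlow

variable {M : ℝ → Matrix (Fin d) (Fin d) ℝ} {b : ℝ → Fin d → ℝ} (F : MetaplecticFlow M b)

theorem eq_of_inner_stateL2 (t : ℝ) {f g : L2 d}
    (h : ∀ z, inner ℂ (F.stateL2 t z) f = inner ℂ (F.stateL2 t z) g) : f = g := by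
  have h0 : ((f - g : L2 d) : Rd d → ℂ) =ᵐ[volume] 0 :=
    F.ae_eq_zero_of_integral_state t
      (fun z => integrable_star_mul_L2 (F.memLp_state t z) (f - g)) fun z => by
        rw [← inner_toLp (F.memLp_state t z) (f - g), inner_sub_right]
        exact sub_eq_zero.2 (h z)
  exact sub_eq_zero.1 ((Lp.eq_zero_iff_ae_eq_zero).2 h0)

/-- Linear combinations of Gaussians, evolved up to time `t`. -/
noncomputable def combination (t : ℝ) : ((Fin d → ℂ) →₀ ℂ) →ₗ[ℂ] L2 d :=
  Finsupp.linearCombination ℂ (F.stateL2 t)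

/-- A vector orthogonal to all evolved Gaussians is zero by totality. -/
theorem denseRange_combination (t : ℝ) : DenseRange (F.combination t) := by
  have h : (LinearMap.range (F.combination t))ᗮ = ⊥ := by
    rw [Submodule.eq_bot_iff]
    intro f hf
    refine F.eq_of_inner_stateL2 t fun z => ?_
    rw [inner_zero_right]
    refine (Submodule.mem_orthogonal _ _).1 hf _ ⟨Finsupp.single z 1, ?_⟩
    simp [combination]
  rw [← Submodule.topologicalClosure_eq_top_iff, ← Submodule.dense_iff_topologicalClosure_eq_top] at h
  rwa [DenseRange, ← LinearMap.coe_range]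

/-- An evolved Gaussian is itself a weak solution, so conservation of pairings applies to it.
Conserved Gram matrices make the map from initial to evolved combinations isometric. -/
theorem inner_stateL2_stateL2 (hM : Continuous M) (hb : Continuous b) {t : ℝ} (ht : 0 ≤ t)
    (z z' : Fin d → ℂ) :
    inner ℂ (F.stateL2 t z) (F.stateL2 t z') = inner ℂ (F.stateL2 0 z) (F.stateL2 0 z') :=
  F.inner_stateL2_eq hM hb z (F.continuous_stateL2 hM hb z').continuousOn
    (F.isWeakSchrodinger_stateL2 hM hb z') ht

theorem norm_combination_eq (hM : Continuous M) (hb : Continuous b) {t : ℝ} (ht : 0 ≤ t)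
    (x : (Fin d → ℂ) →₀ ℂ) : ‖F.combination t x‖ = ‖F.combination 0 x‖ :=
  norm_linearCombination_eq (F.inner_stateL2_stateL2 hM hb ht) x

/-- The propagator, as a continuous linear map. -/
noncomputable def propCLM (t : ℝ) : L2 d →L[ℂ] L2 d :=
  (F.combination (max t 0)).extendOfNorm (F.combination 0)

/-- Equality of norms makes the extension by density legitimate. The clamp `max t 0` is there
because Gram matrices are compared only for nonnegative times. -/
theorem propCLM_combination (hM : Continuous M) (hb : Continuous b) (t : ℝ)
    (x : (Fin d → ℂ) →₀ ℂ) : F.propCLM t (F.combination 0 x) = F.combination (max t 0) x :=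
  LinearMap.extendOfNorm_eq (F.denseRange_combination 0)
    ⟨1, fun y => by rw [one_mul, F.norm_combination_eq hM hb (le_max_right t 0)]⟩ x

theorem norm_propCLM (hM : Continuous M) (hb : Continuous b) (t : ℝ) (a : L2 d) :
    ‖F.propCLM t a‖ = ‖a‖ := by
  refine (F.denseRange_combination 0).induction_on (p := fun a => ‖F.propCLM t a‖ = ‖a‖) a
    (isClosed_eq (F.propCLM t).continuous.norm continuous_norm) fun x => ?_
  rw [F.propCLM_combination hM hb, F.norm_combination_eq hM hb (le_max_right t 0)]

/-- The propagator, as a linear isometry of `L²`. -/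
noncomputable def prop (hM : Continuous M) (hb : Continuous b) (t : ℝ) : L2 d →ₗᵢ[ℂ] L2 d :=
  ⟨(F.propCLM t).toLinearMap, F.norm_propCLM hM hb t⟩

variable (hM : Continuous M) (hb : Continuous b)

theorem prop_combination (t : ℝ) (x : (Fin d → ℂ) →₀ ℂ) :
    F.prop hM hb t (F.combination 0 x) = F.combination (max t 0) x :=
  F.propCLM_combination hM hb t x

theorem prop_stateL2 (t : ℝ) (z : Fin d → ℂ) :
    F.prop hM hb t (F.stateL2 0 z) = F.stateL2 (max t 0) z := by
  have := F.prop_combination hM hb t (Finsupp.single z 1)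
  simpa [combination] using this

theorem prop_zero (a : L2 d) : F.prop hM hb 0 a = a := by
  refine (F.denseRange_combination 0).induction_on (p := fun a => F.prop hM hb 0 a = a) a
    (isClosed_eq (F.prop hM hb 0).continuous continuous_id) fun x => ?_
  rw [F.prop_combination, max_self]

/-- Combinations of Gaussians evolve continuously, and by isometry an approximation of `a` at time
zero is equally good at all times: a uniform limit of continuous curves. -/
theorem continuous_prop (a : L2 d) : Continuous fun t => F.prop hM hb t a := by
  have hcomb : ∀ x, Continuous fun t => F.combination t x := fun x => by
    simp only [combination, Finsupp.linearCombination_apply, Finsupp.sum]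
    exact continuous_finsetSum _ fun z _ => by
      have := F.continuous_stateL2 hM hb z
      fun_prop
  refine continuous_of_uniform_approx_of_continuous fun u hu => ?_
  obtain ⟨ε, hε, hu⟩ := Metric.mem_uniformity_dist.1 hu
  obtain ⟨x, hx⟩ := (F.denseRange_combination 0).exists_dist_lt a hε
  refine ⟨fun t => F.prop hM hb t (F.combination 0 x), ?_, fun t => hu ?_⟩
  · simp only [prop_combination]
    exact (hcomb x).comp (by fun_prop)
  · rwa [(F.prop hM hb t).isometry.dist_eq]

theorem continuous_uncurry_prop : Continuous fun p : L2 d × ℝ => F.prop hM hb p.2 p.1 := by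
  rw [continuous_iff_continuousAt]
  rintro ⟨a, t⟩
  rw [ContinuousAt, tendsto_iff_norm_sub_tendsto_zero]
  have h1 : Tendsto (fun p : L2 d × ℝ => ‖p.1 - a‖ + ‖F.prop hM hb p.2 a - F.prop hM hb t a‖)
      (𝓝 (a, t)) (𝓝 (‖a - a‖ + ‖F.prop hM hb t a - F.prop hM hb t a‖)) := by
    refine Continuous.tendsto (f := fun p : L2 d × ℝ =>
      ‖p.1 - a‖ + ‖F.prop hM hb p.2 a - F.prop hM hb t a‖) ?_ (a, t)
    exact (continuous_fst.sub continuous_const).norm.add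
      (((F.continuous_prop hM hb a).comp continuous_snd).sub continuous_const).norm
  simp only [sub_self, norm_zero, add_zero] at h1
  refine squeeze_zero (fun _ => norm_nonneg _) (fun p => ?_) h1
  have : F.prop hM hb p.2 p.1 - F.prop hM hb t a =
      F.prop hM hb p.2 (p.1 - a) + (F.prop hM hb p.2 a - F.prop hM hb t a) := by
    rw [map_sub]; abel
  refine (congrArg norm this).trans_le ((norm_add_le _ _).trans ?_)
  rw [LinearIsometry.norm_map]

/-- The functional `f ↦ ∫ f φ`. -/
noncomputable def _root_.IsTest.pairing {φ : Rd d → ℂ} (hφ : IsTest φ) : L2 d →L[ℂ] ℂ :=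
  innerSL ℂ (hφ.memLp.conj.toLp _ : L2 d)

theorem _root_.IsTest.pairing_apply {φ : Rd d → ℂ} (hφ : IsTest φ) (f : L2 d) :
    hφ.pairing f = ∫ y, f y * φ y :=
  inner_star_toLp hφ.memLp.conj f

/-- The potential is a polynomial in `y`, so the functional is a combination of fixed pairings with
`y_i y_j φ`, `y_i φ` and `Δφ`, with coefficients continuous in time. Hence it is continuous in time
in operator norm. -/
theorem exists_generator_functional (hM : Continuous M) (hb : Continuous b) {φ : Rd d → ℂ}
    (hφ : IsTest φ) : ∃ ℓ : ℝ → L2 d →L[ℂ] ℂ, Continuous ℓ ∧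
      ∀ t f, ℓ t f = -Complex.I * ∫ y, f y * ((quadPotential M b t y : ℂ) * φ y -
        1 / 2 * Laplacian.laplacian φ y) := by
  refine ⟨fun t => -Complex.I • (((1 / 2 : ℂ) • ∑ i, ∑ j, (M t i j : ℂ) •
    ((hφ.coord_mul j).coord_mul i).pairing) - (∑ i, (b t i : ℂ) • (hφ.coord_mul i).pairing) -
      (1 / 2 : ℂ) • hφ.laplacian.pairing), ?_, fun t f => ?_⟩
  · have h1 : ∀ i j, Continuous fun t => (M t i j : ℂ) := fun i j =>
      Complex.continuous_ofReal.comp (hM.matrix_elem i j)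
    have h2 : ∀ i, Continuous fun t => (b t i : ℂ) := fun i =>
      Complex.continuous_ofReal.comp ((continuous_apply i).comp hb)
    fun_prop
  · have i1 : ∀ {ψ : Rd d → ℂ}, IsTest ψ → ∀ c : ℂ,
        Integrable (fun y => c * (f y * ψ y)) volume := fun hψ c =>
      ((integrable_mul_L2 hψ.memLp f).congr (ae_of_all _ fun y => mul_comm _ _)).const_mul c
    have i2 : Integrable (fun y => ∑ i, ∑ j, (M t i j : ℂ) *
        (f y * (((y i : ℝ) : ℂ) * (((y j : ℝ) : ℂ) * φ y)))) volume :=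
      integrable_finsetSum _ fun i _ => integrable_finsetSum _ fun j _ =>
        i1 ((hφ.coord_mul j).coord_mul i) _
    have i3 : Integrable (fun y => ∑ i, (b t i : ℂ) * (f y * (((y i : ℝ) : ℂ) * φ y))) volume :=
      integrable_finsetSum _ fun i _ => i1 (hφ.coord_mul i) _
    have e : ∀ y, f y * ((quadPotential M b t y : ℂ) * φ y - 1 / 2 * Laplacian.laplacian φ y) =
        1 / 2 * (∑ i, ∑ j, (M t i j : ℂ) * (f y * (((y i : ℝ) : ℂ) * (((y j : ℝ) : ℂ) * φ y)))) -
        (∑ i, (b t i : ℂ) * (f y * (((y i : ℝ) : ℂ) * φ y))) -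
        1 / 2 * (f y * Laplacian.laplacian φ y) := fun y => by
      rw [ofReal_quadPotential, quadForm, linForm]
      simp only [mul_sub, sub_mul, Finset.mul_sum, Finset.sum_mul, complexify, Matrix.map_apply]
      refine congrArg₂ _ (congrArg₂ _ (Finset.sum_congr rfl fun i _ =>
        Finset.sum_congr rfl fun j _ => ?_) (Finset.sum_congr rfl fun i _ => ?_)) ?_ <;> ring
    have i4 := i2.const_mul (1 / 2)
    have i5 := i1 hφ.laplacian (1 / 2)
    simp only [e]
    rw [integral_sub (f := fun y => 1 / 2 * (∑ i, ∑ j, (M t i j : ℂ) *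
        (f y * (((y i : ℝ) : ℂ) * (((y j : ℝ) : ℂ) * φ y)))) -
        (∑ i, (b t i : ℂ) * (f y * (((y i : ℝ) : ℂ) * φ y)))) (i4.sub i3) i5,
      integral_sub i4 i3, integral_const_mul, integral_const_mul,
      integral_finsetSum _ (fun i _ => i1 (hφ.coord_mul i) _),
      integral_finsetSum _ (fun i _ => integrable_finsetSum _ fun j _ =>
        i1 ((hφ.coord_mul j).coord_mul i) _)]
    have e2 : ∀ i, ∫ y, ∑ j, (M t i j : ℂ) * (f y * (((y i : ℝ) : ℂ) * (((y j : ℝ) : ℂ) * φ y))) =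
        ∑ j, (M t i j : ℂ) * ∫ y, f y * (((y i : ℝ) : ℂ) * (((y j : ℝ) : ℂ) * φ y)) := fun i => by
      rw [integral_finsetSum _ (fun j _ => i1 ((hφ.coord_mul j).coord_mul i) _)]
      simp only [integral_const_mul]
    simp only [e2, integral_const_mul, smul_apply, sub_apply, sum_apply, smul_eq_mul,
      IsTest.pairing_apply]

/-- The integrated equation, unlike the differentiated one, is stable under `L²` limits of the
initial datum, so it passes from combinations of Gaussians to every `a`. -/
theorem integral_prop_eq {φ : Rd d → ℂ} (hφ : IsTest φ) {ℓ : ℝ → L2 d →L[ℂ] ℂ}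
    (hℓ : Continuous ℓ) (hℓ' : ∀ t f, ℓ t f = -Complex.I * ∫ y, f y *
      ((quadPotential M b t y : ℂ) * φ y - 1 / 2 * Laplacian.laplacian φ y)) (a : L2 d) {t : ℝ}
    (ht : 0 ≤ t) : hφ.pairing (F.prop hM hb t a) =
      hφ.pairing a + ∫ s in (0 : ℝ)..t, ℓ s (F.prop hM hb s a) := by
  have hjoint : Continuous fun p : L2 d × ℝ => ℓ p.2 (F.prop hM hb p.2 p.1) :=
    (hℓ.comp continuous_snd).clm_apply (F.continuous_uncurry_prop hM hb)
  have hcont : ∀ c : L2 d, Continuous fun s => ℓ s (F.prop hM hb s c) := fun c =>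
    hℓ.clm_apply (F.continuous_prop hM hb c)
  refine (F.denseRange_combination 0).induction_on (p := fun a => hφ.pairing (F.prop hM hb t a) =
      hφ.pairing a + ∫ s in (0 : ℝ)..t, ℓ s (F.prop hM hb s a)) a (isClosed_eq ?_ ?_) fun x => ?_
  · exact hφ.pairing.continuous.comp (F.prop hM hb t).continuous
  · exact hφ.pairing.continuous.add
      (intervalIntegral.continuous_parametric_intervalIntegral_of_continuous' hjoint 0 t)
  · induction x using Finsupp.induction_linear with
    | zero => simp
    | add x y hx hy =>
      simp only [map_add]
      rw [intervalIntegral.integral_add ((hcont _).intervalIntegrable _ _)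
        ((hcont _).intervalIntegrable _ _), hx, hy]
      ring
    | single z c =>
      have hs : F.combination 0 (Finsupp.single z c) = c • F.stateL2 0 z := by
        simp [combination]
      rw [hs]
      simp only [map_smul, intervalIntegral.integral_smul, ← smul_add]
      congr 1
      have hd : ∀ s ∈ uIcc 0 t, HasDerivAt (fun s => hφ.pairing (F.stateL2 s z))
          (ℓ s (F.prop hM hb s (F.stateL2 0 z))) s := fun s hs => by
        rw [uIcc_of_le ht] at hs
        rw [F.prop_stateL2, max_eq_left hs.1, hℓ']
        simp only [IsTest.pairing_apply]
        exact F.hasDerivAt_integral_stateL2 hM hb z hφ s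
      rw [intervalIntegral.integral_eq_sub_of_hasDerivAt hd ((hcont _).intervalIntegrable _ _),
        F.prop_stateL2, max_eq_left ht]
      ring

theorem isWeakSchrodinger_prop (a : L2 d) :
    IsWeakSchrodinger (quadPotential M b) fun t => F.prop hM hb t a := by
  intro φ hφ t ht
  obtain ⟨ℓ, hℓ, hℓ'⟩ := exists_generator_functional hM hb hφ
  have hcont : Continuous fun s => ℓ s (F.prop hM hb s a) :=
    hℓ.clm_apply (F.continuous_prop hM hb a)
  rw [← hℓ']
  have h1 := ((hasDerivAt_integral_of_continuous hcont t).const_add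
    (hφ.pairing a)).hasDerivWithinAt (s := Ici 0)
  simp only [← IsTest.pairing_apply hφ]
  exact h1.congr (fun s hs => F.integral_prop_eq hM hb hφ hℓ hℓ' a hs)
    (F.integral_prop_eq hM hb hφ hℓ hℓ' a ht)

/-- Uniqueness of weak solutions in `C([0, ∞); L²)`. -/
theorem eq_prop_of_isWeakSchrodinger {w : ℝ → L2 d} (hw : ContinuousOn w (Ici 0))
    (hweak : IsWeakSchrodinger (quadPotential M b) w) {t : ℝ} (ht : 0 ≤ t) :
    w t = F.prop hM hb t (w 0) := by
  refine F.eq_of_inner_stateL2 t fun z => ?_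
  rw [F.inner_stateL2_eq hM hb z hw hweak ht, ← LinearIsometry.inner_map_map (F.prop hM hb t),
    F.prop_stateL2, max_eq_left ht]

end MetaplecticFlow

end Propagator

/-! ### Differentiating evolved Gaussians in their parameter -/

section Conjugation

open scoped Matrix Matrix.Norms.Operator

variable {d : ℕ}

/-- `g = y_j f`. -/
def IsMulCoord (j : Fin d) (f g : L2 d) : Prop :=
  ∀ᵐ y : Rd d, g y = ((y j : ℝ) : ℂ) * f y

/-- `g = ∂_j f` in the sense of distributions. -/
def IsWeakPartial (j : Fin d) (f g : L2 d) : Prop :=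
  ∀ φ : Rd d → ℂ, IsTest φ → ∫ y, f y * partialDeriv j φ y = - ∫ y, g y * φ y

theorem integrable_L2_mul {f : Rd d → ℂ} (hf : MemLp f 2 volume) (g : L2 d) :
    Integrable (fun y => g y * f y) volume :=
  (integrable_mul_L2 hf g).congr (ae_of_all _ fun _ => mul_comm _ _)

/-- Enlarges the class of test functions, by cutoff and dominated convergence, so that Gaussians
become admissible. -/
theorem IsWeakPartial.integral_mul_partialDeriv {j : Fin d} {f g : L2 d} (h : IsWeakPartial j f g)
    {ψ : Rd d → ℂ} (hψ : ContDiff ℝ ∞ ψ) (hψ2 : MemLp ψ 2 volume)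
    (hdψ : MemLp (partialDeriv j ψ) 2 volume) :
    ∫ y, f y * partialDeriv j ψ y = - ∫ y, g y * ψ y := by
  obtain ⟨χ, C, hC0, hχ, hχb, hχ1, hχd⟩ := exists_cutoff d
  have hχb' : ∀ n y, ‖(χ n y : ℂ)‖ ≤ 1 := fun n y => by
    rw [Complex.norm_real]; exact hχb n y
  have hd : ∀ n y, partialDeriv j (fun y => (χ n y : ℂ) * ψ y) y =
      partialDeriv j (fun y => (χ n y : ℂ)) y * ψ y + (χ n y : ℂ) * partialDeriv j ψ y :=
    fun n y => partialDeriv_mul j ((hχ n).differentiableAt y) (hψ.differentiable (by simp) y)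
  have hdχ : ∀ n y, ‖partialDeriv j (fun y => (χ n y : ℂ)) y‖ ≤ C := fun n y =>
    ((hχd n y).1 j).trans (div_le_self hC0 (by linarith [n.cast_nonneg (α := ℝ)]))
  have hdχ0 : ∀ y, Tendsto (fun n => partialDeriv j (fun y => (χ n y : ℂ)) y) atTop (𝓝 0) :=
    fun y => squeeze_zero_norm (fun n => (hχd n y).1 j) (by
      have := tendsto_one_div_add_atTop_nhds_zero_nat.const_mul C
      simpa [div_eq_mul_inv] using this)
  have hχlim : ∀ y, Tendsto (fun n => (χ n y : ℂ)) atTop (𝓝 1) := fun y => by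
    refine tendsto_const_nhds.congr' ?_
    filter_upwards [hχ1 y] with n hn
    rw [hn, Complex.ofReal_one]
  have e := fun n => h _ ((hχ n).mul hψ)
  have h1 : Tendsto (fun n => ∫ y, f y * partialDeriv j (fun y => (χ n y : ℂ) * ψ y) y) atTop
      (𝓝 (∫ y, f y * partialDeriv j ψ y)) := by
    refine tendsto_integral_of_dominated_convergence
      (fun y => C * ‖f y * ψ y‖ + ‖f y * partialDeriv j ψ y‖) (fun n => ?_) ?_ (fun n => ?_) ?_
    · exact (integrable_L2_mul (((hχ n).mul hψ).partialDeriv j).memLp f).1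
    · exact ((integrable_L2_mul hψ2 f).norm.const_mul C).add (integrable_L2_mul hdψ f).norm
    · refine ae_of_all _ fun y => ?_
      rw [hd, mul_add]
      refine (norm_add_le _ _).trans (add_le_add ?_ ?_)
      · rw [mul_left_comm, norm_mul]
        gcongr
        exact hdχ n y
      · rw [mul_left_comm, norm_mul]
        exact mul_le_of_le_one_left (norm_nonneg _) (hχb' n y)
    · refine ae_of_all _ fun y => ?_
      simp only [hd]
      have := (((hdχ0 y).mul_const (ψ y)).add ((hχlim y).mul_const (partialDeriv j ψ y))).const_mul
        (f y)
      simpa using this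
  have h2 : Tendsto (fun n => - ∫ y, g y * ((χ n y : ℂ) * ψ y)) atTop (𝓝 (- ∫ y, g y * ψ y)) := by
    refine Tendsto.neg (tendsto_integral_of_dominated_convergence
      (fun y => ‖g y * ψ y‖) (fun n => ?_) ?_ (fun n => ?_) ?_)
    · exact (integrable_L2_mul ((hχ n).mul hψ).memLp g).1
    · exact (integrable_L2_mul hψ2 g).norm
    · refine ae_of_all _ fun y => ?_
      rw [mul_left_comm, norm_mul]
      exact mul_le_of_le_one_left (norm_nonneg _) (hχb' n y)
    · refine ae_of_all _ fun y => ?_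
      have := ((hχlim y).mul_const (ψ y)).const_mul (g y)
      simpa using this
  simp only [e] at h1
  exact tendsto_nhds_unique h1 h2

namespace MetaplecticFlow

variable {M : ℝ → Matrix (Fin d) (Fin d) ℝ} {b : ℝ → Fin d → ℝ} (F : MetaplecticFlow M b)

theorem N_symm (t : ℝ) : (F.N t)ᵀ = F.N t := by
  have h : ∀ t, HasDerivAt (fun t => (F.N t)ᵀ - F.N t) 0 t := fun t =>
    ((F.N_deriv t).matrix_transpose.sub (F.N_deriv t)).congr_deriv (by
      rw [Matrix.transpose_mul, Matrix.transpose_transpose, sub_self])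
  have := eq_const_of_hasDerivAt_zero h t
  rw [F.N_zero, Matrix.transpose_zero, sub_zero] at this
  exact sub_eq_zero.1 this

/-- The logarithmic derivative of the evolved Gaussian in its parameter. -/
noncomputable def paramRate (t : ℝ) (k : Fin d) (z : Fin d → ℂ) (y : Rd d) : ℂ :=
  ((F.R t)ᵀ *ᵥ coordVec y) k + Complex.I * (F.N t *ᵥ z) k - F.ν t k

theorem hasDerivAt_state_param (t : ℝ) (k : Fin d) (z : Fin d → ℂ) (y : Rd d) (h : ℝ) :
    HasDerivAt (fun h : ℝ => F.state t (z + (h : ℂ) • Pi.single k 1) y)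
      (F.paramRate t k (z + (h : ℂ) • Pi.single k 1) y * F.state t (z + (h : ℂ) • Pi.single k 1) y)
      h := by
  set e : Fin d → ℂ := Pi.single k 1 with he
  have hz : HasDerivAt (fun h : ℝ => z + (h : ℂ) • e) e h := by
    have := ((hasDerivAt_id h).ofReal_comp.smul_const e).const_add z
    simpa using this
  have hζ : HasDerivAt (fun h : ℝ => F.zeta t (z + (h : ℂ) • e)) (F.R t *ᵥ e) h := by
    have := (hasDerivAt_const h (F.R t)).matrix_mulVec (hz.add_const (Complex.I • F.β t))
    exact this.congr_deriv (by simp)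
  have hl : HasDerivAt (fun h : ℝ => linForm (F.zeta t (z + (h : ℂ) • e)) y)
      (linForm (F.R t *ᵥ e) y) h :=
    HasDerivAt.fun_sum fun i _ => (hasDerivAt_pi.1 hζ i).mul_const _
  have dot : ∀ {u v : ℝ → Fin d → ℂ} {u' v' : Fin d → ℂ}, HasDerivAt u u' h → HasDerivAt v v' h →
      HasDerivAt (fun t => u t ⬝ᵥ v t) (u' ⬝ᵥ v h + u h ⬝ᵥ v') h := fun hu hv => by
    have := HasDerivAt.fun_sum (u := Finset.univ)
      fun i _ => (hasDerivAt_pi.1 hu i).mul (hasDerivAt_pi.1 hv i)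
    exact this.congr_deriv (by simp only [dotProduct, Finset.sum_add_distrib])
  have hNz : HasDerivAt (fun h : ℝ => F.N t *ᵥ (z + (h : ℂ) • e)) (F.N t *ᵥ e) h :=
    ((hasDerivAt_const h (F.N t)).matrix_mulVec hz).congr_deriv (by simp)
  have hp : HasDerivAt (fun h : ℝ => F.phase t (z + (h : ℂ) • e)) _ h :=
    (((dot hz hNz).const_mul (Complex.I / 2)).const_add (F.s₁ t)).sub
      (dot (hasDerivAt_const h (F.ν t)) hz)
  have h := ((hl.const_add (-(1 / 2 : ℂ) * quadForm (F.P t) y)).add hp).cexp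
  refine h.congr_deriv ?_
  rw [mul_comm (Complex.exp _)]
  refine congrArg₂ _ ?_ rfl
  have h1 : ∀ v, (e ⬝ᵥ v) = v k := fun v => by simp [he]
  have h2 : ∀ v, v ⬝ᵥ (F.N t *ᵥ e) = (F.N t *ᵥ v) k := fun v => by
    rw [Matrix.dotProduct_mulVec, ← Matrix.mulVec_transpose, F.N_symm, dotProduct_comm, h1]
  rw [linForm_eq, h2, h1, dotProduct_comm _ e, h1, zero_dotProduct, paramRate,
    dotProduct_comm (F.R t *ᵥ e), Matrix.dotProduct_mulVec, ← Matrix.mulVec_transpose,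
    dotProduct_comm _ e, h1]
  ring

theorem exists_paramRate_bound (t : ℝ) (k : Fin d) (K : ℝ) : ∃ B, ∀ z : Fin d → ℂ, ‖z‖ ≤ K →
    ∀ y, ‖F.paramRate t k z y‖ ≤ B * (1 + ‖y‖ ^ 2) := by
  refine ⟨(∑ i, ‖F.R t i k‖) + (∑ i, ‖F.N t k i‖ * |K|) + ‖F.ν t k‖, fun z hz y => ?_⟩
  have h1 : ‖((F.R t)ᵀ *ᵥ coordVec y) k‖ ≤ (∑ i, ‖F.R t i k‖) * (1 + ‖y‖ ^ 2) := by
    have e : ((F.R t)ᵀ *ᵥ coordVec y) k = ∑ i, F.R t i k * coordVec y i := rfl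
    rw [Finset.sum_mul, e]
    refine (norm_sum_le _ _).trans (Finset.sum_le_sum fun j _ => ?_)
    rw [norm_mul]
    have := (abs_coord_le y j).trans (le_one_add_sq _)
    exact mul_le_mul_of_nonneg_left this (norm_nonneg _)
  have h2 : ‖(F.N t *ᵥ z) k‖ ≤ ∑ i, ‖F.N t k i‖ * |K| := by
    have e : (F.N t *ᵥ z) k = ∑ i, F.N t k i * z i := rfl
    rw [e]
    refine (norm_sum_le _ _).trans (Finset.sum_le_sum fun j _ => ?_)
    rw [norm_mul]
    exact mul_le_mul_of_nonneg_left ((norm_le_pi_norm z j).trans (hz.trans (le_abs_self _)))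
      (norm_nonneg _)
  have h3 : ‖F.paramRate t k z y‖ ≤ ‖((F.R t)ᵀ *ᵥ coordVec y) k‖ + ‖(F.N t *ᵥ z) k‖ +
      ‖F.ν t k‖ := by
    refine (norm_sub_le _ _).trans (add_le_add ((norm_add_le _ _).trans_eq ?_) le_rfl)
    rw [norm_mul, Complex.norm_I, one_mul]
  nlinarith [norm_nonneg (F.ν t k), norm_nonneg ((F.N t *ᵥ z) k), sq_nonneg ‖y‖]

theorem continuous_paramRate (t : ℝ) (k : Fin d) (z : Fin d → ℂ) :
    Continuous (F.paramRate t k z) := by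
  have h : ∀ i, Continuous fun y : Rd d => coordVec y i := fun i =>
    (contDiff_coord (d := d) (n := 0) i).continuous
  unfold paramRate
  simp only [Matrix.mulVec, dotProduct]
  fun_prop

theorem memLp_paramRate_mul_state (t : ℝ) (k : Fin d) (z : Fin d → ℂ) :
    MemLp (fun y => F.paramRate t k z y * F.state t z y) 2 volume := by
  obtain ⟨B, hB⟩ := F.exists_paramRate_bound t k ‖z‖
  exact F.memLp_mul_state t z (F.continuous_paramRate t k z) (hB z le_rfl)

theorem hasDerivAt_stateL2_param (t : ℝ) (k : Fin d) (z : Fin d → ℂ) :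
    HasDerivAt (fun h : ℝ => F.stateL2 t (z + (h : ℂ) • Pi.single k 1))
      ((F.memLp_paramRate_mul_state t k z).toLp _) 0 := by
  obtain ⟨B, hB⟩ := F.exists_paramRate_bound t k (‖z‖ + 1)
  obtain ⟨c, hc, C, hC0, hC⟩ := F.exists_state_bound |t| (‖z‖ + 1)
  have hz : ∀ h ∈ Metric.ball (0 : ℝ) 1, ‖z + (h : ℂ) • (Pi.single k 1 : Fin d → ℂ)‖ ≤ ‖z‖ + 1 :=
    fun h hh => by
      refine (norm_add_le _ _).trans (add_le_add le_rfl ?_)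
      rw [norm_smul, Complex.norm_real, Pi.norm_single, norm_one, mul_one]
      exact (mem_ball_zero_iff.1 hh).le
  let ζ : ℝ → Fin d → ℂ := fun h => z + (h : ℂ) • Pi.single k 1
  have h0 : ζ 0 = z := by simp [ζ]
  have key : HasDerivAt (fun h => F.stateL2 t (ζ h))
      ((F.memLp_paramRate_mul_state t k (ζ 0)).toLp _) 0 :=
    hasDerivAt_toLp (f := fun h : ℝ => F.state t (ζ h))
      (f' := fun h y => F.paramRate t k (ζ h) y * F.state t (ζ h) y)
      (g := fun y => B * C * gaussWeight c y) (t := 0)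
      (fun h => F.memLp_state t (ζ h)) (F.memLp_paramRate_mul_state t k (ζ 0))
      ((memLp_gaussWeight hc).const_mul (B * C)) one_pos
      (fun s _ y => F.hasDerivAt_state_param t k z y s)
      (fun s hs y => hC t le_rfl _ (hz s hs) y _ B (hB _ (hz s hs) y))
  rw [h0] at key
  exact key

variable (hM : Continuous M) (hb : Continuous b)

theorem inner_prop (z : Fin d → ℂ) {t : ℝ} (ht : 0 ≤ t) (a : L2 d) :
    inner ℂ (F.stateL2 t z) (F.prop hM hb t a) = inner ℂ (F.stateL2 0 z) a := by
  rw [← LinearIsometry.inner_map_map (F.prop hM hb t) (F.stateL2 0 z) a, F.prop_stateL2,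
    max_eq_left ht]

/-- The pairings at times `t` and `0` agree for all `z`, hence so do their derivatives in `z_k`. At
time zero this derivative brings down `y_k`; at time `t` it brings down the affine form `paramRate`.
This is the source of the conjugation formulas. -/
theorem integral_paramRate_prop (k : Fin d) (z : Fin d → ℂ) {t : ℝ} (ht : 0 ≤ t) (a : L2 d) :
    ∫ y, (starRingEnd ℂ) (F.paramRate t k z y * F.state t z y) * F.prop hM hb t a y =
      ∫ y, (starRingEnd ℂ) (F.paramRate 0 k z y * F.state 0 z y) * a y := by
  rw [← inner_toLp (F.memLp_paramRate_mul_state t k z), ← inner_toLp (F.memLp_paramRate_mul_state 0 k z)]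
  have h1 := (F.hasDerivAt_stateL2_param t k z).inner (𝕜 := ℂ)
    (hasDerivAt_const (0 : ℝ) (F.prop hM hb t a))
  have h2 := (F.hasDerivAt_stateL2_param 0 k z).inner (𝕜 := ℂ) (hasDerivAt_const (0 : ℝ) a)
  simp only [F.inner_prop hM hb _ ht] at h1
  have := h1.unique h2
  simpa using this

end MetaplecticFlow

end Conjugation

/-! ### Position and derivative operators conjugated by the propagator; Ehrenfest's law -/

section Conjugation

open scoped Matrix Matrix.Norms.Operator

variable {d : ℕ}

namespace MetaplecticFlow

variable {M : ℝ → Matrix (Fin d) (Fin d) ℝ} {b : ℝ → Fin d → ℝ} (F : MetaplecticFlow M b)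
  (hM : Continuous M) (hb : Continuous b)

/-- The momentum parameter of a Gaussian acts on pairings as `y_i - ∂_i`. -/
theorem conj_mul_inner_stateL2_zero (z : Fin d → ℂ) (i : Fin d) {a x D : L2 d}
    (hx : IsMulCoord i a x) (hD : IsWeakPartial i a D) :
    (starRingEnd ℂ) (z i) * inner ℂ (F.stateL2 0 z) a = inner ℂ (F.stateL2 0 z) (x - D) := by
  have hp : ∀ y, partialDeriv i (F.state 0 z) y = (z i - coordVec y i) * F.state 0 z y := fun y => by
    have h := partialDeriv_gauss (F.P_symm 0) (F.zeta 0 z) (F.phase 0 z) i y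
    rw [F.zeta_zero, gaussGrad_eq, F.P_zero, Matrix.one_mulVec] at h
    rw [state, F.zeta_zero, F.P_zero]
    exact h
  have h1 := hD.integral_mul_partialDeriv (ψ := fun y => (starRingEnd ℂ) (F.state 0 z y))
    (contDiff_star_gauss _ _ _) (F.memLp_state 0 z).conj (by
      have h := (F.memLp_partialDeriv_state 0 z i).conj
      refine (memLp_congr_ae (ae_of_all _ fun y => ?_)).1 h
      exact (partialDeriv_star ((F.contDiff_state (n := 1) 0 z).differentiable (by norm_num) y)
        i).symm)
  have h2 : ∀ y, partialDeriv i (fun y => (starRingEnd ℂ) (F.state 0 z y)) y =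
      ((starRingEnd ℂ) (z i) - ((y i : ℝ) : ℂ)) * (starRingEnd ℂ) (F.state 0 z y) := fun y => by
    rw [partialDeriv_star ((F.contDiff_state (n := 1) 0 z).differentiable (by norm_num) y), hp]
    simp [coordVec]
  simp only [h2] at h1
  have i1 := (integrable_star_mul_L2 (F.memLp_state 0 z) a).const_mul ((starRingEnd ℂ) (z i))
  have i2 := integrable_star_mul_L2 (F.memLp_state 0 z) x
  have h3 : ∫ y, a y * (((starRingEnd ℂ) (z i) - ((y i : ℝ) : ℂ)) * (starRingEnd ℂ) (F.state 0 z y)) =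
      (∫ y, (starRingEnd ℂ) (z i) * ((starRingEnd ℂ) (F.state 0 z y) * a y)) -
        ∫ y, (starRingEnd ℂ) (F.state 0 z y) * x y := by
    rw [← integral_sub i1 i2]
    refine integral_congr_ae ?_
    filter_upwards [hx] with y hy
    rw [hy]
    ring
  have h4 : ∫ y, D y * (starRingEnd ℂ) (F.state 0 z y) =
      ∫ y, (starRingEnd ℂ) (F.state 0 z y) * D y :=
    integral_congr_ae (ae_of_all _ fun y => mul_comm _ _)
  rw [h3, h4, integral_const_mul] at h1
  rw [inner_sub_right, stateL2, inner_toLp, inner_toLp, inner_toLp]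
  linear_combination h1

theorem conj_mul_inner_stateL2 (z : Fin d → ℂ) (i : Fin d) {t : ℝ} (ht : 0 ≤ t) {a x D : L2 d}
    (hx : IsMulCoord i a x) (hD : IsWeakPartial i a D) :
    (starRingEnd ℂ) (z i) * inner ℂ (F.stateL2 t z) (F.prop hM hb t a) =
      inner ℂ (F.stateL2 t z) (F.prop hM hb t (x - D)) := by
  rw [F.inner_prop hM hb z ht, F.inner_prop hM hb z ht, F.conj_mul_inner_stateL2_zero z i hx hD]

/-- The conjugate of `∑_i R_ik y_i`, as it acts on evolved states. -/
noncomputable def propY (t : ℝ) (a : L2 d) (x D : Fin d → L2 d) (k : Fin d) : L2 d :=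
  F.prop hM hb t (x k) + Complex.I • ∑ i, (starRingEnd ℂ) (F.N t k i) • F.prop hM hb t (x i - D i) +
    (starRingEnd ℂ) (F.ν t k) • F.prop hM hb t a

/-- Multiplication by `y_j` of an evolved state. -/
noncomputable def propX (t : ℝ) (a : L2 d) (x D : Fin d → L2 d) (j : Fin d) : L2 d :=
  ∑ k, (starRingEnd ℂ) (F.A t j k) • F.propY hM hb t a x D k

/-- The derivative `∂_j` of an evolved state. -/
noncomputable def propD (t : ℝ) (a : L2 d) (x D : Fin d → L2 d) (j : Fin d) : L2 d :=
  ∑ i, (starRingEnd ℂ) (F.P t j i) • F.propX hM hb t a x D i -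
    ∑ k, (starRingEnd ℂ) (F.R t j k) • (F.prop hM hb t (x k - D k) -
      (Complex.I * (starRingEnd ℂ) (F.β t k)) • F.prop hM hb t a)

variable {a : L2 d} {x D : Fin d → L2 d} (hx : ∀ i, IsMulCoord i a (x i))
  (hD : ∀ i, IsWeakPartial i a (D i))

include hx hD

/-- Solve `integral_paramRate_prop` for the part linear in `y`. The remaining part is affine in `z`,
and a factor `z_i` acts on pairings as the evolution of `x i - D i`. -/
theorem integral_propY (k : Fin d) (z : Fin d → ℂ) {t : ℝ} (ht : 0 ≤ t) :
    ∫ y, (starRingEnd ℂ) (F.state t z y) * ((starRingEnd ℂ) (((F.R t)ᵀ *ᵥ coordVec y) k) *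
      F.prop hM hb t a y) = inner ℂ (F.stateL2 t z) (F.propY hM hb t a x D k) := by
  have h1 := F.integral_paramRate_prop hM hb k z ht a
  have h0 : ∫ y, (starRingEnd ℂ) (F.paramRate 0 k z y * F.state 0 z y) * a y =
      inner ℂ (F.stateL2 t z) (F.prop hM hb t (x k)) := by
    rw [F.inner_prop hM hb z ht, stateL2, inner_toLp]
    refine integral_congr_ae ?_
    filter_upwards [hx k] with y hy
    rw [hy, paramRate, F.R_zero, F.N_zero, F.ν_zero]
    simp [coordVec]
    ring
  rw [h0] at h1
  set c : ℂ := (starRingEnd ℂ) (Complex.I * (F.N t *ᵥ z) k - F.ν t k) with hc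
  have i1 := integrable_star_mul_L2 (F.memLp_paramRate_mul_state t k z) (F.prop hM hb t a)
  have i2 := (integrable_star_mul_L2 (F.memLp_state t z) (F.prop hM hb t a)).const_mul c
  have h2 : ∫ y, (starRingEnd ℂ) (F.state t z y) * ((starRingEnd ℂ) (((F.R t)ᵀ *ᵥ coordVec y) k) *
      F.prop hM hb t a y) =
      (∫ y, (starRingEnd ℂ) (F.paramRate t k z y * F.state t z y) * F.prop hM hb t a y) -
      ∫ y, c * ((starRingEnd ℂ) (F.state t z y) * F.prop hM hb t a y) := by
    rw [← integral_sub i1 i2]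
    refine integral_congr_ae (ae_of_all _ fun y => ?_)
    simp only [hc, paramRate, map_mul, map_sub, map_add]
    ring
  have h3 : ∀ i, (starRingEnd ℂ) (z i) * inner ℂ (F.stateL2 t z) (F.prop hM hb t a) =
      inner ℂ (F.stateL2 t z) (F.prop hM hb t (x i - D i)) := fun i =>
    F.conj_mul_inner_stateL2 hM hb z i ht (hx i) (hD i)
  rw [h2, h1, integral_const_mul, ← inner_toLp (F.memLp_state t z), propY, inner_add_right,
    inner_add_right, inner_smul_right, inner_smul_right, inner_sum]
  simp only [inner_smul_right, ← h3]
  rw [hc]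
  simp only [Matrix.mulVec, dotProduct, map_sub, map_mul, map_sum, Complex.conj_I, ← mul_assoc,
    ← Finset.sum_mul]
  change _ - _ * inner ℂ (F.stateL2 t z) _ = _
  ring

/-- Since `A Rᵀ = 1` and `y` is real, `y_j` is the combination with coefficients `conj A_jk` of the
conjugated forms handled by `integral_propY`. Agreement of all pairings with evolved Gaussians gives
equality almost everywhere. -/
theorem isMulCoord_propX (j : Fin d) {t : ℝ} (ht : 0 ≤ t) :
    IsMulCoord j (F.prop hM hb t a) (F.propX hM hb t a x D j) := by
  set u := F.prop hM hb t a
  have hI : ∀ z, Integrable (fun y => (starRingEnd ℂ) (F.state t z y) * (((y j : ℝ) : ℂ) * u y))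
      volume := fun z => by
    have h := F.memLp_mul_state t z (contDiff_coord (d := d) (n := 0) j).continuous (B := 1)
      (fun y => by rw [one_mul]; exact (abs_coord_le y j).trans (le_one_add_sq _))
    refine (integrable_star_mul_L2 h u).congr (ae_of_all _ fun y => ?_)
    simp only [map_mul, Complex.conj_ofReal]
    ring
  have hI2 := fun z => integrable_star_mul_L2 (F.memLp_state t z) (F.propX hM hb t a x D j)
  have hcoord : ∀ y : Rd d, ((y j : ℝ) : ℂ) = ∑ k, (starRingEnd ℂ) (F.A t j k) *
      (starRingEnd ℂ) (((F.R t)ᵀ *ᵥ coordVec y) k) := fun y => by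
    have h := congrArg (starRingEnd ℂ) (congrFun (Matrix.one_mulVec (coordVec y)) j)
    rw [← F.A_mul_R t, ← Matrix.mulVec_mulVec] at h
    conv_rhs at h => simp only [coordVec, Complex.conj_ofReal]
    rw [← h, Matrix.mulVec, dotProduct, map_sum]
    simp only [map_mul]
  have hI3 : ∀ z k, Integrable (fun y => (starRingEnd ℂ) (F.state t z y) *
      ((starRingEnd ℂ) (((F.R t)ᵀ *ᵥ coordVec y) k) * u y)) volume := fun z k => by
    set c : ℂ := (starRingEnd ℂ) (Complex.I * (F.N t *ᵥ z) k - F.ν t k) with hc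
    have i1 := integrable_star_mul_L2 (F.memLp_paramRate_mul_state t k z) u
    have i2 := (integrable_star_mul_L2 (F.memLp_state t z) u).const_mul c
    refine (i1.sub i2).congr (ae_of_all _ fun y => ?_)
    simp only [hc, Pi.sub_apply, paramRate, map_mul, map_sub, map_add]
    ring
  have h0 := F.ae_eq_zero_of_integral_state t
    (H := fun y => F.propX hM hb t a x D j y - ((y j : ℝ) : ℂ) * u y)
    (fun z => ((hI2 z).sub (hI z)).congr (ae_of_all _ fun y => (mul_sub _ _ _).symm)) fun z => by
      simp only [mul_sub]
      rw [integral_sub (hI2 z) (hI z), ← inner_toLp (F.memLp_state t z), sub_eq_zero, propX,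
        inner_sum]
      simp only [inner_smul_right]
      have e : ∀ y, (starRingEnd ℂ) (F.state t z y) * (((y j : ℝ) : ℂ) * u y) =
          ∑ k, (starRingEnd ℂ) (F.A t j k) * ((starRingEnd ℂ) (F.state t z y) *
            ((starRingEnd ℂ) (((F.R t)ᵀ *ᵥ coordVec y) k) * u y)) := fun y => by
        rw [hcoord, Finset.sum_mul, Finset.mul_sum]
        exact Finset.sum_congr rfl fun k _ => by ring
      simp only [e]
      rw [integral_finsetSum _ fun k _ => (hI3 z k).const_mul _]
      refine Finset.sum_congr rfl fun k _ => ?_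
      rw [integral_const_mul, F.integral_propY hM hb hx hD k z ht]
      rfl
  filter_upwards [h0] with y hy
  exact sub_eq_zero.1 hy

/-- The derivative of an evolved Gaussian multiplies it by `ζ_j - (P y)_j`. Here `y_i` acts through
`propX`, and `ζ_j` is affine in `z`, whose components act as the evolutions of `x i - D i`. -/
theorem isWeakPartial_propD (j : Fin d) {t : ℝ} (ht : 0 ≤ t) :
    IsWeakPartial j (F.prop hM hb t a) (F.propD hM hb t a x D j) := by
  intro φ hφ
  refine F.integral_mul_partialDeriv_of_state t j _ _ (fun z => ?_) hφ
  set u := F.prop hM hb t a with hu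
  have hX := fun i => F.isMulCoord_propX hM hb hx hD i ht
  have i1 := (integrable_star_mul_L2 (F.memLp_state t z) u).const_mul
    ((starRingEnd ℂ) (F.zeta t z j))
  have i2 := fun i => (integrable_star_mul_L2 (F.memLp_state t z)
    (F.propX hM hb t a x D i)).const_mul ((starRingEnd ℂ) (F.P t j i))
  have e1 : ∫ y, (starRingEnd ℂ) (partialDeriv j (F.state t z) y) * u y =
      (∫ y, (starRingEnd ℂ) (F.zeta t z j) * ((starRingEnd ℂ) (F.state t z y) * u y)) -
      ∫ y, ∑ i, (starRingEnd ℂ) (F.P t j i) *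
        ((starRingEnd ℂ) (F.state t z y) * F.propX hM hb t a x D i y) := by
    rw [← integral_sub i1 (integrable_finsetSum _ fun i _ => i2 i)]
    refine integral_congr_ae ?_
    filter_upwards [ae_all_iff.2 hX] with y hy
    rw [state, partialDeriv_gauss (F.P_symm t), gaussGrad, linForm]
    simp only [hy, map_mul, map_sub, map_sum, Complex.conj_ofReal, sub_mul, Finset.sum_mul]
    refine congrArg₂ _ (by ring) (Finset.sum_congr rfl fun i _ => ?_)
    ring
  have h3 : ∀ i, (starRingEnd ℂ) (z i) * inner ℂ (F.stateL2 t z) u =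
      inner ℂ (F.stateL2 t z) (F.prop hM hb t (x i - D i)) := fun i =>
    F.conj_mul_inner_stateL2 hM hb z i ht (hx i) (hD i)
  rw [e1, integral_const_mul, integral_finsetSum _ fun i _ => i2 i]
  simp only [integral_const_mul, ← inner_toLp (F.memLp_state t z)]
  change _ * inner ℂ (F.stateL2 t z) u - ∑ i, _ * inner ℂ (F.stateL2 t z) _ =
    - inner ℂ (F.stateL2 t z) _
  rw [propD, inner_sub_right, inner_sum, inner_sum, neg_sub]
  simp only [inner_smul_right, inner_sub_right _ _ (_ • _), ← hu, ← h3]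
  refine congrArg₂ _ ?_ rfl
  rw [zeta, Matrix.mulVec, dotProduct, map_sum, Finset.sum_mul]
  refine Finset.sum_congr rfl fun i _ => ?_
  simp only [map_mul, Pi.add_apply, Pi.smul_apply, smul_eq_mul, map_add, Complex.conj_I]
  ring

-- By isometry all inner products of evolved vectors reduce to those at time zero, so only the flow
-- matrices depend on time.
omit hx hD in
theorem inner_prop_propX (t : ℝ) (j : Fin d) :
    inner ℂ (F.prop hM hb t a) (F.propX hM hb t a x D j) = (starRingEnd ℂ)
      ((F.A t *ᵥ (fun k => inner ℂ (x k) a) -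
        Complex.I • ((F.A t * F.N t) *ᵥ fun k => inner ℂ (x k - D k) a) +
        ((‖a‖ ^ 2 : ℝ) : ℂ) • (F.A t *ᵥ F.ν t)) j) := by
  have h1 : inner ℂ a a = ((‖a‖ ^ 2 : ℝ) : ℂ) := by
    rw [inner_self_eq_norm_sq_to_K]; simp
  rw [← Matrix.mulVec_mulVec, ← Matrix.mulVec_smul, ← Matrix.mulVec_sub, ← Matrix.mulVec_smul,
    ← Matrix.mulVec_smul, ← Matrix.mulVec_add, Matrix.mulVec, dotProduct, propX, inner_sum, map_sum]
  refine Finset.sum_congr rfl fun k _ => ?_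
  rw [inner_smul_right, propY, inner_add_right, inner_add_right, inner_smul_right,
    inner_smul_right, inner_sum]
  simp only [inner_smul_right, LinearIsometry.inner_map_map, h1]
  simp only [Pi.add_apply, Pi.sub_apply,
    Pi.smul_apply, smul_eq_mul, map_mul, map_add, map_sub, map_sum, Complex.conj_I,
    Complex.conj_ofReal, Matrix.mulVec, dotProduct, inner_conj_symm, neg_mul,
    mul_left_comm _ Complex.I, ← Finset.mul_sum]
  ring

omit hx hD in
/-- The centre of mass of an evolved state follows the classical trajectory. -/
theorem exists_moment_trajectory : ∃ g p : ℝ → Fin d → ℝ,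
    (∀ t, HasDerivAt g (p t) t) ∧
    (∀ t, HasDerivAt p (-(M t *ᵥ g t) + ‖a‖ ^ 2 • b t) t) ∧
    (g 0 = fun j => (inner ℂ (x j) a).re) ∧
    (p 0 = fun j => (Complex.I * inner ℂ (D j) a).re) ∧
    ∀ t j, g t j = (inner ℂ (F.prop hM hb t a) (F.propX hM hb t a x D j)).re := by
  set X₀ : Fin d → ℂ := fun k => inner ℂ (x k) a with hX₀
  set H₀ : Fin d → ℂ := fun k => inner ℂ (x k - D k) a with hH₀
  set m : ℂ := ((‖a‖ ^ 2 : ℝ) : ℂ) with hm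
  -- `A` and `A N` solve the homogeneous Newton equation and `A ν` the one with force `b`, so `v'' =
  -- -M v + m b`. Real parts satisfy the same equation because `M`, `b` and `m` are real.
  set v : ℝ → Fin d → ℂ := fun t => F.A t *ᵥ X₀ - Complex.I • ((F.A t * F.N t) *ᵥ H₀) +
    m • (F.A t *ᵥ F.ν t) with hv
  set w : ℝ → Fin d → ℂ := fun t => F.B t *ᵥ X₀ - Complex.I • (F.Z t *ᵥ H₀) + m • F.w t with hw
  have hmv : ∀ {Q : ℝ → Matrix (Fin d) (Fin d) ℂ} {Q' : Matrix (Fin d) (Fin d) ℂ} {t : ℝ},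
      HasDerivAt Q Q' t → ∀ u, HasDerivAt (fun t => Q t *ᵥ u) (Q' *ᵥ u) t := fun hQ u =>
    (hQ.matrix_mulVec (hasDerivAt_const _ u)).congr_deriv (by simp)
  have hv' : ∀ t, HasDerivAt v (w t) t := fun t =>
    ((hmv (F.A_deriv t) X₀).sub ((hmv (F.AN_deriv t) H₀).const_smul Complex.I)).add
      ((F.Aν_deriv t).const_smul m)
  have hw' : ∀ t, HasDerivAt w (-(complexify (M t) *ᵥ v t) + m • fun k => (b t k : ℂ)) t :=
    fun t => (((hmv (F.B_deriv t) X₀).sub ((hmv (F.Z_deriv t) H₀).const_smul Complex.I)).add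
      ((F.w_deriv t).const_smul m)).congr_deriv (by
        simp only [hv, Matrix.neg_mulVec, Matrix.mulVec_add, Matrix.mulVec_sub, Matrix.mulVec_smul,
          ← Matrix.mulVec_mulVec, smul_add, smul_neg]
        abel)
  have hre : ∀ {u : ℝ → Fin d → ℂ} {u' : Fin d → ℂ} {t : ℝ}, HasDerivAt u u' t →
      HasDerivAt (fun t j => (u t j).re) (fun j => (u' j).re) t := fun hu =>
    hasDerivAt_pi.2 fun j =>
      (Complex.reCLM.hasFDerivAt.comp_hasDerivAt _ (hasDerivAt_pi.1 hu j) :)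
  refine ⟨fun t j => (v t j).re, fun t j => (w t j).re, fun t => hre (hv' t), fun t => ?_, ?_, ?_,
    fun t j => ?_⟩
  · refine (hre (hw' t)).congr_deriv (funext fun j => ?_)
    simp only [Pi.add_apply, Pi.neg_apply, Pi.smul_apply, Matrix.mulVec, dotProduct, complexify,
      Matrix.map_apply, Complex.add_re, Complex.neg_re, Complex.re_sum, Complex.re_ofReal_mul,
      smul_eq_mul, hm, Complex.ofReal_re]
  · simp [hv, F.A_zero, F.N_zero, F.ν_zero, hX₀]
  -- The initial velocity is `i X₀ - i H₀`, where the position moments cancel and `i⟨D, a⟩` remains.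
  · funext j
    simp [hw, F.B_zero, F.Z_zero, F.w_zero, hX₀, hH₀, inner_sub_left, Matrix.smul_mulVec]
    ring
  · rw [F.inner_prop_propX, Complex.conj_re]

end MetaplecticFlow

end Conjugation

/-! ### Calculus of iterated partial derivatives -/

section MultiDeriv

variable {d : ℕ}

theorem partialDeriv_partialDeriv_eq {φ : Rd d → ℂ} (h : ContDiff ℝ ∞ φ) (i j : Fin d) (x : Rd d) :
    partialDeriv i (partialDeriv j φ) x =
      fderiv ℝ (fderiv ℝ φ) x (EuclideanSpace.single i 1) (EuclideanSpace.single j 1) := by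
  have hd : DifferentiableAt ℝ (fderiv ℝ φ) x :=
    (h.fderiv_right (m := ∞) (by simp)).differentiable (by simp) x
  change fderiv ℝ (fun y => fderiv ℝ φ y (EuclideanSpace.single j 1)) x _ = _
  rw [fderiv_clm_apply hd (differentiableAt_const _)]
  simp

theorem partialDeriv_comm {φ : Rd d → ℂ} (h : ContDiff ℝ ∞ φ) (i j : Fin d) :
    partialDeriv i (partialDeriv j φ) = partialDeriv j (partialDeriv i φ) := by
  funext x
  rw [partialDeriv_partialDeriv_eq h, partialDeriv_partialDeriv_eq h]
  exact ((contDiff_infty.1 h 2).contDiffAt.isSymmSndFDerivAt (by simp)) _ _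

theorem contDiff_iterate_partialDeriv {φ : Rd d → ℂ} (h : ContDiff ℝ ∞ φ) (i : Fin d) (n : ℕ) :
    ContDiff ℝ ∞ ((partialDeriv i)^[n] φ) := by
  induction n with
  | zero => exact h
  | succ n ih =>
    rw [Function.iterate_succ_apply']
    exact contDiff_partialDeriv i ih (by simp)

theorem iterate_partialDeriv_comm {φ : Rd d → ℂ} (h : ContDiff ℝ ∞ φ) (i j : Fin d) (n : ℕ) :
    (partialDeriv i)^[n] (partialDeriv j φ) = partialDeriv j ((partialDeriv i)^[n] φ) := by
  induction n with
  | zero => rfl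
  | succ n ih =>
    rw [Function.iterate_succ_apply', Function.iterate_succ_apply', ih,
      partialDeriv_comm (contDiff_iterate_partialDeriv h i n)]

theorem contDiff_foldr_partialDeriv {φ : Rd d → ℂ} (h : ContDiff ℝ ∞ φ) (β : Fin d → ℕ)
    (l : List (Fin d)) : ContDiff ℝ ∞ (l.foldr (fun i ψ => (partialDeriv i)^[β i] ψ) φ) := by
  induction l with
  | nil => exact h
  | cons i l ih => exact contDiff_iterate_partialDeriv ih i _

/-- Induction on the list: the extra derivative appears where `j` is met and commutes past the later
operators. The absence of duplicates ensures that it appears only once. -/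
theorem foldr_partialDeriv_add_single {φ : Rd d → ℂ} (h : ContDiff ℝ ∞ φ) (β : Fin d → ℕ)
    (j : Fin d) (l : List (Fin d)) (hl : l.Nodup) :
    (j ∉ l → l.foldr (fun i ψ => (partialDeriv i)^[(β + Pi.single j 1 : Fin d → ℕ) i] ψ) φ =
      l.foldr (fun i ψ => (partialDeriv i)^[β i] ψ) φ) ∧
    (j ∈ l → l.foldr (fun i ψ => (partialDeriv i)^[(β + Pi.single j 1 : Fin d → ℕ) i] ψ) φ =
      partialDeriv j (l.foldr (fun i ψ => (partialDeriv i)^[β i] ψ) φ)) := by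
  induction l with
  | nil => simp
  | cons i l ih =>
    obtain ⟨hi, hl⟩ := List.nodup_cons.1 hl
    obtain ⟨ih1, ih2⟩ := ih hl
    have hne : i ≠ j → (β + Pi.single j 1 : Fin d → ℕ) i = β i := fun hij => by simp [hij]
    refine ⟨fun hj => ?_, fun hj => ?_⟩
    · rw [List.mem_cons, not_or] at hj
      rw [List.foldr_cons, List.foldr_cons, ih1 hj.2, hne (Ne.symm hj.1)]
    · by_cases hij : i = j
      · subst hij
        rw [List.foldr_cons, List.foldr_cons, ih1 hi, Pi.add_apply, Pi.single_eq_same,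
          Function.iterate_succ_apply']
      · have hjl : j ∈ l := (List.mem_cons.1 hj).resolve_left (Ne.symm hij)
        rw [List.foldr_cons, List.foldr_cons, ih2 hjl, hne hij,
          iterate_partialDeriv_comm (contDiff_foldr_partialDeriv h β l)]

theorem contDiff_multiDeriv {φ : Rd d → ℂ} (h : ContDiff ℝ ∞ φ) (β : Fin d → ℕ) :
    ContDiff ℝ ∞ (multiDeriv β φ) :=
  contDiff_foldr_partialDeriv h β _

theorem multiDeriv_add_single {φ : Rd d → ℂ} (h : ContDiff ℝ ∞ φ) (β : Fin d → ℕ) (j : Fin d) :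
    multiDeriv (β + Pi.single j 1) φ = partialDeriv j (multiDeriv β φ) :=
  (foldr_partialDeriv_add_single h β j _ (List.nodup_finRange d)).2 (List.mem_finRange j)

theorem multiDeriv_zero (φ : Rd d → ℂ) : multiDeriv 0 φ = φ := by
  have : ∀ l : List (Fin d),
      l.foldr (fun i ψ => (partialDeriv i)^[(0 : Fin d → ℕ) i] ψ) φ = φ := fun l => by
    induction l with
    | nil => rfl
    | cons i l ih => rw [List.foldr_cons, ih]; rfl
  exact this _

theorem multiIndex_induction {p : (Fin d → ℕ) → Prop} (h0 : p 0)
    (h1 : ∀ β i, p β → p (β + Pi.single i 1)) (β : Fin d → ℕ) : p β := by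
  induction h : ∑ i, β i generalizing β with
  | zero =>
    have : β = 0 := funext fun i => by
      simpa using (Finset.sum_eq_zero_iff.1 h) i (Finset.mem_univ i)
    rwa [this]
  | succ n ih =>
    obtain ⟨i, -, hi⟩ := Finset.exists_ne_zero_of_sum_ne_zero (h ▸ Nat.succ_ne_zero n :
      ∑ i, β i ≠ 0)
    have hle : Pi.single i 1 ≤ β := fun j => by
      by_cases hij : j = i
      · subst hij; simpa using Nat.one_le_iff_ne_zero.2 hi
      · simp [hij]
    have e : β = β - Pi.single i 1 + Pi.single i 1 := (tsub_add_cancel_of_le hle).symm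
    rw [e]
    refine h1 _ _ (ih _ ?_)
    have h2 := congrArg (fun γ : Fin d → ℕ => ∑ j, γ j) e
    simp only [Pi.add_apply, Finset.sum_add_distrib, Finset.sum_pi_single', h] at h2
    simp at h2
    simpa using h2.symm

theorem IsTest.multiDeriv {φ : Rd d → ℂ} (h : IsTest φ) (β : Fin d → ℕ) :
    IsTest (multiDeriv β φ) := by
  induction β using multiIndex_induction with
  | h0 => rwa [multiDeriv_zero]
  | h1 β i ih =>
    rw [multiDeriv_add_single h.1]
    exact ih.partialDeriv i

/-- Leibniz' rule, in which a coordinate can be differentiated only once. The truncated subtraction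
is harmless: when `β j = 0` its coefficient vanishes. -/
theorem multiDeriv_coord_mul {φ : Rd d → ℂ} (h : ContDiff ℝ ∞ φ) (j : Fin d) (β : Fin d → ℕ) :
    multiDeriv β (fun y => ((y j : ℝ) : ℂ) * φ y) = fun y =>
      ((y j : ℝ) : ℂ) * multiDeriv β φ y + β j * multiDeriv (β - Pi.single j 1) φ y := by
  have hx : ContDiff ℝ ∞ fun y : Rd d => ((y j : ℝ) : ℂ) := contDiff_coord j
  induction β using multiIndex_induction with
  | h0 => simp [multiDeriv_zero]
  | h1 β i ih =>
    have dif : ∀ {ψ : Rd d → ℂ}, ContDiff ℝ ∞ ψ → ∀ y, DifferentiableAt ℝ ψ y := fun hψ y =>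
      hψ.differentiable (by simp) y
    have s1 := contDiff_multiDeriv h β
    have s2 := contDiff_multiDeriv h (β - Pi.single j 1)
    rw [multiDeriv_add_single (hx.mul h), ih]
    funext y
    rw [partialDeriv_add i (dif (hx.mul s1) y) (dif (contDiff_const.mul s2) y),
      partialDeriv_mul i (dif hx y) (dif s1 y), partialDeriv_const_mul i _ (dif s2 y),
      partialDeriv_coord, ← multiDeriv_add_single h, ← multiDeriv_add_single h]
    by_cases hij : i = j
    · subst hij
      have e1 : β + Pi.single i 1 - Pi.single i 1 = β := add_tsub_cancel_right _ _
      rw [e1]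
      by_cases h0 : β i = 0
      · simp [h0]
        ring
      · have e2 : β - Pi.single i 1 + Pi.single i 1 = β := tsub_add_cancel_of_le fun k => by
          by_cases hk : k = i
          · subst hk; simpa using Nat.one_le_iff_ne_zero.2 h0
          · simp [hk]
        rw [e2]
        simp
        ring
    · have e1 : β - Pi.single j 1 + Pi.single i 1 = β + Pi.single i 1 - Pi.single j 1 := by
        funext k
        by_cases hk : k = j
        · subst hk; simp [Ne.symm hij]
        · simp [hk]
      rw [e1]
      simp [Ne.symm hij]

end MultiDeriv

/-! ### The spaces `Σ^k` and their recursive structure -/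

section Sigma

variable {d : ℕ}

/-- The monomial `x^α`, with complex values. -/
noncomputable def monom (α : Fin d → ℕ) (x : Rd d) : ℂ := ((∏ i, x i ^ α i : ℝ) : ℂ)

theorem continuous_monom (α : Fin d → ℕ) : Continuous (monom α : Rd d → ℂ) := by
  have := fun i => (EuclideanSpace.proj (𝕜 := ℝ) (ι := Fin d) i).continuous
  refine Complex.continuous_ofReal.comp (continuous_finsetProd _ fun i _ => ?_)
  exact (this i).pow _

theorem monom_zero (x : Rd d) : monom 0 x = 1 := by simp [monom]

theorem monom_add_single (α : Fin d → ℕ) (j : Fin d) (x : Rd d) :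
    monom (α + Pi.single j 1) x = monom α x * ((x j : ℝ) : ℂ) := by
  simp only [monom, Pi.add_apply, pow_add, Finset.prod_mul_distrib]
  push_cast
  congr 1
  rw [Finset.prod_eq_single j]
  · simp
  · intro i _ hi; simp [hi]
  · simp

theorem weightedNorm_eq (α β : Fin d → ℕ) (f : Rd d → ℂ) : weightedNorm α β f =
    ⨅ (g : Rd d → ℂ) (_ : IsWeakDeriv β f g), eLpNorm (fun x => monom α x * g x) 2 volume := rfl

theorem weightedNorm_le {α β : Fin d → ℕ} {f g : Rd d → ℂ} (h : IsWeakDeriv β f g) :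
    weightedNorm α β f ≤ eLpNorm (fun x => monom α x * g x) 2 volume :=
  iInf₂_le g h

theorem exists_of_weightedNorm_lt {α β : Fin d → ℕ} {f : Rd d → ℂ} {r : ℝ≥0∞}
    (h : weightedNorm α β f < r) :
    ∃ g, IsWeakDeriv β f g ∧ eLpNorm (fun x => monom α x * g x) 2 volume < r := by
  simp only [weightedNorm_eq, iInf_lt_iff] at h
  obtain ⟨g, hg, h⟩ := h
  exact ⟨g, hg, h⟩

theorem locallyIntegrable_L2 (f : L2 d) : LocallyIntegrable f volume :=
  (Lp.memLp f).locallyIntegrable (by norm_num)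

theorem integrable_mul_test {g φ : Rd d → ℂ} (hg : LocallyIntegrable g volume) (hφ : IsTest φ) :
    Integrable (fun y => g y * φ y) volume := by
  have := hg.integrable_smul_left_of_hasCompactSupport hφ.continuous hφ.2
  exact this.congr (ae_of_all _ fun y => by simp [mul_comm])

theorem aestronglyMeasurable_monom_mul (α : Fin d → ℕ) {g : Rd d → ℂ}
    (hg : LocallyIntegrable g volume) :
    AEStronglyMeasurable (fun x => monom α x * g x) volume :=
  (continuous_monom α).aestronglyMeasurable.mul hg.aestronglyMeasurable

theorem weightedNorm_add_le (α β : Fin d → ℕ) (f f' : L2 d) :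
    weightedNorm α β (f + f' : L2 d) ≤ weightedNorm α β f + weightedNorm α β f' := by
  refine ENNReal.le_of_forall_pos_le_add fun ε hε hfin => ?_
  obtain ⟨hf, hf'⟩ := ENNReal.add_lt_top.1 hfin
  -- Near-minimisers in the two infima suffice, up to `ε / 2` each; their sum is a competitor for
  -- the sum.
  have hε' : (ε / 2 : ℝ≥0∞) ≠ 0 := by simp [hε.ne']
  obtain ⟨g, hg, h1⟩ := exists_of_weightedNorm_lt (ENNReal.lt_add_right hf.ne hε')
  obtain ⟨g', hg', h2⟩ := exists_of_weightedNorm_lt (ENNReal.lt_add_right hf'.ne hε')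
  have hw : IsWeakDeriv β (f + f' : L2 d) (g + g') := by
    refine ⟨hg.1.add hg'.1, fun φ hφ => ?_⟩
    have hm := hφ.multiDeriv β
    have e1 : ∫ x, (f + f' : L2 d) x * multiDeriv β φ x =
        (∫ x, f x * multiDeriv β φ x) + ∫ x, f' x * multiDeriv β φ x := by
      rw [← integral_add (integrable_L2_mul hm.memLp f) (integrable_L2_mul hm.memLp f')]
      refine integral_congr_ae ?_
      filter_upwards [Lp.coeFn_add f f'] with y hy
      rw [hy, Pi.add_apply, add_mul]
    have e2 : ∫ x, (g + g') x * φ x = (∫ x, g x * φ x) + ∫ x, g' x * φ x := by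
      rw [← integral_add (integrable_mul_test hg.1 hφ) (integrable_mul_test hg'.1 hφ)]
      simp only [Pi.add_apply, add_mul]
    rw [e1, e2, hg.2 φ hφ, hg'.2 φ hφ, mul_add]
  calc weightedNorm α β (f + f' : L2 d)
      ≤ eLpNorm (fun x => monom α x * (g + g') x) 2 volume := weightedNorm_le hw
    _ = eLpNorm ((fun x => monom α x * g x) + fun x => monom α x * g' x) 2 volume := by
        congr 1; funext x; simp [mul_add]
    _ ≤ _ := eLpNorm_add_le (aestronglyMeasurable_monom_mul α hg.1)
        (aestronglyMeasurable_monom_mul α hg'.1) (by norm_num)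
    _ ≤ (weightedNorm α β f + ε / 2) + (weightedNorm α β f' + ε / 2) := by gcongr
    _ = weightedNorm α β f + weightedNorm α β f' + ε := by
        rw [add_add_add_comm, ENNReal.add_halves]

theorem weightedNorm_smul_le (α β : Fin d → ℕ) (c : ℂ) (f : L2 d) :
    weightedNorm α β (c • f : L2 d) ≤ ‖c‖ₑ * weightedNorm α β f := by
  have key : ∀ g, IsWeakDeriv β f g → IsWeakDeriv β (c • f : L2 d) (fun x => c * g x) :=
    fun g hg => by
      refine ⟨hg.1.smul c, fun φ hφ => ?_⟩
      have e1 : ∫ x, (c • f : L2 d) x * multiDeriv β φ x = c * ∫ x, f x * multiDeriv β φ x := by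
        rw [← integral_const_mul]
        refine integral_congr_ae ?_
        filter_upwards [Lp.coeFn_smul c f] with y hy
        rw [hy, Pi.smul_apply, smul_eq_mul, mul_assoc]
      simp only [mul_assoc]
      rw [e1, hg.2 φ hφ, integral_const_mul]
      ring
  -- Scaling an infimum in `[0, ∞]` is done with a nonzero finite factor; for `c = 0` the zero
  -- function is a weak derivative and gives the bound at once.
  by_cases hc : c = 0
  · have h0 : IsWeakDeriv β (c • f : L2 d) (fun _ => 0) := by
      refine ⟨(continuous_const (y := (0 : ℂ))).locallyIntegrable, fun φ hφ => ?_⟩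
      have : ((c • f : L2 d) : Rd d → ℂ) =ᵐ[volume] 0 := by
        rw [hc, zero_smul]; exact Lp.coeFn_zero _ _ _
      rw [integral_congr_ae (g := fun _ => 0)]
      · simp
      · filter_upwards [this] with y hy
        simp [hy]
    refine (weightedNorm_le h0).trans ?_
    simp
  · rw [weightedNorm_eq α β f, ENNReal.mul_iInf_of_ne (by simpa using hc) (by simp)]
    refine le_iInf fun g => ?_
    rw [ENNReal.mul_iInf_of_ne (by simpa using hc) (by simp)]
    refine le_iInf fun hg => (weightedNorm_le (key g hg)).trans_eq ?_
    rw [← eLpNorm_const_smul]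
    congr 1
    funext x
    simp only [Pi.smul_apply, smul_eq_mul]
    ring

theorem sigmaNorm_add_le (k : ℕ) (f g : L2 d) :
    sigmaNorm k (f + g) ≤ sigmaNorm k f + sigmaNorm k g := by
  rw [sigmaNorm, sigmaNorm, sigmaNorm, ← Finset.sum_add_distrib]
  exact Finset.sum_le_sum fun p _ => weightedNorm_add_le _ _ _ _

theorem sigmaNorm_smul_le (k : ℕ) (c : ℂ) (f : L2 d) :
    sigmaNorm k (c • f) ≤ ‖c‖ₑ * sigmaNorm k f := by
  rw [sigmaNorm, sigmaNorm, Finset.mul_sum]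
  exact Finset.sum_le_sum fun p _ => weightedNorm_smul_le _ _ _ _

theorem isWeakDeriv_zero_self (f : L2 d) : IsWeakDeriv 0 f f :=
  ⟨locallyIntegrable_L2 f, fun φ _ => by simp [multiDeriv_zero]⟩

theorem IsWeakDeriv.ae_eq {f : L2 d} {g : Rd d → ℂ} (h : IsWeakDeriv 0 f g) :
    g =ᵐ[volume] f := by
  have h0 := ae_eq_zero_of_integral_mul_test (h.1.sub (locallyIntegrable_L2 f)) fun φ hφ => by
    have := h.2 φ hφ
    simp only [multiDeriv_zero, Pi.zero_apply, Finset.sum_const_zero, pow_zero, one_mul] at this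
    simp only [Pi.sub_apply, sub_mul]
    rw [integral_sub (integrable_mul_test h.1 hφ) (integrable_L2_mul hφ.memLp f), this, sub_self]
  filter_upwards [h0] with y hy
  exact sub_eq_zero.1 hy

theorem weightedNorm_zero_right (α : Fin d → ℕ) (f : L2 d) :
    weightedNorm α 0 f = eLpNorm (fun x => monom α x * f x) 2 volume := by
  refine le_antisymm (weightedNorm_le (isWeakDeriv_zero_self f)) (le_iInf₂ fun g hg => ?_)
  refine (eLpNorm_congr_ae ?_).le
  filter_upwards [hg.ae_eq] with y hy
  rw [← hy]
  rfl

theorem weightedNorm_zero_zero (f : L2 d) : weightedNorm 0 0 f = ‖f‖ₑ := by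
  rw [weightedNorm_zero_right, Lp.enorm_def]
  simp [monom_zero]

theorem weightedNorm_add_single_zero (α : Fin d → ℕ) {j : Fin d} {f x : L2 d}
    (h : IsMulCoord j f x) : weightedNorm (α + Pi.single j 1) 0 f = weightedNorm α 0 x := by
  rw [weightedNorm_zero_right, weightedNorm_zero_right]
  refine eLpNorm_congr_ae ?_
  filter_upwards [h] with y hy
  rw [monom_add_single, hy, mul_assoc]

theorem isWeakDeriv_add_single_iff (β : Fin d → ℕ) {j : Fin d} {f D : L2 d} {g : Rd d → ℂ}
    (h : IsWeakPartial j f D) : IsWeakDeriv (β + Pi.single j 1) f g ↔ IsWeakDeriv β D g := by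
  have key : ∀ φ : Rd d → ℂ, IsTest φ → ∫ x, f x * multiDeriv (β + Pi.single j 1) φ x =
      - ∫ x, D x * multiDeriv β φ x := fun φ hφ => by
    rw [multiDeriv_add_single hφ.1]
    exact h _ (hφ.multiDeriv β)
  have hs : (-1 : ℂ) ^ (∑ i, (β + Pi.single j 1 : Fin d → ℕ) i) = - (-1) ^ (∑ i, β i) := by
    simp only [Pi.add_apply, Finset.sum_add_distrib, pow_add]
    simp
  refine and_congr_right fun _ => forall₂_congr fun φ hφ => ?_
  rw [key φ hφ, hs, neg_mul, neg_inj]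

theorem weightedNorm_add_single (α β : Fin d → ℕ) {j : Fin d} {f D : L2 d}
    (h : IsWeakPartial j f D) : weightedNorm α (β + Pi.single j 1) f = weightedNorm α β D := by
  simp only [weightedNorm_eq, isWeakDeriv_add_single_iff β h]

theorem mem_indexPairs {k : ℕ} {p : (Fin d → ℕ) × (Fin d → ℕ)} :
    p ∈ indexPairs d k ↔ ∑ i, p.1 i + ∑ i, p.2 i ≤ k := by
  simp only [indexPairs, Finset.mem_filter, Finset.mem_product, Fintype.mem_piFinset,
    Finset.mem_range, Nat.lt_succ_iff, and_iff_right_iff_imp]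
  intro h
  constructor <;> intro i
  · have := Finset.single_le_sum (f := p.1) (fun i _ => Nat.zero_le _) (Finset.mem_univ i)
    omega
  · have := Finset.single_le_sum (f := p.2) (fun i _ => Nat.zero_le _) (Finset.mem_univ i)
    omega

theorem weightedNorm_le_sigmaNorm {k : ℕ} {α β : Fin d → ℕ} (h : ∑ i, α i + ∑ i, β i ≤ k)
    (f : L2 d) : weightedNorm α β f ≤ sigmaNorm k f := by
  have hm : (α, β) ∈ indexPairs d k := mem_indexPairs.2 h
  rw [sigmaNorm, ← Finset.add_sum_erase _ _ hm]
  exact le_self_add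

theorem enorm_le_sigmaNorm (k : ℕ) (f : L2 d) : ‖f‖ₑ ≤ sigmaNorm k f := by
  rw [← weightedNorm_zero_zero]
  exact weightedNorm_le_sigmaNorm (by simp) f

theorem sum_add_single (β : Fin d → ℕ) (j : Fin d) :
    ∑ i, (β + Pi.single j 1 : Fin d → ℕ) i = ∑ i, β i + 1 := by
  simp [Finset.sum_add_distrib]

theorem exists_eq_add_single {β : Fin d → ℕ} (h : β ≠ 0) : ∃ (γ : Fin d → ℕ) (j : Fin d), β = γ + Pi.single j 1 := by
  induction β using multiIndex_induction with
  | h0 => exact absurd rfl h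
  | h1 γ j _ => exact ⟨γ, j, rfl⟩

theorem sigmaNorm_index_zero (f : L2 d) : sigmaNorm 0 f = ‖f‖ₑ := by
  have h : indexPairs d 0 = {0} := by
    ext ⟨α, β⟩
    rw [mem_indexPairs, Finset.mem_singleton, Prod.ext_iff]
    simp [funext_iff]
  rw [sigmaNorm, h, Finset.sum_singleton]
  exact weightedNorm_zero_zero f

/-- The induction step in `k`: from `x^α ∂^β f` the innermost operator is peeled off, a derivative
if `β ≠ 0` and a coordinate otherwise. No commutators arise. -/
theorem sigmaNorm_succ_le (k : ℕ) {f : L2 d} {x D : Fin d → L2 d} (hx : ∀ j, IsMulCoord j f (x j))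
    (hD : ∀ j, IsWeakPartial j f (D j)) : sigmaNorm (k + 1) f ≤ (indexPairs d (k + 1)).card *
      (‖f‖ₑ + (∑ j, sigmaNorm k (x j) + ∑ j, sigmaNorm k (D j))) := by
  rw [← nsmul_eq_mul]
  refine Finset.sum_le_card_nsmul _ _ _ fun p hp => ?_
  obtain ⟨α, β⟩ := p
  have hp := mem_indexPairs.1 hp
  simp only at hp ⊢
  by_cases hβ : β = 0
  · subst hβ
    by_cases hα : α = 0
    · subst hα
      rw [weightedNorm_zero_zero]
      exact le_self_add
    · obtain ⟨γ, j, rfl⟩ := exists_eq_add_single hα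
      rw [sum_add_single] at hp
      rw [weightedNorm_add_single_zero γ (hx j)]
      have h1 := weightedNorm_le_sigmaNorm (k := k) (α := γ) (β := 0) (by omega) (x j)
      have h2 := Finset.single_le_sum (f := fun j => sigmaNorm k (x j)) (fun _ _ => zero_le)
        (Finset.mem_univ j)
      exact h1.trans (h2.trans (le_self_add.trans le_add_self))
  · obtain ⟨γ, j, rfl⟩ := exists_eq_add_single hβ
    rw [sum_add_single] at hp
    rw [weightedNorm_add_single α γ (hD j)]
    have h1 := weightedNorm_le_sigmaNorm (k := k) (α := α) (β := γ) (by omega) (D j)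
    have h2 := Finset.single_le_sum (f := fun j => sigmaNorm k (D j)) (fun _ _ => zero_le)
      (Finset.mem_univ j)
    exact h1.trans (h2.trans (le_add_self.trans le_add_self))

theorem MemSigma.exists_isMulCoord {k : ℕ} {f : L2 d} (h : MemSigma (k + 1) f) (j : Fin d) :
    ∃ x : L2 d, IsMulCoord j f x ∧ ‖x‖ₑ ≤ sigmaNorm (k + 1) f := by
  have h1 := weightedNorm_le_sigmaNorm (k := k + 1) (α := 0 + Pi.single j 1) (β := 0)
    (by rw [sum_add_single]; simp) f
  rw [weightedNorm_zero_right] at h1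
  have h2 : MemLp (fun x => monom (0 + Pi.single j 1) x * f x) 2 volume :=
    ⟨aestronglyMeasurable_monom_mul _ (locallyIntegrable_L2 f), h1.trans_lt h⟩
  refine ⟨h2.toLp _, ?_, ?_⟩
  · filter_upwards [h2.coeFn_toLp] with y hy
    rw [hy, monom_add_single, monom_zero, one_mul]
  · rwa [Lp.enorm_toLp]

theorem MemSigma.exists_isWeakPartial {k : ℕ} {f : L2 d} (h : MemSigma (k + 1) f) (j : Fin d) :
    ∃ D : L2 d, IsWeakPartial j f D := by
  have h1 := weightedNorm_le_sigmaNorm (k := k + 1) (α := 0) (β := 0 + Pi.single j 1)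
    (by rw [sum_add_single]; simp) f
  obtain ⟨g, hg, h2⟩ := exists_of_weightedNorm_lt (h1.trans_lt h)
  simp only [monom_zero, one_mul] at h2
  have hm : MemLp g 2 volume := ⟨hg.1.aestronglyMeasurable, h2⟩
  refine ⟨hm.toLp g, fun φ hφ => ?_⟩
  have h3 := hg.2 φ hφ
  rw [multiDeriv_add_single hφ.1, multiDeriv_zero, sum_add_single] at h3
  rw [h3]
  simp only [Pi.zero_apply, Finset.sum_const_zero, zero_add, pow_one, neg_mul, one_mul]
  congr 1
  refine integral_congr_ae ?_
  filter_upwards [hm.coeFn_toLp] with y hy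
  rw [hy]

theorem MemSigma.of_isWeakPartial {k : ℕ} {f D : L2 d} (h : MemSigma (k + 1) f) {j : Fin d}
    (hD : IsWeakPartial j f D) : MemSigma k D := by
  refine ENNReal.sum_lt_top.2 fun p hp => ?_
  rw [← weightedNorm_add_single _ _ hD]
  refine (weightedNorm_le_sigmaNorm (k := k + 1) ?_ f).trans_lt h
  have := mem_indexPairs.1 hp
  rw [sum_add_single]
  omega

theorem IsWeakDeriv.coord_mul {β : Fin d → ℕ} {j : Fin d} {f x : L2 d} (hx : IsMulCoord j f x)
    {u v : Rd d → ℂ} (hu : IsWeakDeriv β f u) (hv : IsWeakDeriv (β - Pi.single j 1) f v) :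
    IsWeakDeriv β x (fun y => ((y j : ℝ) : ℂ) * u y + β j * v y) := by
  have hc : Continuous fun y : Rd d => ((y j : ℝ) : ℂ) := (contDiff_coord (n := 0) j).continuous
  -- Lowering the order by one flips the sign from integration by parts; if `β j = 0`, the order is
  -- not lowered but both sides vanish.
  have hsign : (-1 : ℂ) ^ (∑ i, (β - Pi.single j 1 : Fin d → ℕ) i) * β j =
      - ((-1) ^ (∑ i, β i) * β j) := by
    by_cases h0 : β j = 0
    · simp [h0]
    · have e : β - Pi.single j 1 + Pi.single j 1 = β := tsub_add_cancel_of_le fun k => by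
        by_cases hk : k = j
        · subst hk; simpa using Nat.one_le_iff_ne_zero.2 h0
        · simp [hk]
      have h2 := sum_add_single (β - Pi.single j 1) j
      rw [e] at h2
      rw [h2, pow_succ]
      ring
  have hu' : LocallyIntegrable (fun y => ((y j : ℝ) : ℂ) * u y) volume := by
    rw [← locallyIntegrableOn_univ]
    exact (locallyIntegrableOn_univ.2 hu.1).continuousOn_mul hc.continuousOn
      isOpen_univ.isLocallyClosed
  refine ⟨hu'.add (hv.1.smul (β j : ℂ)), fun φ hφ => ?_⟩
  have m1 := (hφ.coord_mul j).multiDeriv β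
  have m2 := hφ.multiDeriv (β - Pi.single j 1)
  have e1 : ∫ y, x y * multiDeriv β φ y =
      (∫ y, f y * multiDeriv β (fun y => ((y j : ℝ) : ℂ) * φ y) y) -
        ∫ y, β j * (f y * multiDeriv (β - Pi.single j 1) φ y) := by
    rw [← integral_sub (integrable_L2_mul m1.memLp f) ((integrable_L2_mul m2.memLp f).const_mul _)]
    refine integral_congr_ae ?_
    filter_upwards [hx] with y hy
    rw [hy, multiDeriv_coord_mul hφ.1]
    ring
  have e2 : ∫ y, (((y j : ℝ) : ℂ) * u y + β j * v y) * φ y =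
      (∫ y, u y * (((y j : ℝ) : ℂ) * φ y)) + β j * ∫ y, v y * φ y := by
    rw [← integral_const_mul, ← integral_add (integrable_mul_test hu.1 (hφ.coord_mul j))
      ((integrable_mul_test hv.1 hφ).const_mul _)]
    refine integral_congr_ae (ae_of_all _ fun y => ?_)
    simp only
    ring
  rw [e1, e2, integral_const_mul, hu.2 _ (hφ.coord_mul j), hv.2 _ hφ]
  linear_combination (-(∫ y, v y * φ y)) * hsign

/-- Here `x_j` must be commuted past `∂^β`: the two terms of `IsWeakDeriv.coord_mul` have index
pairs `(α + e_j, β)` and `(α, β - e_j)`, both of total order at most `k + 1`. -/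
theorem MemSigma.of_isMulCoord {k : ℕ} {f x : L2 d} (h : MemSigma (k + 1) f) {j : Fin d}
    (hx : IsMulCoord j f x) : MemSigma k x := by
  refine ENNReal.sum_lt_top.2 fun p hp => ?_
  obtain ⟨α, β⟩ := p
  have hp := mem_indexPairs.1 hp
  simp only at hp ⊢
  obtain ⟨u, hu, h1⟩ := exists_of_weightedNorm_lt
    ((weightedNorm_le_sigmaNorm (k := k + 1) (α := α + Pi.single j 1) (β := β)
      (by rw [sum_add_single]; omega) f).trans_lt h)
  have hle : ∑ i, (β - Pi.single j 1 : Fin d → ℕ) i ≤ ∑ i, β i :=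
    Finset.sum_le_sum fun i _ => Nat.sub_le _ _
  obtain ⟨v, hv, h2⟩ := exists_of_weightedNorm_lt
    ((weightedNorm_le_sigmaNorm (k := k + 1) (α := α) (β := β - Pi.single j 1)
      (by omega) f).trans_lt h)
  refine (weightedNorm_le (hu.coord_mul hx hv)).trans_lt ?_
  have e : (fun y : Rd d => monom α y * (((y j : ℝ) : ℂ) * u y + β j * v y)) =
      (fun y => monom (α + Pi.single j 1) y * u y) + (β j : ℂ) • fun y => monom α y * v y := by
    funext y
    simp only [Pi.add_apply, Pi.smul_apply, smul_eq_mul, monom_add_single]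
    ring
  rw [e]
  exact (MemLp.add ⟨aestronglyMeasurable_monom_mul _ hu.1, h1⟩
    (MemLp.const_smul ⟨aestronglyMeasurable_monom_mul _ hv.1, h2⟩ _)).2

end Sigma

/-! ### Continuity in `Σ^k` and persistence under the propagator -/

section SigmaContinuity

variable {d : ℕ}

theorem MemSigma.add {k : ℕ} {f g : L2 d} (hf : MemSigma k f) (hg : MemSigma k g) :
    MemSigma k (f + g) :=
  (sigmaNorm_add_le k f g).trans_lt (ENNReal.add_lt_top.2 ⟨hf, hg⟩)

theorem MemSigma.smul {k : ℕ} {f : L2 d} (hf : MemSigma k f) (c : ℂ) : MemSigma k (c • f) :=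
  (sigmaNorm_smul_le k c f).trans_lt (ENNReal.mul_lt_top enorm_lt_top hf)

theorem MemSigma.sub {k : ℕ} {f g : L2 d} (hf : MemSigma k f) (hg : MemSigma k g) :
    MemSigma k (f - g) := by
  have := hf.add (hg.smul (-1))
  rwa [neg_one_smul, ← sub_eq_add_neg] at this

theorem sigmaNorm_zero (k : ℕ) : sigmaNorm k (0 : L2 d) = 0 := by
  have := sigmaNorm_smul_le k 0 (0 : L2 d)
  simpa using this

theorem sigmaNorm_mono {k l : ℕ} (h : k ≤ l) (f : L2 d) : sigmaNorm k f ≤ sigmaNorm l f :=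
  Finset.sum_le_sum_of_subset fun _ hp => mem_indexPairs.2 ((mem_indexPairs.1 hp).trans h)

theorem MemSigma.mono {k l : ℕ} {f : L2 d} (h : MemSigma l f) (hkl : k ≤ l) : MemSigma k f :=
  (sigmaNorm_mono hkl f).trans_lt h

theorem IsMulCoord.sub {j : Fin d} {f g x x' : L2 d} (h : IsMulCoord j f x)
    (h' : IsMulCoord j g x') : IsMulCoord j (f - g) (x - x') := by
  filter_upwards [h, h', Lp.coeFn_sub f g, Lp.coeFn_sub x x'] with y h1 h2 h3 h4
  rw [h3, h4, Pi.sub_apply, Pi.sub_apply, h1, h2, mul_sub]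

theorem IsWeakPartial.sub {j : Fin d} {f g x x' : L2 d} (h : IsWeakPartial j f x)
    (h' : IsWeakPartial j g x') : IsWeakPartial j (f - g) (x - x') := by
  intro φ hφ
  have e : ∀ {ψ : Rd d → ℂ} (u v : L2 d), IsTest ψ →
      ∫ y, (u - v : L2 d) y * ψ y = (∫ y, u y * ψ y) - ∫ y, v y * ψ y := fun u v hψ => by
    rw [← integral_sub (integrable_L2_mul hψ.memLp u) (integrable_L2_mul hψ.memLp v)]
    refine integral_congr_ae ?_
    filter_upwards [Lp.coeFn_sub u v] with y hy
    rw [hy, Pi.sub_apply, sub_mul]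
  rw [e _ _ (hφ.partialDeriv j), e _ _ hφ, h φ hφ, h' φ hφ]
  ring

theorem IsMulCoord.enorm_le {j : Fin d} {f x : L2 d} (h : IsMulCoord j f x) (k : ℕ) :
    ‖x‖ₑ ≤ sigmaNorm (k + 1) f := by
  rw [← weightedNorm_zero_zero, ← weightedNorm_add_single_zero 0 h]
  exact weightedNorm_le_sigmaNorm (by rw [sum_add_single]; simp) f

namespace ContinuousInSigma

variable {k : ℕ} {u v : ℝ → L2 d}

theorem add (hu : ContinuousInSigma k u) (hv : ContinuousInSigma k v) :
    ContinuousInSigma k fun t => u t + v t := by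
  refine ⟨fun t ht => (hu.1 t ht).add (hv.1 t ht), fun t ht => ?_⟩
  have h := (hu.2 t ht).add (hv.2 t ht)
  rw [add_zero] at h
  refine tendsto_of_tendsto_of_tendsto_of_le_of_le tendsto_const_nhds h (fun _ => zero_le)
    fun s => ?_
  have e : u s + v s - (u t + v t) = (u s - u t) + (v s - v t) := by abel
  simp only [e]
  exact sigmaNorm_add_le _ _ _

theorem smul {c : ℝ → ℂ} (hu : ContinuousInSigma k u) (hc : ContinuousOn c (Ici 0)) :
    ContinuousInSigma k fun t => c t • u t := by
  refine ⟨fun t ht => (hu.1 t ht).smul _, fun t ht => ?_⟩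
  have h1 : Tendsto (fun s => ‖c s‖ₑ) (𝓝[Ici 0] t) (𝓝 ‖c t‖ₑ) := (hc t ht).enorm
  have h2 : Tendsto (fun s => ‖c s - c t‖ₑ) (𝓝[Ici 0] t) (𝓝 0) := by
    have : Tendsto (fun s => c s - c t) (𝓝[Ici 0] t) (𝓝 (c t - c t)) := (hc t ht).sub_const _
    simpa using this.enorm
  have h3 := (ENNReal.Tendsto.mul h1 (Or.inr ENNReal.zero_ne_top) (hu.2 t ht)
    (Or.inr enorm_ne_top)).add (ENNReal.Tendsto.mul_const h2 (Or.inr (hu.1 t ht).ne))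
  rw [mul_zero, zero_mul, add_zero] at h3
  refine tendsto_of_tendsto_of_tendsto_of_le_of_le tendsto_const_nhds h3 (fun _ => zero_le)
    fun s => ?_
  have e : c s • u s - c t • u t = c s • (u s - u t) + (c s - c t) • u t := by module
  simp only [e]
  exact (sigmaNorm_add_le _ _ _).trans
    (add_le_add (sigmaNorm_smul_le _ _ _) (sigmaNorm_smul_le _ _ _))

theorem sub (hu : ContinuousInSigma k u) (hv : ContinuousInSigma k v) :
    ContinuousInSigma k fun t => u t - v t := by
  have := hu.add (hv.smul (c := fun _ => -1) continuousOn_const)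
  simpa only [neg_one_smul, ← sub_eq_add_neg] using this

theorem sum {ι : Type*} (s : Finset ι) {u : ι → ℝ → L2 d}
    (hu : ∀ i ∈ s, ContinuousInSigma k (u i)) : ContinuousInSigma k fun t => ∑ i ∈ s, u i t := by
  classical
  induction s using Finset.induction_on with
  | empty =>
    simp only [Finset.sum_empty]
    refine ⟨fun t _ => ?_, fun t _ => ?_⟩
    · rw [MemSigma, sigmaNorm_zero]; exact ENNReal.zero_lt_top
    · simp only [sub_self, sigmaNorm_zero]; exact tendsto_const_nhds
  | insert i s hi ih =>
    simp only [Finset.sum_insert hi]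
    exact (hu i (Finset.mem_insert_self i s)).add
      (ih fun j hj => hu j (Finset.mem_insert_of_mem hj))

theorem continuousOn_of_enorm_le {x : ℝ → L2 d} (hu : ContinuousInSigma k u)
    (h : ∀ s t, 0 ≤ s → 0 ≤ t → ‖x s - x t‖ₑ ≤ sigmaNorm k (u s - u t)) :
    ContinuousOn x (Ici 0) := by
  intro t ht
  rw [ContinuousWithinAt, tendsto_iff_edist_tendsto_0]
  refine tendsto_of_tendsto_of_tendsto_of_le_of_le' tendsto_const_nhds (hu.2 t ht)
    (Eventually.of_forall fun _ => zero_le) ?_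
  filter_upwards [self_mem_nhdsWithin] with s hs
  rw [edist_eq_enorm_sub]
  exact h s t hs ht

theorem continuousOn (hu : ContinuousInSigma k u) : ContinuousOn u (Ici 0) :=
  hu.continuousOn_of_enorm_le fun _ _ _ _ => enorm_le_sigmaNorm k _

theorem exists_isMulCoord (hu : ContinuousInSigma (k + 1) u) : ∃ x : ℝ → Fin d → L2 d,
    (∀ t, 0 ≤ t → ∀ j, IsMulCoord j (u t) (x t j)) ∧
      ∀ j, ContinuousOn (fun t => x t j) (Ici 0) := by
  have h : ∀ t j, ∃ x : L2 d, 0 ≤ t → IsMulCoord j (u t) x := fun t j => by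
    by_cases ht : 0 ≤ t
    · obtain ⟨x, hx, -⟩ := (hu.1 t ht).exists_isMulCoord j
      exact ⟨x, fun _ => hx⟩
    · exact ⟨0, fun h => absurd h ht⟩
  choose x hx using h
  exact ⟨x, fun t ht j => hx t j ht, fun j => hu.continuousOn_of_enorm_le fun s t hs ht =>
    ((hx s j hs).sub (hx t j ht)).enorm_le k⟩

end ContinuousInSigma

namespace MetaplecticFlow

variable {M : ℝ → Matrix (Fin d) (Fin d) ℝ} {b : ℝ → Fin d → ℝ} (F : MetaplecticFlow M b)
  (hM : Continuous M) (hb : Continuous b)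

theorem continuousInSigma_propY {k : ℕ} {a : L2 d} {x D : Fin d → L2 d}
    (h : ∀ f, MemSigma k f → ContinuousInSigma k fun t => F.prop hM hb t f)
    (ha : MemSigma k a) (hx : ∀ i, MemSigma k (x i)) (hD : ∀ i, MemSigma k (D i)) (j : Fin d) :
    ContinuousInSigma k fun t => F.propY hM hb t a x D j := by
  have hN : ∀ i, Continuous fun t => (starRingEnd ℂ) (F.N t j i) := fun i =>
    Complex.continuous_conj.comp (F.continuous_N.matrix_elem j i)
  have hν : Continuous fun t => (starRingEnd ℂ) (F.ν t j) :=
    Complex.continuous_conj.comp ((continuous_apply j).comp F.continuous_ν)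
  exact ((h _ (hx j)).add ((ContinuousInSigma.sum _ fun i _ =>
    (h _ ((hx i).sub (hD i))).smul (hN i).continuousOn).smul continuousOn_const)).add
      ((h _ ha).smul hν.continuousOn)

theorem continuousInSigma_propX {k : ℕ} {a : L2 d} {x D : Fin d → L2 d}
    (h : ∀ f, MemSigma k f → ContinuousInSigma k fun t => F.prop hM hb t f)
    (ha : MemSigma k a) (hx : ∀ i, MemSigma k (x i)) (hD : ∀ i, MemSigma k (D i)) (j : Fin d) :
    ContinuousInSigma k fun t => F.propX hM hb t a x D j := by
  have hA : ∀ i, Continuous fun t => (starRingEnd ℂ) (F.A t j i) := fun i =>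
    Complex.continuous_conj.comp (F.continuous_A.matrix_elem j i)
  exact ContinuousInSigma.sum _ fun i _ =>
    (F.continuousInSigma_propY hM hb h ha hx hD i).smul (hA i).continuousOn

theorem continuousInSigma_propD {k : ℕ} {a : L2 d} {x D : Fin d → L2 d}
    (h : ∀ f, MemSigma k f → ContinuousInSigma k fun t => F.prop hM hb t f)
    (ha : MemSigma k a) (hx : ∀ i, MemSigma k (x i)) (hD : ∀ i, MemSigma k (D i)) (j : Fin d) :
    ContinuousInSigma k fun t => F.propD hM hb t a x D j := by
  have hP : ∀ i, Continuous fun t => (starRingEnd ℂ) (F.P t j i) := fun i =>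
    Complex.continuous_conj.comp (F.continuous_P.matrix_elem j i)
  have hR : ∀ i, Continuous fun t => (starRingEnd ℂ) (F.R t j i) := fun i =>
    Complex.continuous_conj.comp (F.continuous_R.matrix_elem j i)
  have hβ : ∀ i, Continuous fun t => Complex.I * (starRingEnd ℂ) (F.β t i) := fun i =>
    continuous_const.mul (Complex.continuous_conj.comp ((continuous_apply i).comp F.continuous_β))
  exact (ContinuousInSigma.sum _ fun i _ =>
    (F.continuousInSigma_propX hM hb h ha hx hD i).smul (hP i).continuousOn).sub
      (ContinuousInSigma.sum _ fun i _ => ((h _ ((hx i).sub (hD i))).sub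
        ((h _ ha).smul (hβ i).continuousOn)).smul (hR i).continuousOn)

/-- The propagator preserves `Σ^k`, continuously in time. -/
theorem continuousInSigma_prop (k : ℕ) (a : L2 d) (ha : MemSigma k a) :
    ContinuousInSigma k fun t => F.prop hM hb t a := by
  induction k generalizing a with
  | zero =>
    simp only [ContinuousInSigma, MemSigma, sigmaNorm_index_zero]
    refine ⟨fun t _ => enorm_lt_top, fun t _ => ?_⟩
    have := ((F.continuous_prop hM hb a).sub
      (continuous_const (y := F.prop hM hb t a))).enorm.continuousWithinAt (s := Ici 0) (x := t)
    simpa [ContinuousWithinAt] using this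
  | succ k ih =>
    choose x hx _ using fun j => ha.exists_isMulCoord j
    choose D hD using fun j => ha.exists_isWeakPartial j
    -- The coordinates and derivatives of the evolved state are combinations, with continuous
    -- coefficients, of evolutions of `a`, `x i` and `D i`. These data lie in `Σ^k`, so the
    -- induction hypothesis applies to them.
    have hX := fun j => F.continuousInSigma_propX hM hb ih (ha.mono k.le_succ)
      (fun i => ha.of_isMulCoord (hx i)) (fun i => ha.of_isWeakPartial (hD i)) j
    have hD' := fun j => F.continuousInSigma_propD hM hb ih (ha.mono k.le_succ)
      (fun i => ha.of_isMulCoord (hx i)) (fun i => ha.of_isWeakPartial (hD i)) j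
    have mX := fun (t : ℝ) (ht : 0 ≤ t) j => F.isMulCoord_propX hM hb hx hD j ht
    have mD := fun (t : ℝ) (ht : 0 ≤ t) j => F.isWeakPartial_propD hM hb hx hD j ht
    refine ⟨fun t ht => ?_, fun t ht => ?_⟩
    · refine (sigmaNorm_succ_le k (mX t ht) (mD t ht)).trans_lt
        (ENNReal.mul_lt_top (ENNReal.natCast_lt_top _) ?_)
      exact ENNReal.add_lt_top.2 ⟨enorm_lt_top, ENNReal.add_lt_top.2
        ⟨ENNReal.sum_lt_top.2 fun j _ => (hX j).1 t ht,
          ENNReal.sum_lt_top.2 fun j _ => (hD' j).1 t ht⟩⟩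
    · have h0 := (ih a (ha.mono k.le_succ)).2 t ht
      have h1 := tendsto_finsetSum Finset.univ fun j _ => (hX j).2 t ht
      have h2 := tendsto_finsetSum Finset.univ fun j _ => (hD' j).2 t ht
      have h3 := ENNReal.Tendsto.const_mul (a := ((indexPairs d (k + 1)).card : ℝ≥0∞))
        (h0.add (h1.add h2)) (Or.inr (ENNReal.natCast_ne_top _))
      simp only [Finset.sum_const_zero, add_zero, mul_zero] at h3
      refine tendsto_of_tendsto_of_tendsto_of_le_of_le' tendsto_const_nhds h3
        (Eventually.of_forall fun _ => zero_le) ?_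
      filter_upwards [self_mem_nhdsWithin] with s hs
      refine (sigmaNorm_succ_le k (fun j => (mX s hs j).sub (mX t ht j))
        fun j => (mD s hs j).sub (mD t ht j)).trans ?_
      gcongr
      exact enorm_le_sigmaNorm k _

end MetaplecticFlow

end SigmaContinuity

/-! ### Moments, the potential in coordinates and gauge transformations -/

section Moments

open scoped Matrix

variable {d : ℕ}

theorem integral_eq_re_inner {u v : L2 d} {r : Rd d → ℝ}
    (h : ∀ᵐ z, (starRingEnd ℂ) (u z) * v z = (r z : ℂ)) :
    Integrable r volume ∧ ∫ z, r z = (inner ℂ u v).re := by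
  have h1 : (fun z => inner ℂ (u z) (v z)) =ᵐ[volume] fun z => (r z : ℂ) := by
    filter_upwards [h] with z hz
    rw [← hz, RCLike.inner_apply, mul_comm]
  have h2 := (L2.integrable_inner (𝕜 := ℂ) u v).congr h1
  refine ⟨by simpa using h2.re, ?_⟩
  rw [L2.inner_def, integral_congr_ae h1, integral_complex_ofReal, Complex.ofReal_re]

theorem conj_mul_self_eq (c : ℂ) : (starRingEnd ℂ) c * c = ((‖c‖ ^ 2 : ℝ) : ℂ) := by
  rw [mul_comm, Complex.mul_conj, Complex.normSq_eq_norm_sq]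

theorem IsMulCoord.firstMoment {j : Fin d} {f x : L2 d} (h : IsMulCoord j f x) :
    Integrable (fun z => ‖f z‖ ^ 2 * z j) volume ∧
      ∫ z, ‖f z‖ ^ 2 * z j = (inner ℂ f x).re := by
  refine integral_eq_re_inner ?_
  filter_upwards [h] with z hz
  rw [hz, Complex.ofReal_mul, ← conj_mul_self_eq]
  ring

theorem IsMulCoord.secondMoment {i j : Fin d} {f x x' : L2 d} (h : IsMulCoord i f x)
    (h' : IsMulCoord j f x') : Integrable (fun z => z i * z j * ‖f z‖ ^ 2) volume ∧
      ∫ z, z i * z j * ‖f z‖ ^ 2 = (inner ℂ x x').re := by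
  refine integral_eq_re_inner ?_
  filter_upwards [h, h'] with z hz hz'
  rw [hz, hz', Complex.ofReal_mul, ← conj_mul_self_eq, map_mul, Complex.conj_ofReal]
  push_cast
  ring

theorem sum_smul_single (z : Rd d) : ∑ j, z j • EuclideanSpace.single j (1 : ℝ) = z := by
  simpa using (EuclideanSpace.basisFun (Fin d) ℝ).sum_repr z

/-- Expressing moments as inner products gives access to their continuity in time and to
`inner_prop_propX`. -/
theorem firstMoment_apply {f : L2 d} {x : Fin d → L2 d} (h : ∀ j, IsMulCoord j f (x j))
    (j : Fin d) : firstMoment f j = (inner ℂ f (x j)).re := by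
  have e : ∀ z : Rd d, (‖f z‖ ^ 2) • z =
      ∑ j, (‖f z‖ ^ 2 * z j) • EuclideanSpace.single j (1 : ℝ) := fun z => by
    simp only [← smul_smul, ← Finset.smul_sum, sum_smul_single]
  have e2 : firstMoment f = ∑ j, (inner ℂ f (x j)).re • EuclideanSpace.single j (1 : ℝ) := by
    rw [firstMoment]
    simp only [e]
    rw [integral_finsetSum _ fun j _ => (h j).firstMoment.1.smul_const _]
    simp only [integral_smul_const, (h _).firstMoment.2]
  have e3 := sum_smul_single (WithLp.toLp 2 fun j => (inner ℂ f (x j)).re : Rd d)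
  simp only at e3
  rw [e2, e3]

/-- The moment `∫ ⟨z, H z⟩ |f(z)|² dz` for a matrix `H`. -/
noncomputable def matrixMoment (H : Matrix (Fin d) (Fin d) ℝ) (f : L2 d) : ℝ :=
  ∫ z, (∑ i, ∑ j, H i j * z i * z j) * ‖f z‖ ^ 2

theorem matrixMoment_eq (H : Matrix (Fin d) (Fin d) ℝ) {f : L2 d} {x : Fin d → L2 d}
    (h : ∀ j, IsMulCoord j f (x j)) :
    matrixMoment H f = ∑ i, ∑ j, H i j * (inner ℂ (x i) (x j)).re := by
  have e : ∀ z : Rd d, (∑ i, ∑ j, H i j * z i * z j) * ‖f z‖ ^ 2 =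
      ∑ i, ∑ j, H i j * (z i * z j * ‖f z‖ ^ 2) := fun z => by
    simp only [Finset.sum_mul, mul_assoc]
  have hi : ∀ i j, Integrable (fun z => H i j * (z i * z j * ‖f z‖ ^ 2)) volume := fun i j =>
    ((h i).secondMoment (h j)).1.const_mul _
  rw [matrixMoment]
  simp only [e]
  rw [integral_finsetSum _ fun i _ => integrable_finsetSum _ fun j _ => hi i j]
  refine Finset.sum_congr rfl fun i _ => ?_
  rw [integral_finsetSum _ fun j _ => hi i j]
  refine Finset.sum_congr rfl fun j _ => ?_
  rw [integral_const_mul, ((h i).secondMoment (h j)).2]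

theorem norm_smul_apply_ae {c : ℂ} (hc : ‖c‖ = 1) (f : L2 d) :
    ∀ᵐ z, ‖(c • f : L2 d) z‖ = ‖f z‖ := by
  filter_upwards [Lp.coeFn_smul c f] with z hz
  rw [hz, Pi.smul_apply, norm_smul, hc, one_mul]

theorem firstMoment_smul {c : ℂ} (hc : ‖c‖ = 1) (f : L2 d) :
    firstMoment (c • f) = firstMoment f := by
  refine integral_congr_ae ?_
  filter_upwards [norm_smul_apply_ae hc f] with z hz
  simp only [hz]

theorem matrixMoment_smul (H : Matrix (Fin d) (Fin d) ℝ) {c : ℂ} (hc : ‖c‖ = 1) (f : L2 d) :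
    matrixMoment H (c • f) = matrixMoment H f := by
  refine integral_congr_ae ?_
  filter_upwards [norm_smul_apply_ae hc f] with z hz
  simp only [hz]

theorem ContinuousInSigma.continuousOn_firstMoment {k : ℕ} {u : ℝ → L2 d}
    (hu : ContinuousInSigma (k + 1) u) :
    ContinuousOn (fun t => (firstMoment (u t)).ofLp) (Ici 0) := by
  obtain ⟨x, hx, hc⟩ := hu.exists_isMulCoord
  refine continuousOn_pi.2 fun j => ?_
  have h : ContinuousOn (fun t => (inner ℂ (u t) (x t j)).re) (Ici 0) :=
    Complex.continuous_re.comp_continuousOn (hu.continuousOn.inner (hc j))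
  exact h.congr fun t ht => firstMoment_apply (hx t ht) j

theorem ContinuousInSigma.continuousOn_matrixMoment {k : ℕ} {u : ℝ → L2 d}
    (hu : ContinuousInSigma (k + 1) u) {H : ℝ → Matrix (Fin d) (Fin d) ℝ} (hH : Continuous H) :
    ContinuousOn (fun t => matrixMoment (H t) (u t)) (Ici 0) := by
  obtain ⟨x, hx, hc⟩ := hu.exists_isMulCoord
  have h : ContinuousOn (fun t => ∑ i, ∑ j, H t i j * (inner ℂ (x t i) (x t j)).re) (Ici 0) :=
    continuousOn_finsetSum _ fun i _ => continuousOn_finsetSum _ fun j _ =>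
      (hH.matrix_elem i j).continuousOn.mul
        (Complex.continuous_re.comp_continuousOn ((hc i).inner (hc j)))
  exact h.congr fun t ht => matrixMoment_eq _ (hx t ht)

/-- The Hessian matrix. -/
noncomputable def hessMatrix (f : Rd d → ℝ) (x : Rd d) : Matrix (Fin d) (Fin d) ℝ :=
  Matrix.of fun i j => hess f x (EuclideanSpace.single i 1) (EuclideanSpace.single j 1)

theorem hess_eq (f : Rd d → ℝ) (x v w : Rd d) :
    hess f x v w = ∑ i, ∑ j, hessMatrix f x i j * v i * w j := by
  conv_lhs => rw [← sum_smul_single v, ← sum_smul_single w, hess]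
  simp only [map_sum, map_smul, sum_apply, smul_apply, smul_eq_mul, Finset.mul_sum, hessMatrix,
    Matrix.of_apply, hess]
  rw [Finset.sum_comm]
  refine Finset.sum_congr rfl fun i _ => Finset.sum_congr rfl fun j _ => ?_
  ring

theorem isSymm_hessMatrix {f : Rd d → ℝ} (h : ContDiff ℝ 3 f) (x : Rd d) :
    (hessMatrix f x).IsSymm := by
  ext i j
  exact (h.of_le (m := 2) (by norm_num)).contDiffAt.isSymmSndFDerivAt (by simp) _ _

theorem quadMoment_eq (K : Rd d → ℝ) (x : Rd d) (f : L2 d) :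
    quadMoment K x f = matrixMoment (hessMatrix K x) f := by
  simp only [quadMoment, matrixMoment, hess_eq]

theorem hess_eq_mulVec {f : Rd d → ℝ} (h : ContDiff ℝ 3 f) (x v w : Rd d) :
    hess f x v w = ∑ i, (hessMatrix f x *ᵥ v.ofLp) i * w i := by
  rw [hess_eq, Finset.sum_comm]
  refine Finset.sum_congr rfl fun j _ => ?_
  rw [Matrix.mulVec, dotProduct, Finset.sum_mul]
  refine Finset.sum_congr rfl fun i _ => ?_
  rw [(isSymm_hessMatrix h x).apply j i]

/-- The potential of the envelope equation, in coordinates. -/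
noncomputable def coupledPotential (M H Q : Matrix (Fin d) (Fin d) ℝ) (f f' : L2 d) (y : Rd d) : ℝ :=
  quadPotential (fun _ => M)
    (fun _ => H *ᵥ (firstMoment f).ofLp + Q *ᵥ (firstMoment f').ofLp) 0 y +
    (1 / 2 * matrixMoment H f + 1 / 2 * matrixMoment Q f')

/-- Sorts the potential by degree in `y`: the matrix, the linear term carried by first moments, and
the constant carried by second moments. Symmetry of the Hessian of `K` is used in the linear term.
-/
theorem envelopePotential_eq (V : ℝ → Rd d → ℝ) {K : Rd d → ℝ} (hK : ContDiff ℝ 3 K) (m m' t : ℝ)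
    (q q' : Rd d) (f f' : L2 d) (y : Rd d) :
    envelopePotential V K m m' t q q' f f' y =
      coupledPotential (m • hessMatrix K 0 + m' • hessMatrix K (q - q') + hessMatrix (V t) q)
        (hessMatrix K 0) (hessMatrix K (q - q')) f f' y := by
  rw [envelopePotential, coupledPotential, quadPotential, hess_eq_mulVec hK 0 (firstMoment f),
    hess_eq_mulVec hK _ (firstMoment f'), hess_eq, hess_eq, hess_eq, quadMoment_eq, quadMoment_eq]
  simp only [Matrix.add_apply, Matrix.smul_apply, smul_eq_mul, add_mul, Finset.sum_add_distrib,
    mul_assoc, ← Finset.mul_sum, Pi.add_apply]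
  ring

theorem IsWeakSchrodinger.congr {W W' : ℝ → Rd d → ℝ} {u u' : ℝ → L2 d}
    (h : IsWeakSchrodinger W u) (hW : ∀ t, 0 ≤ t → W' t = W t) (hu : ∀ t, 0 ≤ t → u' t = u t) :
    IsWeakSchrodinger W' u' := by
  intro φ hφ t ht
  rw [hW t ht, hu t ht]
  exact (h φ hφ t ht).congr (fun s hs => by rw [hu s hs]) (by rw [hu t ht])

/-- Gauge transformations change the potential by a function of time. -/
theorem IsWeakSchrodinger.gauge {M : ℝ → Matrix (Fin d) (Fin d) ℝ} {b : ℝ → Fin d → ℝ}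
    {c e θ : ℝ → ℝ} {u : ℝ → L2 d}
    (h : IsWeakSchrodinger (fun t y => quadPotential M b t y + c t) u)
    (hθ : ∀ t, HasDerivAt θ (e t) t) :
    IsWeakSchrodinger (fun t y => quadPotential M b t y + (c t - e t))
      fun t => Complex.exp (Complex.I * θ t) • u t := by
  intro φ hφ t ht
  have hint : ∀ (s : ℝ) (ψ : Rd d → ℂ), ∫ y, (Complex.exp (Complex.I * θ s) • u s : L2 d) y * ψ y =
      Complex.exp (Complex.I * θ s) * ∫ y, u s y * ψ y := fun s ψ => by
    rw [← integral_const_mul]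
    refine integral_congr_ae ?_
    filter_upwards [Lp.coeFn_smul (Complex.exp (Complex.I * θ s)) (u s)] with y hy
    rw [hy, Pi.smul_apply, smul_eq_mul, mul_assoc]
  have hexp : HasDerivAt (fun s => Complex.exp (Complex.I * θ s))
      (Complex.exp (Complex.I * θ t) * (Complex.I * e t)) t :=
    (((hθ t).ofReal_comp).const_mul Complex.I).cexp
  simp only [hint]
  refine (hexp.hasDerivWithinAt.mul (h φ hφ t ht)).congr_deriv ?_
  have i1 : Integrable (fun y => u t y * ((quadPotential M b t y : ℂ) * φ y -
      1 / 2 * Laplacian.laplacian φ y)) volume :=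
    integrable_L2_mul ((MetaplecticFlow.isTest_potential hφ t).memLp.sub (hφ.laplacian.memLp.const_mul (1 / 2)))
      (u t)
  have i2 := integrable_L2_mul hφ.memLp (u t)
  have hs : ∀ r : ℝ, ∫ y, u t y * (((quadPotential M b t y + r : ℝ) : ℂ) * φ y -
      1 / 2 * Laplacian.laplacian φ y) = (∫ y, u t y * ((quadPotential M b t y : ℂ) * φ y -
      1 / 2 * Laplacian.laplacian φ y)) + r * ∫ y, u t y * φ y := fun r => by
    rw [← integral_const_mul, ← integral_add i1 (i2.const_mul _)]
    refine integral_congr_ae (ae_of_all _ fun y => ?_)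
    simp only
    push_cast
    ring
  rw [hs, hs]
  push_cast
  ring

end Moments

/-! ### Coupled second-order linear systems -/

section CoupledTrajectories

open scoped Matrix

variable {d : ℕ}

/-- Multiplication by a matrix as a continuous linear map. -/
noncomputable def mulVecCLM (C : Matrix (Fin d) (Fin d) ℝ) : (Fin d → ℝ) →L[ℝ] (Fin d → ℝ) :=
  LinearMap.toContinuousLinearMap (Matrix.toLin' C)

theorem continuous_mulVecCLM : Continuous (mulVecCLM (d := d)) :=
  ((LinearMap.toContinuousLinearMap.toLinearMap ∘ₗ
    (Matrix.toLin' (R := ℝ) (m := Fin d) (n := Fin d)).toLinearMap)).continuous_of_finiteDimensional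

/-- Two second-order linear equations, coupled through their positions, on `[0, ∞)`. -/
structure IsCoupledTrajectory (C₁₁ C₁₂ C₂₁ C₂₂ : ℝ → Matrix (Fin d) (Fin d) ℝ)
    (g₁ p₁ g₂ p₂ : ℝ → Fin d → ℝ) : Prop where
  deriv_g₁ : ∀ t, 0 ≤ t → HasDerivWithinAt g₁ (p₁ t) (Ici 0) t
  deriv_p₁ : ∀ t, 0 ≤ t → HasDerivWithinAt p₁ (C₁₁ t *ᵥ g₁ t + C₁₂ t *ᵥ g₂ t) (Ici 0) t
  deriv_g₂ : ∀ t, 0 ≤ t → HasDerivWithinAt g₂ (p₂ t) (Ici 0) t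
  deriv_p₂ : ∀ t, 0 ≤ t → HasDerivWithinAt p₂ (C₂₁ t *ᵥ g₁ t + C₂₂ t *ᵥ g₂ t) (Ici 0) t

/-- The generator of a coupled trajectory on phase space. -/
noncomputable def coupledGenerator (C₁₁ C₁₂ C₂₁ C₂₂ : ℝ → Matrix (Fin d) (Fin d) ℝ) (t : ℝ) :
    (((Fin d → ℝ) × (Fin d → ℝ)) × ((Fin d → ℝ) × (Fin d → ℝ))) →L[ℝ]
      (((Fin d → ℝ) × (Fin d → ℝ)) × ((Fin d → ℝ) × (Fin d → ℝ))) :=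
  ((ContinuousLinearMap.snd ℝ _ _).comp (ContinuousLinearMap.fst ℝ _ _)).prod
    ((mulVecCLM (C₁₁ t)).comp ((ContinuousLinearMap.fst ℝ _ _).comp (ContinuousLinearMap.fst ℝ _ _)) +
      (mulVecCLM (C₁₂ t)).comp
        ((ContinuousLinearMap.fst ℝ _ _).comp (ContinuousLinearMap.snd ℝ _ _))) |>.prod
  (((ContinuousLinearMap.snd ℝ _ _).comp (ContinuousLinearMap.snd ℝ _ _)).prod
    ((mulVecCLM (C₂₁ t)).comp ((ContinuousLinearMap.fst ℝ _ _).comp (ContinuousLinearMap.fst ℝ _ _)) +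
      (mulVecCLM (C₂₂ t)).comp
        ((ContinuousLinearMap.fst ℝ _ _).comp (ContinuousLinearMap.snd ℝ _ _))))

variable {C₁₁ C₁₂ C₂₁ C₂₂ : ℝ → Matrix (Fin d) (Fin d) ℝ}

theorem continuous_coupledGenerator (h₁₁ : Continuous C₁₁) (h₁₂ : Continuous C₁₂)
    (h₂₁ : Continuous C₂₁) (h₂₂ : Continuous C₂₂) :
    Continuous (coupledGenerator C₁₁ C₁₂ C₂₁ C₂₂) := by
  have h : ∀ {C : ℝ → Matrix (Fin d) (Fin d) ℝ}, Continuous C →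
      Continuous fun t => mulVecCLM (C t) := fun hC => continuous_mulVecCLM.comp hC
  refine (ContinuousLinearMap.prodₗᵢ ℝ).continuous.comp (Continuous.prodMk
    ((ContinuousLinearMap.prodₗᵢ ℝ).continuous.comp (continuous_const.prodMk ?_))
    ((ContinuousLinearMap.prodₗᵢ ℝ).continuous.comp (continuous_const.prodMk ?_)))
  · exact ((h h₁₁).clm_comp continuous_const).add ((h h₁₂).clm_comp continuous_const)
  · exact ((h h₂₁).clm_comp continuous_const).add ((h h₂₂).clm_comp continuous_const)

theorem exists_isCoupledTrajectory (h₁₁ : Continuous C₁₁) (h₁₂ : Continuous C₁₂)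
    (h₂₁ : Continuous C₂₁) (h₂₂ : Continuous C₂₂) (x₁ y₁ x₂ y₂ : Fin d → ℝ) :
    ∃ g₁ p₁ g₂ p₂ : ℝ → Fin d → ℝ, IsCoupledTrajectory C₁₁ C₁₂ C₂₁ C₂₂ g₁ p₁ g₂ p₂ ∧
      Continuous g₁ ∧ Continuous g₂ ∧ g₁ 0 = x₁ ∧ p₁ 0 = y₁ ∧ g₂ 0 = x₂ ∧ p₂ 0 = y₂ := by
  obtain ⟨x, h0, hx⟩ := exists_linearODE_solution
    (continuous_coupledGenerator h₁₁ h₁₂ h₂₁ h₂₂) ((x₁, y₁), (x₂, y₂))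
  have hc : Continuous x := continuous_iff_continuousAt.2 fun t => (hx t).continuousAt
  have hℓ : ∀ t (ℓ : _ →L[ℝ] (Fin d → ℝ)), HasDerivWithinAt (fun t => ℓ (x t))
      (ℓ (coupledGenerator C₁₁ C₁₂ C₂₁ C₂₂ t (x t))) (Ici 0) t := fun t ℓ =>
    (ℓ.hasFDerivAt.comp_hasDerivAt t (hx t)).hasDerivWithinAt
  let π₁ := ContinuousLinearMap.fst ℝ ((Fin d → ℝ) × (Fin d → ℝ)) ((Fin d → ℝ) × (Fin d → ℝ))
  let π₂ := ContinuousLinearMap.snd ℝ ((Fin d → ℝ) × (Fin d → ℝ)) ((Fin d → ℝ) × (Fin d → ℝ))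
  refine ⟨fun t => (x t).1.1, fun t => (x t).1.2, fun t => (x t).2.1, fun t => (x t).2.2,
    ⟨fun t _ => hℓ t ((ContinuousLinearMap.fst ℝ _ _).comp π₁),
      fun t _ => hℓ t ((ContinuousLinearMap.snd ℝ _ _).comp π₁),
      fun t _ => hℓ t ((ContinuousLinearMap.fst ℝ _ _).comp π₂),
      fun t _ => hℓ t ((ContinuousLinearMap.snd ℝ _ _).comp π₂)⟩,
    hc.fst.fst, hc.snd.fst, ?_, ?_, ?_, ?_⟩ <;> simp only [h0]

theorem IsCoupledTrajectory.eq (h₁₁ : Continuous C₁₁) (h₁₂ : Continuous C₁₂)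
    (h₂₁ : Continuous C₂₁) (h₂₂ : Continuous C₂₂) {g₁ p₁ g₂ p₂ g₁' p₁' g₂' p₂' : ℝ → Fin d → ℝ}
    (h : IsCoupledTrajectory C₁₁ C₁₂ C₂₁ C₂₂ g₁ p₁ g₂ p₂)
    (h' : IsCoupledTrajectory C₁₁ C₁₂ C₂₁ C₂₂ g₁' p₁' g₂' p₂')
    (e₁ : g₁ 0 = g₁' 0) (e₂ : p₁ 0 = p₁' 0) (e₃ : g₂ 0 = g₂' 0) (e₄ : p₂ 0 = p₂' 0) {t : ℝ}
    (ht : 0 ≤ t) : g₁ t = g₁' t ∧ g₂ t = g₂' t := by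
  have := linearODE_unique_Ici (continuous_coupledGenerator h₁₁ h₁₂ h₂₁ h₂₂)
    (x := fun t => ((g₁ t, p₁ t), (g₂ t, p₂ t))) (y := fun t => ((g₁' t, p₁' t), (g₂' t, p₂' t)))
    (fun t ht => ((h.deriv_g₁ t ht).prodMk (h.deriv_p₁ t ht)).prodMk
      ((h.deriv_g₂ t ht).prodMk (h.deriv_p₂ t ht)))
    (fun t ht => ((h'.deriv_g₁ t ht).prodMk (h'.deriv_p₁ t ht)).prodMk
      ((h'.deriv_g₂ t ht).prodMk (h'.deriv_p₂ t ht))) (by simp only [e₁, e₂, e₃, e₄]) ht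
  simp only [Prod.mk.injEq] at this
  exact ⟨this.1.1, this.2.1⟩

/-- The difference of two solutions is homogeneous; padding it with a trivial second particle
reduces the claim to uniqueness for coupled trajectories. -/
theorem newton_unique {M : ℝ → Matrix (Fin d) (Fin d) ℝ} (hM : Continuous M)
    {f g p g' p' : ℝ → Fin d → ℝ}
    (hg : ∀ t, 0 ≤ t → HasDerivWithinAt g (p t) (Ici 0) t)
    (hp : ∀ t, 0 ≤ t → HasDerivWithinAt p (-(M t *ᵥ g t) + f t) (Ici 0) t)
    (hg' : ∀ t, 0 ≤ t → HasDerivWithinAt g' (p' t) (Ici 0) t)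
    (hp' : ∀ t, 0 ≤ t → HasDerivWithinAt p' (-(M t *ᵥ g' t) + f t) (Ici 0) t)
    (e₁ : g 0 = g' 0) (e₂ : p 0 = p' 0) {t : ℝ} (ht : 0 ≤ t) : g t = g' t := by
  have h1 : IsCoupledTrajectory (fun t => -M t) 0 0 0 (fun t => g t - g' t) (fun t => p t - p' t)
      0 0 := by
    refine ⟨fun t ht => (hg t ht).sub (hg' t ht), fun t ht =>
      ((hp t ht).sub (hp' t ht)).congr_deriv ?_, fun t _ => hasDerivWithinAt_const _ _ _,
      fun t _ => (hasDerivWithinAt_const _ _ _).congr_deriv (by simp)⟩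
    simp only [Matrix.neg_mulVec, Matrix.mulVec_sub, Pi.zero_apply, Matrix.mulVec_zero]
    abel
  have h2 : IsCoupledTrajectory (fun t => -M t) 0 0 0 (0 : ℝ → Fin d → ℝ) 0 0 0 := by
    refine ⟨fun t _ => hasDerivWithinAt_const _ _ _,
      fun t _ => (hasDerivWithinAt_const _ _ _).congr_deriv (by simp),
      fun t _ => hasDerivWithinAt_const _ _ _,
      fun t _ => (hasDerivWithinAt_const _ _ _).congr_deriv (by simp)⟩
  exact sub_eq_zero.1 (h1.eq hM.neg continuous_const continuous_const continuous_const h2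
    (by simp [e₁]) (by simp [e₂]) rfl rfl ht).1

end CoupledTrajectories

/-! ### Structure and uniqueness of solutions of the coupled system -/

section CoupledSystem

open scoped Matrix

variable {d : ℕ}

/-- Freezing a coefficient at its initial value for negative times makes it continuous on the whole
line, as the linear theory requires. -/
theorem ContinuousOn.continuous_comp_max {X : Type*} [TopologicalSpace X] {f : ℝ → X}
    (hf : ContinuousOn f (Ici 0)) : Continuous fun t => f (max t 0) :=
  hf.comp_continuous (by fun_prop) fun t => le_max_right t 0

/-- Solutions to the system of envelope equations, in coordinates. -/
structure IsCoupledSolution (M₁ M₂ Q₁ Q₂ : ℝ → Matrix (Fin d) (Fin d) ℝ)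
    (H : Matrix (Fin d) (Fin d) ℝ) (k : ℕ) (a₁ a₂ : L2 d) (u₁ u₂ : ℝ → L2 d) : Prop where
  continuous₁ : ContinuousInSigma k u₁
  continuous₂ : ContinuousInSigma k u₂
  initial₁ : u₁ 0 = a₁
  initial₂ : u₂ 0 = a₂
  equation₁ : IsWeakSchrodinger (fun t => coupledPotential (M₁ t) H (Q₁ t) (u₁ t) (u₂ t)) u₁
  equation₂ : IsWeakSchrodinger (fun t => coupledPotential (M₂ t) H (Q₂ t) (u₂ t) (u₁ t)) u₂

theorem MetaplecticFlow.exists_firstMoment_trajectory {M : ℝ → Matrix (Fin d) (Fin d) ℝ}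
    {b : ℝ → Fin d → ℝ} (F : MetaplecticFlow M b) (hM : Continuous M) (hb : Continuous b)
    {a : L2 d} {x D : Fin d → L2 d} (hx : ∀ i, IsMulCoord i a (x i))
    (hD : ∀ i, IsWeakPartial i a (D i)) : ∃ g p : ℝ → Fin d → ℝ,
    (∀ t, 0 ≤ t → HasDerivWithinAt g (p t) (Ici 0) t) ∧
    (∀ t, 0 ≤ t → HasDerivWithinAt p (-(M t *ᵥ g t) + ‖a‖ ^ 2 • b t) (Ici 0) t) ∧
    (g 0 = fun j => (inner ℂ (x j) a).re) ∧
    (p 0 = fun j => (Complex.I * inner ℂ (D j) a).re) ∧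
    ∀ t, 0 ≤ t → (firstMoment (F.prop hM hb t a)).ofLp = g t := by
  obtain ⟨g, p, hg, hp, g0, p0, h⟩ := F.exists_moment_trajectory hM hb (a := a) (x := x) (D := D)
  refine ⟨g, p, fun t _ => (hg t).hasDerivWithinAt, fun t _ => (hp t).hasDerivWithinAt, g0, p0,
    fun t ht => funext fun j => ?_⟩
  rw [h]
  exact firstMoment_apply (fun j => F.isMulCoord_propX hM hb hx hD j ht) j

/-- A solution to an envelope equation is, up to a phase, an evolved state. -/
theorem IsWeakSchrodinger.eq_exp_smul_prop {M Q : ℝ → Matrix (Fin d) (Fin d) ℝ}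
    {H : Matrix (Fin d) (Fin d) ℝ} {b : ℝ → Fin d → ℝ} (F : MetaplecticFlow M b)
    (hM : Continuous M) (hb : Continuous b) {w w' : ℝ → L2 d} (hw : ContinuousOn w (Ici 0))
    (h : IsWeakSchrodinger (fun t => coupledPotential (M t) H (Q t) (w t) (w' t)) w)
    (hb' : ∀ t, 0 ≤ t → b t = H *ᵥ (firstMoment (w t)).ofLp + Q t *ᵥ (firstMoment (w' t)).ofLp)
    {c θ : ℝ → ℝ} (hθ : ∀ t, HasDerivAt θ (c t) t) (hθ0 : θ 0 = 0)
    (hc : ∀ t, 0 ≤ t → c t = 1 / 2 * matrixMoment H (w t) + 1 / 2 * matrixMoment (Q t) (w' t))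
    {t : ℝ} (ht : 0 ≤ t) :
    w t = Complex.exp (-(Complex.I * θ t)) • F.prop hM hb t (w 0) := by
  have h1 : IsWeakSchrodinger (fun t y => quadPotential M b t y + c t) w := by
    refine h.congr (fun t ht => ?_) fun t _ => rfl
    funext y
    rw [coupledPotential, hc t ht, quadPotential, quadPotential, hb' t ht]
  have h2 := (h1.gauge hθ).congr (W' := quadPotential M b) (u' := _)
    (fun t _ => by funext y; simp) fun t _ => rfl
  have hθc : Continuous θ := continuous_iff_continuousAt.2 fun t => (hθ t).continuousAt
  have h3 := F.eq_prop_of_isWeakSchrodinger hM hb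
    (((by fun_prop : Continuous fun t => Complex.exp (Complex.I * θ t)).continuousOn).smul hw) h2 ht
  simp only [hθ0, Complex.ofReal_zero, mul_zero, Complex.exp_zero, one_smul, Pi.smul_apply'] at h3
  rw [← h3, smul_smul, ← Complex.exp_add, neg_add_cancel, Complex.exp_zero, one_smul]

theorem norm_exp_I_mul (r : ℝ) : ‖Complex.exp (Complex.I * r)‖ = 1 := by
  rw [mul_comm]; exact Complex.norm_exp_ofReal_mul_I r

theorem norm_exp_neg_I_mul (r : ℝ) : ‖Complex.exp (-(Complex.I * r))‖ = 1 := by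
  have := norm_exp_I_mul (-r)
  rwa [Complex.ofReal_neg, mul_neg] at this

namespace IsCoupledSolution

variable {M₁ M₂ Q₁ Q₂ : ℝ → Matrix (Fin d) (Fin d) ℝ} {H : Matrix (Fin d) (Fin d) ℝ} {k : ℕ}
  {a₁ a₂ : L2 d} {u₁ u₂ w₁ w₂ : ℝ → L2 d}

theorem symm (h : IsCoupledSolution M₁ M₂ Q₁ Q₂ H k a₁ a₂ u₁ u₂) :
    IsCoupledSolution M₂ M₁ Q₂ Q₁ H k a₂ a₁ u₂ u₁ :=
  ⟨h.continuous₂, h.continuous₁, h.initial₂, h.initial₁, h.equation₂, h.equation₁⟩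

/-- The linear part of the potential that a solution generates for its first component. -/
noncomputable def force (Q : ℝ → Matrix (Fin d) (Fin d) ℝ) (H : Matrix (Fin d) (Fin d) ℝ)
    (u u' : ℝ → L2 d) (t : ℝ) : Fin d → ℝ :=
  H *ᵥ (firstMoment (u (max t 0))).ofLp + Q (max t 0) *ᵥ (firstMoment (u' (max t 0))).ofLp

/-- The spatially constant part of the potential that a solution generates. -/
noncomputable def energy (Q : ℝ → Matrix (Fin d) (Fin d) ℝ) (H : Matrix (Fin d) (Fin d) ℝ)
    (u u' : ℝ → L2 d) (t : ℝ) : ℝ :=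
  1 / 2 * matrixMoment H (u (max t 0)) + 1 / 2 * matrixMoment (Q (max t 0)) (u' (max t 0))

theorem continuous_force {Q : ℝ → Matrix (Fin d) (Fin d) ℝ} (hQ : Continuous Q) {u u' : ℝ → L2 d}
    (hu : ContinuousInSigma (k + 1) u) (hu' : ContinuousInSigma (k + 1) u') :
    Continuous (force Q H u u') :=
  (continuous_const.matrix_mulVec hu.continuousOn_firstMoment.continuous_comp_max).add
    ((hQ.comp (by fun_prop)).matrix_mulVec hu'.continuousOn_firstMoment.continuous_comp_max)

theorem continuous_energy {Q : ℝ → Matrix (Fin d) (Fin d) ℝ} (hQ : Continuous Q) {u u' : ℝ → L2 d}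
    (hu : ContinuousInSigma (k + 1) u) (hu' : ContinuousInSigma (k + 1) u') :
    Continuous (energy Q H u u') :=
  (continuous_const.mul (hu.continuousOn_matrixMoment continuous_const).continuous_comp_max).add
    (continuous_const.mul (hu'.continuousOn_matrixMoment hQ).continuous_comp_max)

variable (hM₁ : Continuous M₁) (hM₂ : Continuous M₂) (hM₁s : ∀ t, (M₁ t).IsSymm)
  (hM₂s : ∀ t, (M₂ t).IsSymm) (hQ₁ : Continuous Q₁) (hQ₂ : Continuous Q₂)

-- Once the moments of the given solution are regarded as known coefficients, the equation is linear
-- with a spatially constant term, which a phase removes.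
include hM₁ hM₁s hQ₁ in
theorem exists_eq_exp_smul_prop (h : IsCoupledSolution M₁ M₂ Q₁ Q₂ H (k + 1) a₁ a₂ u₁ u₂) :
    ∃ (F : MetaplecticFlow M₁ (force Q₁ H u₁ u₂)) (hb : Continuous (force Q₁ H u₁ u₂)) (θ : ℝ → ℝ),
      θ 0 = 0 ∧ (∀ t, HasDerivAt θ (energy Q₁ H u₁ u₂ t) t) ∧
      ∀ t, 0 ≤ t → u₁ t = Complex.exp (-(Complex.I * θ t)) • F.prop hM₁ hb t a₁ := by
  have hb := continuous_force (H := H) hQ₁ h.continuous₁ h.continuous₂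
  have hc := continuous_energy (H := H) hQ₁ h.continuous₁ h.continuous₂
  obtain ⟨F⟩ := exists_metaplecticFlow hM₁ hM₁s hb
  have hθ := hasDerivAt_integral_of_continuous hc
  refine ⟨F, hb, _, intervalIntegral.integral_same, hθ, fun t ht => ?_⟩
  rw [← h.initial₁]
  exact h.equation₁.eq_exp_smul_prop F hM₁ hb h.continuous₁.continuousOn
    (fun t ht => by rw [force, max_eq_left ht]) hθ intervalIntegral.integral_same
    (fun t ht => by rw [energy, max_eq_left ht]) ht

include hM₁ hM₁s hQ₁ in
theorem norm_eq (h : IsCoupledSolution M₁ M₂ Q₁ Q₂ H (k + 1) a₁ a₂ u₁ u₂) {t : ℝ} (ht : 0 ≤ t) :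
    ‖u₁ t‖ = ‖a₁‖ := by
  obtain ⟨F, hb, θ, -, -, e⟩ := h.exists_eq_exp_smul_prop hM₁ hM₁s hQ₁
  rw [e t ht, norm_smul, norm_exp_neg_I_mul, one_mul, LinearIsometry.norm_map]

-- Phases do not change the first moment, so Ehrenfest's law for the linear evolution applies, with
-- the force generated by the solution itself.
include hM₁ hM₁s hQ₁ in
theorem exists_trajectory (h : IsCoupledSolution M₁ M₂ Q₁ Q₂ H (k + 1) a₁ a₂ u₁ u₂)
    {x D : Fin d → L2 d} (hx : ∀ i, IsMulCoord i a₁ (x i)) (hD : ∀ i, IsWeakPartial i a₁ (D i)) :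
    ∃ g p : ℝ → Fin d → ℝ,
      (∀ t, 0 ≤ t → HasDerivWithinAt g (p t) (Ici 0) t) ∧
      (∀ t, 0 ≤ t → HasDerivWithinAt p (-(M₁ t *ᵥ g t) + ‖a₁‖ ^ 2 •
        (H *ᵥ g t + Q₁ t *ᵥ (firstMoment (u₂ t)).ofLp)) (Ici 0) t) ∧
      (g 0 = fun j => (inner ℂ (x j) a₁).re) ∧
      (p 0 = fun j => (Complex.I * inner ℂ (D j) a₁).re) ∧
      ∀ t, 0 ≤ t → (firstMoment (u₁ t)).ofLp = g t := by
  obtain ⟨F, hb, θ, -, -, e⟩ := h.exists_eq_exp_smul_prop hM₁ hM₁s hQ₁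
  obtain ⟨g, p, hg, hp, g0, p0, hm⟩ := F.exists_firstMoment_trajectory hM₁ hb hx hD
  have hm' : ∀ t, 0 ≤ t → (firstMoment (u₁ t)).ofLp = g t := fun t ht => by
    rw [e t ht, firstMoment_smul (norm_exp_neg_I_mul _), hm t ht]
  refine ⟨g, p, hg, fun t ht => (hp t ht).congr_deriv ?_, g0, p0, hm'⟩
  rw [force, max_eq_left ht, hm' t ht]

include hM₁ hM₂ hM₁s hM₂s hQ₁ hQ₂

/-- The two Ehrenfest equations together form a closed linear system for the pair of first moments,
whose coefficients and initial data depend only on `a₁` and `a₂` and the given matrices. -/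
theorem firstMoment_eq (h : IsCoupledSolution M₁ M₂ Q₁ Q₂ H (k + 1) a₁ a₂ u₁ u₂)
    (h' : IsCoupledSolution M₁ M₂ Q₁ Q₂ H (k + 1) a₁ a₂ w₁ w₂) {t : ℝ} (ht : 0 ≤ t) :
    (firstMoment (u₁ t)).ofLp = (firstMoment (w₁ t)).ofLp ∧
      (firstMoment (u₂ t)).ofLp = (firstMoment (w₂ t)).ofLp := by
  have ha₁ : MemSigma (k + 1) a₁ := h.initial₁ ▸ h.continuous₁.1 0 le_rfl
  have ha₂ : MemSigma (k + 1) a₂ := h.initial₂ ▸ h.continuous₂.1 0 le_rfl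
  choose x₁ hx₁ _ using fun j => ha₁.exists_isMulCoord j
  choose D₁ hD₁ using fun j => ha₁.exists_isWeakPartial j
  choose x₂ hx₂ _ using fun j => ha₂.exists_isMulCoord j
  choose D₂ hD₂ using fun j => ha₂.exists_isWeakPartial j
  have key : ∀ {v₁ v₂ : ℝ → L2 d}, IsCoupledSolution M₁ M₂ Q₁ Q₂ H (k + 1) a₁ a₂ v₁ v₂ →
      ∃ g₁ p₁ g₂ p₂ : ℝ → Fin d → ℝ, IsCoupledTrajectory
        (fun t => -M₁ t + ‖a₁‖ ^ 2 • H) (fun t => ‖a₁‖ ^ 2 • Q₁ t) (fun t => ‖a₂‖ ^ 2 • Q₂ t)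
        (fun t => -M₂ t + ‖a₂‖ ^ 2 • H) g₁ p₁ g₂ p₂ ∧
      (g₁ 0 = fun j => (inner ℂ (x₁ j) a₁).re) ∧
      (p₁ 0 = fun j => (Complex.I * inner ℂ (D₁ j) a₁).re) ∧
      (g₂ 0 = fun j => (inner ℂ (x₂ j) a₂).re) ∧
      (p₂ 0 = fun j => (Complex.I * inner ℂ (D₂ j) a₂).re) ∧
      (∀ t, 0 ≤ t → (firstMoment (v₁ t)).ofLp = g₁ t) ∧
      ∀ t, 0 ≤ t → (firstMoment (v₂ t)).ofLp = g₂ t := fun hv => by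
    obtain ⟨g₁, p₁, hg₁, hp₁, g₁0, p₁0, hm₁⟩ := hv.exists_trajectory hM₁ hM₁s hQ₁ hx₁ hD₁
    obtain ⟨g₂, p₂, hg₂, hp₂, g₂0, p₂0, hm₂⟩ := hv.symm.exists_trajectory hM₂ hM₂s hQ₂ hx₂ hD₂
    refine ⟨g₁, p₁, g₂, p₂, ⟨hg₁, fun t ht => (hp₁ t ht).congr_deriv ?_, hg₂,
      fun t ht => (hp₂ t ht).congr_deriv ?_⟩, g₁0, p₁0, g₂0, p₂0, hm₁, hm₂⟩
    · rw [hm₂ t ht]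
      simp only [Matrix.add_mulVec, Matrix.neg_mulVec, Matrix.smul_mulVec, smul_add]
      abel
    · rw [hm₁ t ht]
      simp only [Matrix.add_mulVec, Matrix.neg_mulVec, Matrix.smul_mulVec, smul_add]
      abel
  obtain ⟨g₁, p₁, g₂, p₂, hg, e₁, e₂, e₃, e₄, hm₁, hm₂⟩ := key h
  obtain ⟨g₁', p₁', g₂', p₂', hg', e₁', e₂', e₃', e₄', hm₁', hm₂'⟩ := key h'
  rw [hm₁ t ht, hm₂ t ht, hm₁' t ht, hm₂' t ht]
  have c₁ : Continuous fun t => -M₁ t + ‖a₁‖ ^ 2 • H := hM₁.neg.add continuous_const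
  have c₂ : Continuous fun t => -M₂ t + ‖a₂‖ ^ 2 • H := hM₂.neg.add continuous_const
  have c₃ : Continuous fun t => ‖a₁‖ ^ 2 • Q₁ t := by fun_prop
  have c₄ : Continuous fun t => ‖a₂‖ ^ 2 • Q₂ t := by fun_prop
  exact hg.eq c₁ c₃ c₄ c₂ hg' (e₁.trans e₁'.symm) (e₂.trans e₂'.symm)
    (e₃.trans e₃'.symm) (e₄.trans e₄'.symm) ht

/-- Equal first moments mean equal forces on `[0, ∞)`, so one and the same linear flow represents
both solutions. -/
theorem exists_phase_eq (h : IsCoupledSolution M₁ M₂ Q₁ Q₂ H (k + 1) a₁ a₂ u₁ u₂)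
    (h' : IsCoupledSolution M₁ M₂ Q₁ Q₂ H (k + 1) a₁ a₂ w₁ w₂) :
    ∃ (v : ℝ → L2 d) (θ θ' : ℝ → ℝ), θ 0 = 0 ∧ θ' 0 = 0 ∧
      (∀ t, HasDerivAt θ (energy Q₁ H u₁ u₂ t) t) ∧
      (∀ t, HasDerivAt θ' (energy Q₁ H w₁ w₂ t) t) ∧
      ∀ t, 0 ≤ t → u₁ t = Complex.exp (-(Complex.I * θ t)) • v t ∧
        w₁ t = Complex.exp (-(Complex.I * θ' t)) • v t := by
  obtain ⟨F, hb, θ, θ0, hθ, e⟩ := h.exists_eq_exp_smul_prop hM₁ hM₁s hQ₁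
  have hc := continuous_energy (H := H) hQ₁ h'.continuous₁ h'.continuous₂
  have hθ' := hasDerivAt_integral_of_continuous hc
  refine ⟨fun t => F.prop hM₁ hb t a₁, θ, _, θ0, intervalIntegral.integral_same, hθ, hθ',
    fun t ht => ⟨e t ht, ?_⟩⟩
  rw [← h'.initial₁]
  refine h'.equation₁.eq_exp_smul_prop F hM₁ hb h'.continuous₁.continuousOn (fun t ht => ?_) hθ'
    intervalIntegral.integral_same (fun t ht => by rw [energy, max_eq_left ht]) ht
  obtain ⟨e₁, e₂⟩ := h.firstMoment_eq hM₁ hM₂ hM₁s hM₂s hQ₁ hQ₂ h' ht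
  rw [force, max_eq_left ht, e₁, e₂]

theorem matrixMoment_eq (h : IsCoupledSolution M₁ M₂ Q₁ Q₂ H (k + 1) a₁ a₂ u₁ u₂)
    (h' : IsCoupledSolution M₁ M₂ Q₁ Q₂ H (k + 1) a₁ a₂ w₁ w₂) {t : ℝ} (ht : 0 ≤ t)
    (N : Matrix (Fin d) (Fin d) ℝ) : matrixMoment N (u₁ t) = matrixMoment N (w₁ t) := by
  obtain ⟨v, θ, θ', -, -, -, -, e⟩ := h.exists_phase_eq hM₁ hM₂ hM₁s hM₂s hQ₁ hQ₂ h'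
  rw [(e t ht).1, (e t ht).2, matrixMoment_smul _ (norm_exp_neg_I_mul _),
    matrixMoment_smul _ (norm_exp_neg_I_mul _)]

/-- Solutions that differ by phases have the same second moments, hence the same energies. The
phases then have equal derivatives and both start at `0`. -/
theorem eq_fst (h : IsCoupledSolution M₁ M₂ Q₁ Q₂ H (k + 1) a₁ a₂ u₁ u₂)
    (h' : IsCoupledSolution M₁ M₂ Q₁ Q₂ H (k + 1) a₁ a₂ w₁ w₂) {t : ℝ} (ht : 0 ≤ t) :
    u₁ t = w₁ t := by
  obtain ⟨v, θ, θ', θ0, θ0', hθ, hθ', e⟩ := h.exists_phase_eq hM₁ hM₂ hM₁s hM₂s hQ₁ hQ₂ h'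
  have hE : energy Q₁ H u₁ u₂ = energy Q₁ H w₁ w₂ := funext fun s => by
    rw [energy, energy, h.matrixMoment_eq hM₁ hM₂ hM₁s hM₂s hQ₁ hQ₂ h' (le_max_right s 0),
      h.symm.matrixMoment_eq hM₂ hM₁ hM₂s hM₁s hQ₂ hQ₁ h'.symm (le_max_right s 0)]
  have hθθ := eq_const_of_hasDerivAt_zero (f := fun t => θ t - θ' t)
    (fun s => ((hθ s).sub (hθ' s)).congr_deriv (by rw [hE, sub_self])) t
  rw [θ0, θ0', sub_self] at hθθ
  rw [(e t ht).1, (e t ht).2, sub_eq_zero.1 hθθ]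

end IsCoupledSolution

end CoupledSystem

/-! ### Construction of a solution -/

section Existence

open scoped Matrix

variable {d : ℕ} {M₁ M₂ Q₁ Q₂ : ℝ → Matrix (Fin d) (Fin d) ℝ} {H : Matrix (Fin d) (Fin d) ℝ} {k : ℕ}
  {a₁ a₂ : L2 d}

/-- Self-consistency: a trajectory prescribed in advance, with the right Newton equation and initial
data, is the actual first moment of the evolved state. -/
theorem MetaplecticFlow.firstMoment_prop_eq {M : ℝ → Matrix (Fin d) (Fin d) ℝ}
    {b : ℝ → Fin d → ℝ} (F : MetaplecticFlow M b) (hM : Continuous M) (hb : Continuous b)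
    {a : L2 d} {x D : Fin d → L2 d} (hx : ∀ i, IsMulCoord i a (x i))
    (hD : ∀ i, IsWeakPartial i a (D i)) {g p : ℝ → Fin d → ℝ}
    (hg : ∀ t, 0 ≤ t → HasDerivWithinAt g (p t) (Ici 0) t)
    (hp : ∀ t, 0 ≤ t → HasDerivWithinAt p (-(M t *ᵥ g t) + ‖a‖ ^ 2 • b t) (Ici 0) t)
    (hg0 : g 0 = fun j => (inner ℂ (x j) a).re)
    (hp0 : p 0 = fun j => (Complex.I * inner ℂ (D j) a).re) {t : ℝ} (ht : 0 ≤ t) :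
    (firstMoment (F.prop hM hb t a)).ofLp = g t := by
  obtain ⟨γ, π, hγ, hπ, γ0, π0, hm⟩ := F.exists_firstMoment_trajectory hM hb hx hD
  rw [hm t ht]
  exact newton_unique hM hγ hπ hg hp (γ0.trans hg0.symm) (π0.trans hp0.symm) ht

/-- The energy can be computed from the states before the phases are attached, because moments
ignore phases; hence no fixed point is needed for the constant term. -/
theorem isWeakSchrodinger_coupledPotential {M Q : ℝ → Matrix (Fin d) (Fin d) ℝ} {b : ℝ → Fin d → ℝ}
    {v v' : ℝ → L2 d} (hv : IsWeakSchrodinger (quadPotential M b) v)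
    (hb : ∀ t, 0 ≤ t → b t = H *ᵥ (firstMoment (v t)).ofLp + Q t *ᵥ (firstMoment (v' t)).ofLp)
    {θ θ' : ℝ → ℝ} (hθ : ∀ t, HasDerivAt θ (-IsCoupledSolution.energy Q H v v' t) t) :
    IsWeakSchrodinger (fun t => coupledPotential (M t) H (Q t)
      (Complex.exp (Complex.I * θ t) • v t) (Complex.exp (Complex.I * θ' t) • v' t))
      fun t => Complex.exp (Complex.I * θ t) • v t := by
  have h0 : IsWeakSchrodinger (fun t y => quadPotential M b t y + (fun _ => (0 : ℝ)) t) v := by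
    simpa using hv
  refine (h0.gauge hθ).congr (fun t ht => ?_) fun _ _ => rfl
  funext y
  rw [coupledPotential, firstMoment_smul (norm_exp_I_mul _), firstMoment_smul (norm_exp_I_mul _),
    matrixMoment_smul _ (norm_exp_I_mul _), matrixMoment_smul _ (norm_exp_I_mul _),
    IsCoupledSolution.energy, max_eq_left ht, quadPotential, quadPotential, hb t ht]
  ring

theorem exists_isCoupledSolution (hM₁ : Continuous M₁) (hM₂ : Continuous M₂)
    (hM₁s : ∀ t, (M₁ t).IsSymm) (hM₂s : ∀ t, (M₂ t).IsSymm) (hQ₁ : Continuous Q₁)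
    (hQ₂ : Continuous Q₂) (ha₁ : MemSigma (k + 1) a₁) (ha₂ : MemSigma (k + 1) a₂) :
    ∃ u₁ u₂, IsCoupledSolution M₁ M₂ Q₁ Q₂ H (k + 1) a₁ a₂ u₁ u₂ := by
  choose x₁ hx₁ _ using fun j => ha₁.exists_isMulCoord j
  choose D₁ hD₁ using fun j => ha₁.exists_isWeakPartial j
  choose x₂ hx₂ _ using fun j => ha₂.exists_isMulCoord j
  choose D₂ hD₂ using fun j => ha₂.exists_isWeakPartial j
  have c₁ : Continuous fun t => -M₁ t + ‖a₁‖ ^ 2 • H := hM₁.neg.add continuous_const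
  have c₂ : Continuous fun t => -M₂ t + ‖a₂‖ ^ 2 • H := hM₂.neg.add continuous_const
  have c₃ : Continuous fun t => ‖a₁‖ ^ 2 • Q₁ t := by fun_prop
  have c₄ : Continuous fun t => ‖a₂‖ ^ 2 • Q₂ t := by fun_prop
  -- The first moments are found before the wave functions: the closed Ehrenfest system is solved
  -- with the position and momentum moments of `a₁` and `a₂` as initial data.
  obtain ⟨g₁, p₁, g₂, p₂, hg, hg₁, hg₂, g₁0, p₁0, g₂0, p₂0⟩ := exists_isCoupledTrajectory c₁ c₃ c₄ c₂
    (fun j => (inner ℂ (x₁ j) a₁).re) (fun j => (Complex.I * inner ℂ (D₁ j) a₁).re)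
    (fun j => (inner ℂ (x₂ j) a₂).re) (fun j => (Complex.I * inner ℂ (D₂ j) a₂).re)
  have hb₁ : Continuous fun t => H *ᵥ g₁ t + Q₁ t *ᵥ g₂ t :=
    (continuous_const.matrix_mulVec hg₁).add (hQ₁.matrix_mulVec hg₂)
  have hb₂ : Continuous fun t => H *ᵥ g₂ t + Q₂ t *ᵥ g₁ t :=
    (continuous_const.matrix_mulVec hg₂).add (hQ₂.matrix_mulVec hg₁)
  obtain ⟨F₁⟩ := exists_metaplecticFlow hM₁ hM₁s hb₁
  obtain ⟨F₂⟩ := exists_metaplecticFlow hM₂ hM₂s hb₂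
  have m₁ : ∀ t, 0 ≤ t → (firstMoment (F₁.prop hM₁ hb₁ t a₁)).ofLp = g₁ t := fun t ht =>
    F₁.firstMoment_prop_eq hM₁ hb₁ hx₁ hD₁ hg.deriv_g₁ (fun t ht =>
      (hg.deriv_p₁ t ht).congr_deriv (by
        simp only [Matrix.add_mulVec, Matrix.neg_mulVec, Matrix.smul_mulVec, smul_add]
        abel)) g₁0 p₁0 ht
  have m₂ : ∀ t, 0 ≤ t → (firstMoment (F₂.prop hM₂ hb₂ t a₂)).ofLp = g₂ t := fun t ht =>
    F₂.firstMoment_prop_eq hM₂ hb₂ hx₂ hD₂ hg.deriv_g₂ (fun t ht =>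
      (hg.deriv_p₂ t ht).congr_deriv (by
        simp only [Matrix.add_mulVec, Matrix.neg_mulVec, Matrix.smul_mulVec, smul_add]
        abel)) g₂0 p₂0 ht
  set v₁ : ℝ → L2 d := fun t => F₁.prop hM₁ hb₁ t a₁ with hv₁
  set v₂ : ℝ → L2 d := fun t => F₂.prop hM₂ hb₂ t a₂ with hv₂
  have s₁ : ContinuousInSigma (k + 1) v₁ := F₁.continuousInSigma_prop hM₁ hb₁ _ _ ha₁
  have s₂ : ContinuousInSigma (k + 1) v₂ := F₂.continuousInSigma_prop hM₂ hb₂ _ _ ha₂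
  have hθ₁ := hasDerivAt_integral_of_continuous
    (IsCoupledSolution.continuous_energy (H := H) hQ₁ s₁ s₂).neg
  have hθ₂ := hasDerivAt_integral_of_continuous
    (IsCoupledSolution.continuous_energy (H := H) hQ₂ s₂ s₁).neg
  set θ₁ : ℝ → ℝ := fun t => ∫ s in (0 : ℝ)..t, (-IsCoupledSolution.energy Q₁ H v₁ v₂) s
  set θ₂ : ℝ → ℝ := fun t => ∫ s in (0 : ℝ)..t, (-IsCoupledSolution.energy Q₂ H v₂ v₁) s
  have hc₁ : Continuous θ₁ := continuous_iff_continuousAt.2 fun t => (hθ₁ t).continuousAt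
  have hc₂ : Continuous θ₂ := continuous_iff_continuousAt.2 fun t => (hθ₂ t).continuousAt
  refine ⟨fun t => Complex.exp (Complex.I * θ₁ t) • v₁ t,
    fun t => Complex.exp (Complex.I * θ₂ t) • v₂ t, s₁.smul (by fun_prop), s₂.smul (by fun_prop),
    ?_, ?_, ?_, ?_⟩
  · simp [θ₁, hv₁, F₁.prop_zero]
  · simp [θ₂, hv₂, F₂.prop_zero]
  · exact isWeakSchrodinger_coupledPotential (F₁.isWeakSchrodinger_prop hM₁ hb₁ a₁)
      (fun t ht => by rw [m₁ t ht, m₂ t ht]) hθ₁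
  · exact isWeakSchrodinger_coupledPotential (F₂.isWeakSchrodinger_prop hM₂ hb₂ a₂)
      (fun t ht => by rw [m₁ t ht, m₂ t ht]) hθ₂

end Existence

/-! ### Regularity of the coefficients and the main theorem -/

section Coefficients

variable {d : ℕ}

theorem contDiff_potential {V : ℝ → Rd d → ℝ} (hV : AdmissiblePotential V) {t : ℝ} (ht : 0 ≤ t) :
    ContDiff ℝ 3 (V t) := by
  have h : ContDiff ℝ 3 fun x : Rd d => (t, x) := contDiff_const.prodMk contDiff_id
  exact contDiffOn_univ.1 (hV.1.comp h.contDiffOn fun x _ => ⟨ht, mem_univ _⟩)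

theorem hasFDerivAt_slice {E : Type*} [NormedAddCommGroup E] [NormedSpace ℝ E] {f : ℝ × Rd d → E}
    (hf : DifferentiableOn ℝ f (Ici 0 ×ˢ univ)) {t : ℝ} (ht : 0 ≤ t) (x : Rd d) :
    HasFDerivAt (fun x => f (t, x)) ((fderivWithin ℝ f (Ici 0 ×ˢ univ) (t, x)).comp
      (ContinuousLinearMap.inr ℝ ℝ (Rd d))) x := by
  have h1 := (hf (t, x) ⟨ht, mem_univ _⟩).hasFDerivWithinAt
  have h2 : HasFDerivWithinAt (fun x : Rd d => (t, x)) (ContinuousLinearMap.inr ℝ ℝ (Rd d)) univ x :=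
    (hasFDerivAt_prodMk_right t x).hasFDerivWithinAt
  exact hasFDerivWithinAt_univ.1 (h1.comp x h2 fun x _ => ⟨ht, mem_univ _⟩)

theorem uniqueDiffOn_halfSpace : UniqueDiffOn ℝ (Ici (0 : ℝ) ×ˢ (univ : Set (Rd d))) :=
  (uniqueDiffOn_Ici 0).prod uniqueDiffOn_univ

/-- `V` is smooth only on the closed half-space, so joint continuity of its spatial Hessian is read
off from the second derivative within that set, restricted to spatial directions. -/
theorem hess_potential_eq {V : ℝ → Rd d → ℝ} (hV : AdmissiblePotential V) {t : ℝ} (ht : 0 ≤ t)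
    (x v w : Rd d) : hess (V t) x v w =
      fderivWithin ℝ (fderivWithin ℝ (fun z : ℝ × Rd d => V z.1 z.2) (Ici 0 ×ˢ univ))
        (Ici 0 ×ˢ univ) (t, x) (0, v) (0, w) := by
  have h1 : ContDiffOn ℝ 2 (fderivWithin ℝ (fun z : ℝ × Rd d => V z.1 z.2) (Ici 0 ×ˢ univ))
      (Ici 0 ×ˢ univ) := hV.1.fderivWithin uniqueDiffOn_halfSpace (by norm_num)
  have h2 : fderiv ℝ (V t) = fun x => (fderivWithin ℝ (fun z : ℝ × Rd d => V z.1 z.2)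
      (Ici 0 ×ˢ univ) (t, x)).comp (ContinuousLinearMap.inr ℝ ℝ (Rd d)) := funext fun x =>
    (hasFDerivAt_slice (hV.1.differentiableOn (by norm_num)) ht x).fderiv
  have h3 := hasFDerivAt_slice (h1.differentiableOn (by norm_num)) ht x
  rw [hess, h2, (h3.clm_comp (hasFDerivAt_const _ x)).fderiv]
  simp

theorem continuousOn_hessMatrix_potential {V : ℝ → Rd d → ℝ} (hV : AdmissiblePotential V)
    {q : ℝ → Rd d} (hq : ContinuousOn q (Ici 0)) :
    ContinuousOn (fun t => hessMatrix (V t) (q t)) (Ici 0) := by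
  have h1 : ContDiffOn ℝ 2 (fderivWithin ℝ (fun z : ℝ × Rd d => V z.1 z.2) (Ici 0 ×ˢ univ))
      (Ici 0 ×ˢ univ) := hV.1.fderivWithin uniqueDiffOn_halfSpace (by norm_num)
  have h2 := (h1.continuousOn_fderivWithin uniqueDiffOn_halfSpace (by norm_num)).comp
    (continuousOn_id.prodMk hq) fun t ht => ⟨ht, mem_univ _⟩
  refine continuousOn_pi.2 fun i => continuousOn_pi.2 fun j => ?_
  refine ((h2.clm_apply (continuousOn_const (c := (0, EuclideanSpace.single i 1)))).clm_apply
    (continuousOn_const (c := (0, EuclideanSpace.single j 1)))).congr fun t ht => ?_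
  exact hess_potential_eq hV ht _ _ _

theorem continuous_hessMatrix {K : Rd d → ℝ} (hK : ContDiff ℝ 3 K) : Continuous (hessMatrix K) := by
  have h1 : ContDiff ℝ 2 (fderiv ℝ K) := hK.fderiv_right (by norm_num)
  have h2 := h1.continuous_fderiv (by norm_num)
  refine continuous_pi fun i => continuous_pi fun j => ?_
  exact (h2.clm_apply continuous_const).clm_apply continuous_const

/-- The matrix of the quadratic part of the envelope potential, extended to negative times. -/
noncomputable def envelopeMatrix (V : ℝ → Rd d → ℝ) (K : Rd d → ℝ) (m m' : ℝ) (q q' : ℝ → Rd d)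
    (t : ℝ) : Matrix (Fin d) (Fin d) ℝ :=
  m • hessMatrix K 0 + m' • hessMatrix K (q (max t 0) - q' (max t 0)) +
    hessMatrix (V (max t 0)) (q (max t 0))

theorem continuous_interaction {K : Rd d → ℝ} (hK : ContDiff ℝ 3 K) {q q' : ℝ → Rd d}
    (hq : ContinuousOn q (Ici 0)) (hq' : ContinuousOn q' (Ici 0)) :
    Continuous fun t => hessMatrix K (q (max t 0) - q' (max t 0)) :=
  (continuous_hessMatrix hK).comp (hq.continuous_comp_max.sub hq'.continuous_comp_max)

theorem continuous_envelopeMatrix {V : ℝ → Rd d → ℝ} {K : Rd d → ℝ} (hV : AdmissiblePotential V)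
    (hK : ContDiff ℝ 3 K) (m m' : ℝ) {q q' : ℝ → Rd d} (hq : ContinuousOn q (Ici 0))
    (hq' : ContinuousOn q' (Ici 0)) : Continuous (envelopeMatrix V K m m' q q') := by
  have h1 := continuous_interaction hK hq hq'
  have h2 := (continuousOn_hessMatrix_potential hV hq).continuous_comp_max
  unfold envelopeMatrix
  fun_prop

theorem isSymm_envelopeMatrix {V : ℝ → Rd d → ℝ} {K : Rd d → ℝ} (hV : AdmissiblePotential V)
    (hK : ContDiff ℝ 3 K) (m m' : ℝ) (q q' : ℝ → Rd d) (t : ℝ) :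
    (envelopeMatrix V K m m' q q' t).IsSymm :=
  (((isSymm_hessMatrix hK 0).smul m).add ((isSymm_hessMatrix hK _).smul m')).add
    (isSymm_hessMatrix (contDiff_potential hV (le_max_right t 0)) _)

/-- Both notions test only times `t ≥ 0`, where the clamped coefficients agree with the original
ones. -/
theorem isEnvelopeSolution_iff {V : ℝ → Rd d → ℝ} {K : Rd d → ℝ} (hK : ContDiff ℝ 3 K)
    (q₁ q₂ : ℝ → Rd d) (k : ℕ) (a₁ a₂ : L2 d) (u₁ u₂ : ℝ → L2 d) :
    IsEnvelopeSolution V K q₁ q₂ k a₁ a₂ u₁ u₂ ↔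
      IsCoupledSolution (envelopeMatrix V K (‖a₁‖ ^ 2) (‖a₂‖ ^ 2) q₁ q₂)
        (envelopeMatrix V K (‖a₂‖ ^ 2) (‖a₁‖ ^ 2) q₂ q₁)
        (fun t => hessMatrix K (q₁ (max t 0) - q₂ (max t 0)))
        (fun t => hessMatrix K (q₂ (max t 0) - q₁ (max t 0)))
        (hessMatrix K 0) k a₁ a₂ u₁ u₂ := by
  have e : ∀ (m m' : ℝ) (q q' : ℝ → Rd d) (u u' : ℝ → L2 d) (t : ℝ), 0 ≤ t →
      envelopePotential V K m m' t (q t) (q' t) (u t) (u' t) =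
        coupledPotential (envelopeMatrix V K m m' q q' t) (hessMatrix K 0)
          (hessMatrix K (q (max t 0) - q' (max t 0))) (u t) (u' t) := fun m m' q q' u u' t ht => by
    funext y
    rw [envelopePotential_eq V hK, envelopeMatrix, max_eq_left ht]
  constructor
  · intro h
    exact ⟨h.continuous₁, h.continuous₂, h.initial₁, h.initial₂,
      h.equation₁.congr (fun t ht => (e _ _ _ _ _ _ t ht).symm) fun _ _ => rfl,
      h.equation₂.congr (fun t ht => (e _ _ _ _ _ _ t ht).symm) fun _ _ => rfl⟩
  · intro h
    exact ⟨h.continuous₁, h.continuous₂, h.initial₁, h.initial₂,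
      h.equation₁.congr (fun t ht => e _ _ _ _ _ _ t ht) fun _ _ => rfl,
      h.equation₂.congr (fun t ht => e _ _ _ _ _ _ t ht) fun _ _ => rfl⟩

end Coefficients

theorem mainTheorem6 {d : ℕ} (hd : 1 ≤ d) (V : ℝ → Rd d → ℝ) (K : Rd d → ℝ)
    (hV : AdmissiblePotential V) (hK : AdmissibleKernel K)
    (k : ℕ) (hk : 1 ≤ k) (a₁ a₂ : L2 d) (ha₁ : MemSigma k a₁) (ha₂ : MemSigma k a₂)
    (q₁ p₁ q₂ p₂ : ℝ → Rd d)
    (hqp : IsModifiedTrajectory V K (‖a₁‖ ^ 2) (‖a₂‖ ^ 2) q₁ p₁ q₂ p₂) :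
    ∃ u₁ u₂ : ℝ → L2 d,
      IsEnvelopeSolution V K q₁ q₂ k a₁ a₂ u₁ u₂ ∧
      (∀ t, 0 ≤ t → ‖u₁ t‖ = ‖a₁‖ ∧ ‖u₂ t‖ = ‖a₂‖) ∧
      ∀ w₁ w₂ : ℝ → L2 d, IsEnvelopeSolution V K q₁ q₂ k a₁ a₂ w₁ w₂ →
        ∀ t, 0 ≤ t → w₁ t = u₁ t ∧ w₂ t = u₂ t := by
  -- At least one order in `Σ^k` is what places `y_j a` and `∂_j a` in `L²`, so that the moments are
  -- defined and continuous.
  obtain ⟨k, rfl⟩ := Nat.exists_eq_add_of_le' hk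
  have hq₁ : ContinuousOn q₁ (Ici 0) := fun t ht => (hqp.deriv_q₁ t ht).continuousWithinAt
  have hq₂ : ContinuousOn q₂ (Ici 0) := fun t ht => (hqp.deriv_q₂ t ht).continuousWithinAt
  have hM₁ := continuous_envelopeMatrix hV hK.1 (‖a₁‖ ^ 2) (‖a₂‖ ^ 2) hq₁ hq₂
  have hM₂ := continuous_envelopeMatrix hV hK.1 (‖a₂‖ ^ 2) (‖a₁‖ ^ 2) hq₂ hq₁
  have hM₁s := isSymm_envelopeMatrix hV hK.1 (‖a₁‖ ^ 2) (‖a₂‖ ^ 2) q₁ q₂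
  have hM₂s := isSymm_envelopeMatrix hV hK.1 (‖a₂‖ ^ 2) (‖a₁‖ ^ 2) q₂ q₁
  have hQ₁ := continuous_interaction hK.1 hq₁ hq₂
  have hQ₂ := continuous_interaction hK.1 hq₂ hq₁
  simp only [isEnvelopeSolution_iff hK.1]
  obtain ⟨u₁, u₂, hu⟩ := exists_isCoupledSolution (H := hessMatrix K 0) hM₁ hM₂ hM₁s hM₂s hQ₁ hQ₂
    ha₁ ha₂
  exact ⟨u₁, u₂, hu, fun t ht => ⟨hu.norm_eq hM₁ hM₁s hQ₁ ht, hu.symm.norm_eq hM₂ hM₂s hQ₂ ht⟩,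
    fun w₁ w₂ hw t ht => ⟨hw.eq_fst hM₁ hM₂ hM₁s hM₂s hQ₁ hQ₂ hu ht,
      hw.symm.eq_fst hM₂ hM₁ hM₂s hM₁s hQ₂ hQ₁ hu.symm ht⟩⟩
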